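/- Let $\theta\in(0,1)$ and $\delta>0$. For $n\in\mathbb N$ let $k=\lfloor n^{\theta}\rfloor$, and let the ground truth $\sigma\in\{0,1\}^n$ be uniformly distributed over all vectors with exactly $k$ ones. In quantitative group testing a pool is a subset of the $n$ items, and its measurement reveals the number of items of label $1$ in it; all pools are fixed in advance, independently of $\sigma$. **Theorem.** There exist a randomised non-adaptive pooling scheme $G$ on at most $$(1+\delta)\cdot\frac{1+\sqrt\theta}{1-\sqrt\theta}\cdot\frac{2(1-\theta)}{\theta}\,k$$ pools (for all large $n$) and a polynomial-time algorithm that, given $G$ and the measurement results of its pools, outputs $\sigma$ with probability tending to $1$ as $n\to\infty$ (over $G$ and $\sigma$). More precisely, the scheme can be taken to be an augmented spatially coupled design, and the algorithm to be a sequential thresholding algorithm, as follows. *Design.* There are integers $\ell=o(k)$, $s=o(\ell)$ with $s\to\infty$, and $g,p$, all depending on $n$. The $n$ items are split into $\ell$ compartments $V[s],\dots,V[\ell+s-1]$ of sizes $\lfloor n/\ell\rfloor$ or $\lceil n/\ell\rceil$. There are $s-1$ further compartments $V[1],\dots,V[s-1]$ of $\lceil n/\ell\rceil$ auxiliary items each,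 whose labels are uniformly random with exactly $\lceil (s-1)k/\ell\rceil$ ones and are known to the algorithm. There are $\ell+s-1$ pool compartments $F[1],\dots,F[\ell+s-1]$ of $p$ pools each; every pool in $F[i]$ contains exactly $g$ items from each of $V[i-s+1],\dots,V[i]$ (indices modulo $\ell+s-1$), chosen uniformly without replacement and independently for different compartments and pools. In addition, for each $i\in\{s,\dots,\ell+s-1\}$ one pool consists of all items of $V[i]$. The total number of pools is $m+\ell$ with $m=p(\ell+s-1)$. The graph, the auxiliary labels and $\sigma$ are independent. *Algorithm.* Let $k[r]$ be the number of ones in $V[r]$, and $\hat\sigma_a$ the number of ones in the pool $a$ (auxiliary items included); both are determined by the measurements and the auxiliary labels. The estimate $\tilde\sigma$ starts with the known auxiliary labels, and with $0$ on the $n$ items. For $i=s,\dots,\ell+s-1$ in turn, all items $x\in V[i]$ with $\mathcal N_x>T$ are given the label $1$, where, with $\Delta_x[j]$ the number of pools in $F[i+j]$ containing $x$ and $\Delta/s=pg/\lceil n/\ell\rceil$, $$\mathcal N_x=\sum_{j=0}^{s-1}\frac{\mathcal U_x^j-\mathcal M_x^j}{(j+1)\frac{\Delta}{s}\sqrt{k/m}},\qquad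 \mathcal U_x^j=\sum_{a\in F[i+j],\,a\ni x}\Big(\hat\sigma_a-\sum_{r=i-s+j+1}^{i-1}\ \sum_{y\in a\cap V[r]}\tilde\sigma_y\Big),$$ $$\mathcal M_x^j=\Delta_x[j]\sum_{r=0}^{j}\big(g-\mathbf 1\{r=0\}\big)\frac{k[i+r]}{|V[i+r]\setminus\{x\}|}.$$ The thresholds satisfy $T=(\alpha+o(1))\sqrt{m/k}\,\ln s$ for some constant $\alpha\in(0,1)$. For all large $n$ and all outcomes of the randomness, one fixed program of a random access machine with logarithmic cost (depending only on $\theta$ and $\delta$) computes the output of this algorithm from $n,k,\ell,s,g,p$, the graph, the auxiliary labels and the measurement results, in time polynomial in $n$. -/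

import Mathlib

open Filter Topology Asymptotics

namespace QGT

/-! ### Machine model: a random access machine with logarithmic cost -/

/-- State of the machine: registers (named by constants of the program) and a memory
(addressed through registers); every cell holds a natural number. -/
structure RamState where
  reg : ℕ → ℕ
  mem : ℕ → ℕ

/-- Write the value `v` into register `d`. -/
def RamState.setReg (S : RamState) (d v : ℕ) : RamState :=
  { S with reg := Function.update S.reg d v }

/-- Write the value `v` into the memory cell `a`. -/
def RamState.setMem (S : RamState) (a v : ℕ) : RamState :=
  { S with mem := Function.update S.mem a v }

/-- Programs of the machine. In the first group `d`, `a`, `b` are names of registers. -/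
inductive RamProg where
  | skip : RamProg
  | const (d c : ℕ) : RamProg
  | add (d a b : ℕ) : RamProg
  | sub (d a b : ℕ) : RamProg
  | mul (d a b : ℕ) : RamProg
  | div (d a b : ℕ) : RamProg
  | load (d a : ℕ) : RamProg
  | store (a b : ℕ) : RamProg
  | seq (p q : RamProg) : RamProg
  | cond (a : ℕ) (p q : RamProg) : RamProg
  | loop (a : ℕ) (p : RamProg) : RamProg

/-- `Exec p S S' t`: started in state `S`, the program `p` halts in state `S'` after a running
time of exactly `t`. Every elementary operation is charged one unit plus the bit lengths
(`Nat.size`) of all numbers and memory addresses on which it operates. -/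
inductive Exec : RamProg → RamState → RamState → ℕ → Prop where
  | skip (S : RamState) : Exec .skip S S 1
  | const (S : RamState) (d c : ℕ) :
      Exec (.const d c) S (S.setReg d c) (1 + c.size)
  | add (S : RamState) (d a b : ℕ) :
      Exec (.add d a b) S (S.setReg d (S.reg a + S.reg b))
        (1 + (S.reg a).size + (S.reg b).size)
  | sub (S : RamState) (d a b : ℕ) :
      Exec (.sub d a b) S (S.setReg d (S.reg a - S.reg b))
        (1 + (S.reg a).size + (S.reg b).size)
  | mul (S : RamState) (d a b : ℕ) :
      Exec (.mul d a b) S (S.setReg d (S.reg a * S.reg b))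
        (1 + (S.reg a).size + (S.reg b).size)
  | div (S : RamState) (d a b : ℕ) :
      Exec (.div d a b) S (S.setReg d (S.reg a / S.reg b))
        (1 + (S.reg a).size + (S.reg b).size)
  | load (S : RamState) (d a : ℕ) :
      Exec (.load d a) S (S.setReg d (S.mem (S.reg a)))
        (1 + (S.reg a).size + (S.mem (S.reg a)).size)
  | store (S : RamState) (a b : ℕ) :
      Exec (.store a b) S (S.setMem (S.reg a) (S.reg b))
        (1 + (S.reg a).size + (S.reg b).size)
  | seq {p q : RamProg} {S₁ S₂ S₃ : RamState} {t u : ℕ} :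
      Exec p S₁ S₂ t → Exec q S₂ S₃ u → Exec (.seq p q) S₁ S₃ (t + u)
  | cond_pos {a : ℕ} {p q : RamProg} {S₁ S₂ : RamState} {t : ℕ} :
      S₁.reg a ≠ 0 → Exec p S₁ S₂ t → Exec (.cond a p q) S₁ S₂ (1 + (S₁.reg a).size + t)
  | cond_zero {a : ℕ} {p q : RamProg} {S₁ S₂ : RamState} {t : ℕ} :
      S₁.reg a = 0 → Exec q S₁ S₂ t → Exec (.cond a p q) S₁ S₂ (1 + t)
  | loop_pos {a : ℕ} {p : RamProg} {S₁ S₂ S₃ : RamState} {t u : ℕ} :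
      S₁.reg a ≠ 0 → Exec p S₁ S₂ t → Exec (.loop a p) S₂ S₃ u →
        Exec (.loop a p) S₁ S₃ (1 + (S₁.reg a).size + t + u)
  | loop_zero {a : ℕ} {p : RamProg} {S : RamState} :
      S.reg a = 0 → Exec (.loop a p) S S 1

/-- Initial state: the input is written into the memory cells `0, 1, 2, …`, all else is zero. -/
def initState (input : List ℕ) : RamState where
  reg := fun _ => 0
  mem := fun i => input.getD i 0

/-! ### The augmented spatially coupled pooling design -/

/-- Parameters of a design: the number `ℓ` of compartments of items with unknown labels, the
sliding window `s`, the number `g = Γ / s` of items that a pool of size `Γ` draws from each of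
the `s` compartments of its window, and the number `p = m / (ℓ + s - 1)` of pools per
compartment of pools. -/
structure Params where
  ℓ : ℕ
  s : ℕ
  g : ℕ
  p : ℕ

/-- Number `ℓ + s - 1` of compartments on the ring. Compartments are numbered from `0`:
`0, …, s - 2` are the seed and `s - 1, …, ℓ + s - 2` are the bulk. -/
abbrev Params.ring (P : Params) : ℕ := P.ℓ + P.s - 1

/-- `⌈n / ℓ⌉`. -/
def Params.compSize (P : Params) (n : ℕ) : ℕ := (n + P.ℓ - 1) / P.ℓ

/-- The number `n' = (s - 1) ⌈n / ℓ⌉` of auxiliary items. -/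
def Params.numAux (P : Params) (n : ℕ) : ℕ := (P.s - 1) * P.compSize n

/-- The number `⌈(s - 1) k / ℓ⌉` of auxiliary items with label one. -/
def Params.auxOnes (P : Params) (k : ℕ) : ℕ := ((P.s - 1) * k + P.ℓ - 1) / P.ℓ

/-- All items: auxiliary items (`Sum.inl`) with known labels, and the `n` items (`Sum.inr`)
whose labels are to be found. -/
abbrev Item (n : ℕ) (P : Params) : Type := Fin (P.numAux n) ⊕ Fin n

/-- The compartment of an item. Seed compartments consist of `⌈n / ℓ⌉` auxiliary items each;
the `n` items are split into `ℓ` compartments of sizes `⌊n / ℓ⌋` or `⌈n / ℓ⌉`. -/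
def comp {n : ℕ} {P : Params} : Item n P → ℕ
  | Sum.inl y => y.val / P.compSize n
  | Sum.inr x => (P.s - 1) + x.val % P.ℓ

/-- The set of items of compartment `c`. -/
def compartment (n : ℕ) (P : Params) (c : ℕ) : Finset (Item n P) :=
  Finset.univ.filter fun v => comp v = c

/-- The bipartite graph between items and coupled pools: `G b a` is the set of items in the
`a`-th pool of the `b`-th compartment of pools. -/
abbrev Graph (n : ℕ) (P : Params) : Type := Fin P.ring → Fin P.p → Finset (Item n P)

/-- The possible outcomes of the spatially coupled design: every pool of pool compartment `b`
consists of exactly `g` items from each of the item compartments `b, b - 1, …, b - (s - 1)`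
(indices modulo `ℓ + s - 1`) and of no other item. -/
def IsCoupled {n : ℕ} {P : Params} (G : Graph n P) : Prop :=
  ∀ (b : Fin P.ring) (a : Fin P.p),
    (∀ v ∈ G b a, ∃ r < P.s, comp v = (b.val + P.ring - r) % P.ring) ∧
    ∀ r < P.s, (G b a ∩ compartment n P ((b.val + P.ring - r) % P.ring)).card = P.g

/-- Index set of the pools that are measured: the coupled pools, and one additional pool for
each of the `ℓ` bulk compartments. -/
abbrev PoolIdx (P : Params) : Type := (Fin P.ring × Fin P.p) ⊕ Fin P.ℓ

/-- The pools, as subsets of the `n` items with unknown labels. (Auxiliary items have known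
labels and do not have to be measured.) -/
def pools {n : ℕ} {P : Params} (G : Graph n P) : PoolIdx P → Finset (Fin n)
  | Sum.inl (b, a) => Finset.univ.filter fun x => Sum.inr x ∈ G b a
  | Sum.inr c => Finset.univ.filter fun x => Sum.inr x ∈ compartment n P (P.s - 1 + c.val)

/-- The measurement results of a family of pools: each pool reveals its number of items with
label one. -/
def results {n : ℕ} {ι : Type} (A : ι → Finset (Fin n)) (σ : Fin n → Fin 2) : ι → ℕ :=
  fun i => ∑ x ∈ A i, (σ x).val

/-- A joint outcome of the graph, of the labels of the auxiliary items, and of the ground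
truth. -/
abbrev Outcome (n : ℕ) (P : Params) : Type :=
  Graph n P × (Fin (P.numAux n) → Fin 2) × (Fin n → Fin 2)

open Classical in
/-- All joint outcomes. The uniform distribution on this product set makes the three
components independent and each of them uniform: the coupled pools choose their items uniformly
without replacement and independently of each other, the auxiliary labels are uniform with
`⌈(s - 1) k / ℓ⌉` ones, and the ground truth is uniform with `k` ones. -/
noncomputable def outcomes (n k : ℕ) (P : Params) : Finset (Outcome n P) :=
  (Finset.univ.filter fun G => IsCoupled G) ×ˢ
    (Finset.univ.filter fun τ => ∑ y, (τ y).val = P.auxOnes k) ×ˢ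
      (Finset.univ.filter fun σ => ∑ x, (σ x).val = k)

/-! ### The thresholding algorithm -/

section Decoder

variable {n : ℕ} {P : Params}

/-- The number of items with label one in the `a`-th pool of pool compartment `b`, auxiliary
items included, as obtained from the measurement result. -/
def poolCount (G : Graph n P) (τ : Fin (P.numAux n) → Fin 2) (res : PoolIdx P → ℕ)
    (b : Fin P.ring) (a : Fin P.p) : ℕ :=
  res (Sum.inl (b, a)) + ∑ y, if Sum.inl y ∈ G b a then (τ y).val else 0

/-- The number `k[c]` of items with label one in compartment `c`: known for the seed, measured
by the additional pools for the bulk. -/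
def compCount (τ : Fin (P.numAux n) → Fin 2) (res : PoolIdx P → ℕ) (c : ℕ) : ℕ :=
  (∑ y, if Sum.inl y ∈ compartment n P c then (τ y).val else 0) +
    ∑ i : Fin P.ℓ, if P.s - 1 + i.val = c then res (Sum.inr i) else 0

/-- The coupled pools of pool compartment `i + j` that contain `x`, where `i` is the
compartment of `x`. -/
def nbrs (G : Graph n P) (x : Fin n) (j : ℕ) : Finset (Fin P.ring × Fin P.p) :=
  Finset.univ.filter fun ba =>
    ba.1.val = (comp (P := P) (Sum.inr x) + j) % P.ring ∧ Sum.inr x ∈ G ba.1 ba.2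

/-- The estimated unexplained neighbourhood sum of `x` in pool compartment `i + j`, given the
current estimate `est` of all labels: the sum over the pools containing `x` of their counts,
minus the estimated labels of their items in the compartments `i - s + j + 1, …, i - 1`. -/
def unexplained (G : Graph n P) (τ : Fin (P.numAux n) → Fin 2) (res : PoolIdx P → ℕ)
    (est : Item n P → Fin 2) (x : Fin n) (j : ℕ) : ℤ :=
  ∑ ba ∈ nbrs G x j,
    ((poolCount G τ res ba.1 ba.2 : ℤ) -
      ∑ v ∈ (G ba.1 ba.2).filter fun v =>
        comp (P := P) (Sum.inr x) + j + 1 ≤ comp v + P.s ∧ comp v < comp (P := P) (Sum.inr x),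
        ((est v).val : ℤ))

/-- The centring term
`Δ_x[j] ∑_{r ≤ j} (Γ / s - 1{r = 0}) k[i + r] / |V[i + r] \ {x}|`. -/
noncomputable def centring (G : Graph n P) (τ : Fin (P.numAux n) → Fin 2) (res : PoolIdx P → ℕ)
    (x : Fin n) (j : ℕ) : ℝ :=
  ((nbrs G x j).card : ℝ) *
    ∑ r ∈ Finset.range (j + 1),
      ((P.g : ℝ) - if r = 0 then 1 else 0) *
        ((compCount τ res ((comp (P := P) (Sum.inr x) + r) % P.ring) : ℝ) /
          (((compartment n P ((comp (P := P) (Sum.inr x) + r) % P.ring)).erase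
            (Sum.inr x)).card : ℝ))

variable (n P) in
/-- The number `m = p (ℓ + s - 1)` of coupled pools. -/
def numCoupled : ℕ := P.ring * P.p

variable (n P) in
/-- The mean number `Δ / s = p (Γ / s) / ⌈n / ℓ⌉` of pools of one given compartment of its
window in which an item (of a compartment of size `⌈n / ℓ⌉`) participates. -/
noncomputable def meanDeg : ℝ := (P.p : ℝ) * P.g / P.compSize n

/-- The score of an item: the sum of its centred and normalised unexplained neighbourhood
sums. -/
noncomputable def score (k : ℕ) (G : Graph n P) (τ : Fin (P.numAux n) → Fin 2)
    (res : PoolIdx P → ℕ) (est : Item n P → Fin 2) (x : Fin n) : ℝ :=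
  ∑ j ∈ Finset.range P.s,
    ((unexplained G τ res est x j : ℝ) - centring G τ res x j) /
      (((j : ℝ) + 1) * meanDeg n P * √((k : ℝ) / (numCoupled P : ℝ)))

open Classical in
/-- The estimate of all labels after the first `t` bulk compartments have been treated, one
after the other: initially the known auxiliary labels, and zero elsewhere; then the items of the
current compartment whose score exceeds the threshold `T` get label one. -/
noncomputable def estimate (k : ℕ) (T : ℝ) (G : Graph n P) (τ : Fin (P.numAux n) → Fin 2)
    (res : PoolIdx P → ℕ) : ℕ → Item n P → Fin 2
  | 0 => Sum.elim τ fun _ => 0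
  | t + 1 => fun v =>
      match v with
      | Sum.inl y => τ y
      | Sum.inr x =>
          if comp (P := P) (Sum.inr x) = P.s - 1 + t ∧
              T < score k G τ res (estimate k T G τ res t) x then 1
          else estimate k T G τ res t (Sum.inr x)

/-- The output of the thresholding algorithm. It depends on the ground truth only through the
measurement results `res`. -/
noncomputable def decode (k : ℕ) (T : ℝ) (G : Graph n P) (τ : Fin (P.numAux n) → Fin 2)
    (res : PoolIdx P → ℕ) (x : Fin n) : Fin 2 :=
  estimate k T G τ res P.ℓ (Sum.inr x)

/-- The input of the algorithm as a list of numbers: the parameters, the adjacency matrix of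
the graph (one row per coupled pool), the auxiliary labels, the measurement results. -/
def encodeInput (k : ℕ) (G : Graph n P) (τ : Fin (P.numAux n) → Fin 2)
    (res : PoolIdx P → ℕ) : List ℕ :=
  [n, k, P.ℓ, P.s, P.g, P.p] ++
  ((List.finRange P.ring).flatMap fun b => (List.finRange P.p).flatMap fun a =>
    (List.ofFn fun y : Fin (P.numAux n) => if Sum.inl y ∈ G b a then 1 else 0) ++
      (List.ofFn fun x : Fin n => if Sum.inr x ∈ G b a then 1 else 0)) ++
  (List.ofFn fun y => (τ y).val) ++
  ((List.finRange P.ring).flatMap fun b => (List.finRange P.p).map fun a =>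
    res (Sum.inl (b, a))) ++
  (List.ofFn fun c : Fin P.ℓ => res (Sum.inr c))

end Decoder

/-- The program `prog` computes the thresholding algorithm with threshold `T` in time at most
`B`: on every possible input it halts within time `B`, with the label of item `x` in the
memory cell `x`. -/
def ComputesWithin (prog : RamProg) (n k : ℕ) (P : Params) (T : ℝ) (B : ℕ) : Prop :=
  ∀ G τ σ, (G, τ, σ) ∈ outcomes n k P →
    ∃ (S : RamState) (t : ℕ),
      Exec prog (initState (encodeInput k G τ (results (pools G) σ))) S t ∧ t ≤ B ∧
      ∀ x : Fin n, S.mem x.val = (decode k T G τ (results (pools G) σ) x).val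

open Classical in
/-- The probability that the thresholding algorithm outputs the ground truth. -/
noncomputable def successProb (n k : ℕ) (P : Params) (T : ℝ) : ℝ :=
  (((outcomes n k P).filter fun ω =>
      decode k T ω.1 ω.2.1 (results (pools ω.1) ω.2.2) = ω.2.2).card : ℝ) /
    ((outcomes n k P).card : ℝ)

/-- The number `k = ⌊n ^ θ⌋` of items with label one. -/
noncomputable def numOnes (θ : ℝ) (n : ℕ) : ℕ := ⌊(n : ℝ) ^ θ⌋₊

end QGT

namespace QGT

/-! ### A compiler for arithmetic expressions with bounded sums and products -/

/-! The score of an item of compartment `i` uses estimates of earlier compartments only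
(`score_congr`). Induction over the rounds (`decode_eq_of_score`) therefore shows that decoding
succeeds as soon as every score computed from the true labels lies on the correct side of the
threshold. No propagation of errors has to be analysed: a union bound over the `n` items suffices
(`card_decode_ne_le`).

Given the labels, such a score is a function of independent pools. A pool of compartment `i + j`
that contains `x` contributes the label of `x` plus the centred counts of ones in the `j + 1`
compartments ahead. The signal is the same for every `j`, but the variance grows like `j + 1`, so `1
/ (j + 1)` is the right weight. The counts are hypergeometric, and their moment generating functions
are at most those of Poisson variables with the same mean (`sum_powersetCard_exp_le`). Let `D = Δ /
s`, let `H` be the harmonic number of `s`, and let there be about `c k` coupled pools. With tilt `h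
/ D` the logarithm of the moment generating function of the unnormalised score is at most `H (label
* h + h ^ 2 / (2 c) + o(1))` (`sum_exp_rawScore_le`, `scoreExponent_le`, `tendsto_leadingRate`),
while the threshold contributes `-H h α`. The minimising tilts are `α c` for label zero and `-(1 -
α) c` for label one, with failure probabilities of about `exp (-H α² c / 2)` and `exp (-H (1 - α)² c
/ 2)` per item.

Since `H` exceeds `η log n` for every `η < θ`, the union bounds over at most `n` zeros and `k ≤ n ^
θ` ones vanish if `1 / θ < α² c / 2` and `1 < (1 - α)² c / 2` (`tendsto_successProb`). Such an `α`
exists as soon as `√(2 / (c θ)) + √(2 / c) < 1`, that is, `c > 2 (1 + √θ)² / θ`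
(`exists_threshold_constant`), and this bound equals `(1 + √θ) / (1 - √θ) * 2 (1 - θ) / θ`.

The sizes in `designParams` serve the error terms. The ratio `k / ℓ` is at least about `log² n`, so
with high probability no compartment has more than `(1 + o(1)) k / ℓ` ones. The ratio of `g` to the
compartment size tends to zero, `D` tends to infinity, and `s` is still `n ^ (θ - o(1))`.

For the running time, the threshold is taken as `a₁ / a₂ * H * √(m / k)` with natural `a₁`, `a₂`.
The roots cancel (`harmonicThreshold_lt_score_iff`), and multiplication by factorials turns the
comparison into one of natural numbers of polynomial bit length (`natDecision_iff`). A small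
compiler for arithmetic expressions (`ArithExpr.size_eval_le_and_yields`) turns it into a program
and delivers a polynomial time bound (`computesWithin_decoderProg`). -/

@[simp] theorem RamState.setReg_reg (S : RamState) (d v e : ℕ) :
    (S.setReg d v).reg e = if e = d then v else S.reg e := by
  simp [RamState.setReg, Function.update_apply]

@[simp] theorem RamState.setReg_mem (S : RamState) (d v : ℕ) : (S.setReg d v).mem = S.mem := rfl

@[simp] theorem RamState.setMem_reg (S : RamState) (a v : ℕ) : (S.setMem a v).reg = S.reg := rfl

@[simp] theorem RamState.setMem_mem (S : RamState) (a v : ℕ) :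
    (S.setMem a v).mem = Function.update S.mem a v := rfl

theorem size_le_self (n : ℕ) : n.size ≤ n := Nat.size_le.2 Nat.lt_two_pow_self

theorem size_add_le (a b : ℕ) : (a + b).size ≤ a.size + b.size + 1 := by
  rw [Nat.size_le]
  have ha := Nat.lt_size_self a
  have hb := Nat.lt_size_self b
  have h1 : 2 ^ a.size ≤ 2 ^ (a.size + b.size) := Nat.pow_le_pow_right (by norm_num) (by omega)
  have h2 : 2 ^ b.size ≤ 2 ^ (a.size + b.size) := Nat.pow_le_pow_right (by norm_num) (by omega)
  rw [pow_succ]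
  omega

theorem size_mul_le (a b : ℕ) : (a * b).size ≤ a.size + b.size := by
  rw [Nat.size_le, pow_add]
  exact Nat.mul_lt_mul'' (Nat.lt_size_self a) (Nat.lt_size_self b)

theorem size_sum_range_le (f : ℕ → ℕ) (q k : ℕ) (h : ∀ i < k, (f i).size ≤ q) :
    (∑ i ∈ Finset.range k, f i).size ≤ k + q := by
  have : ∑ i ∈ Finset.range k, f i ≤ k * 2 ^ q := by
    calc _ ≤ ∑ i ∈ Finset.range k, 2 ^ q :=
          Finset.sum_le_sum fun i hi => (Nat.size_le.1 (h i (Finset.mem_range.1 hi))).le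
      _ = _ := by simp
  rw [Nat.size_le, pow_add]
  exact this.trans_lt (Nat.mul_lt_mul_of_pos_right Nat.lt_two_pow_self (by positivity))

theorem size_prod_range_le (f : ℕ → ℕ) (q k : ℕ) (h : ∀ i < k, (f i).size ≤ q) :
    (∏ i ∈ Finset.range k, f i).size ≤ k * q + 1 := by
  induction k with
  | zero => simp
  | succ k ih =>
    rw [Finset.prod_range_succ]
    have h1 := ih fun i hi => h i (by omega)
    have h2 := h k (by omega)
    have h3 := size_mul_le (∏ i ∈ Finset.range k, f i) (f k)
    rw [Nat.succ_mul]
    omega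

/-- Arithmetic expressions over variables and a memory. In `sum i b e` and `prod i b e`, the
variable `i` runs through the numbers less than the value of the variable `b`. -/
inductive ArithExpr where
  | var (i : ℕ) : ArithExpr
  | const (c : ℕ) : ArithExpr
  | add (e f : ArithExpr) : ArithExpr
  | sub (e f : ArithExpr) : ArithExpr
  | mul (e f : ArithExpr) : ArithExpr
  | div (e f : ArithExpr) : ArithExpr
  | load (e : ArithExpr) : ArithExpr
  | sum (i b : ℕ) (e : ArithExpr) : ArithExpr
  | prod (i b : ℕ) (e : ArithExpr) : ArithExpr

/-- The loop `for i < b do body`. The variable `v` is kept in register `2 * v`, and the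
temporary `d` in register `2 * d + 1`; the temporaries `d, …, d + 3` hold the number of
remaining rounds, the number one, the initial value of `i`, and zero. -/
def RamProg.forVar (i b d : ℕ) (body : RamProg) : RamProg :=
  .seq (.const (2 * (d + 1) + 1) 1) <|
  .seq (.const (2 * (d + 3) + 1) 0) <|
  .seq (.add (2 * d + 1) (2 * b) (2 * (d + 3) + 1)) <|
  .seq (.add (2 * (d + 2) + 1) (2 * i) (2 * (d + 3) + 1)) <|
  .seq (.const (2 * i) 0) <|
  .seq (.loop (2 * d + 1) (.seq body
    (.seq (.add (2 * i) (2 * i) (2 * (d + 1) + 1)) (.sub (2 * d + 1) (2 * d + 1) (2 * (d + 1) + 1))))) <|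
  .add (2 * i) (2 * (d + 2) + 1) (2 * (d + 3) + 1)

/-- Induction on the number `r` of remaining rounds, with `k + r = N`. The invariant `J` has to
survive the bookkeeping of the loop itself, hence `hJi` and `hJd`. All variables but `i`, and the
temporaries below `K`, are compared with the state `S₀` before the loop. -/
theorem exec_loop_forVar {i d N K Tb B : ℕ} {body : RamProg} {S₀ : RamState} {J : ℕ → RamState → Prop}
    (hJi : ∀ k S v, J k S → J k (S.setReg (2 * i) v))
    (hJd : ∀ k S v, J k S → J k (S.setReg (2 * d + 1) v))
    (hNB : N ≤ B)
    (hbody : ∀ k < N, ∀ S, (∀ v, S.reg (2 * v) = if v = i then k else S₀.reg (2 * v)) →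
      (∀ c < K, S.reg (2 * c + 1) = S₀.reg (2 * c + 1)) → J k S →
      ∃ S' t, Exec body S S' t ∧ t ≤ Tb ∧ (∀ v, S'.reg (2 * v) = S.reg (2 * v)) ∧
        (∀ c < K, S'.reg (2 * c + 1) = S.reg (2 * c + 1)) ∧
        (∀ c, d ≤ c → c < d + 4 → S'.reg (2 * c + 1) = S.reg (2 * c + 1)) ∧ J (k + 1) S')
    (hKd : K ≤ d) (r k : ℕ) (hrk : k + r = N) (S : RamState)
    (hv : ∀ v, S.reg (2 * v) = if v = i then k else S₀.reg (2 * v))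
    (hc : ∀ c < K, S.reg (2 * c + 1) = S₀.reg (2 * c + 1))
    (h0 : S.reg (2 * d + 1) = r) (h1 : S.reg (2 * (d + 1) + 1) = 1) (hJ : J k S) :
    ∃ S' t, Exec (.loop (2 * d + 1) (.seq body
        (.seq (.add (2 * i) (2 * i) (2 * (d + 1) + 1))
          (.sub (2 * d + 1) (2 * d + 1) (2 * (d + 1) + 1))))) S S' t ∧
      t ≤ r * (Tb + 3 * B + 5) + 1 ∧
      (∀ v, S'.reg (2 * v) = if v = i then N else S₀.reg (2 * v)) ∧
      (∀ c < K, S'.reg (2 * c + 1) = S₀.reg (2 * c + 1)) ∧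
      (∀ c, d < c → c < d + 4 → S'.reg (2 * c + 1) = S.reg (2 * c + 1)) ∧ J N S' := by
  induction r generalizing k S with
  | zero =>
    obtain rfl : k = N := by omega
    exact ⟨S, 1, Exec.loop_zero h0, by omega, hv, hc, fun _ _ _ => rfl, hJ⟩
  | succ r ih =>
    obtain ⟨S₁, t₁, e₁, ht₁, hv₁, hc₁, hd₁, hJ₁⟩ := hbody k (by omega) S hv hc hJ
    have h1' : S₁.reg (2 * (d + 1) + 1) = 1 := by rw [hd₁ _ (by omega) (by omega), h1]
    have h0' : S₁.reg (2 * d + 1) = r + 1 := by rw [hd₁ _ (by omega) (by omega), h0]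
    have hi' : S₁.reg (2 * i) = k := by rw [hv₁, hv]; simp
    set S₂ := S₁.setReg (2 * i) (S₁.reg (2 * i) + S₁.reg (2 * (d + 1) + 1)) with hS₂
    have e₂ : Exec (.add (2 * i) (2 * i) (2 * (d + 1) + 1)) S₁ S₂ _ := Exec.add _ _ _ _
    set S₃ := S₂.setReg (2 * d + 1) (S₂.reg (2 * d + 1) - S₂.reg (2 * (d + 1) + 1)) with hS₃
    have e₃ : Exec (.sub (2 * d + 1) (2 * d + 1) (2 * (d + 1) + 1)) S₂ S₃ _ := Exec.sub _ _ _ _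
    have a1 : S₂.reg (2 * (d + 1) + 1) = 1 := by
      rw [hS₂, RamState.setReg_reg, if_neg (by omega), h1']
    have a0 : S₂.reg (2 * d + 1) = r + 1 := by
      rw [hS₂, RamState.setReg_reg, if_neg (by omega), h0']
    obtain ⟨S', t', e', ht', hv', hc', hd', hJ'⟩ := ih (k + 1) (by omega) S₃
      (fun v => by
        rw [hS₃, RamState.setReg_reg, if_neg (by omega), hS₂, RamState.setReg_reg, hi', h1']
        by_cases hvi : v = i
        · simp [hvi]
        · rw [if_neg (by omega), if_neg hvi, hv₁, hv, if_neg hvi])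
      (fun c hcK => by
        rw [hS₃, RamState.setReg_reg, if_neg (by omega), hS₂, RamState.setReg_reg,
          if_neg (by omega), hc₁ c hcK, hc c hcK])
      (by rw [hS₃, RamState.setReg_reg, if_pos rfl, a0, a1]; simp)
      (by rw [hS₃, RamState.setReg_reg, if_neg (by omega), a1])
      (hJd _ _ _ (hJi _ _ _ hJ₁))
    refine ⟨S', _, Exec.loop_pos (by rw [h0]; omega) (Exec.seq e₁ (Exec.seq e₂ e₃)) e', ?_, hv', hc',
      fun c h h' => ?_, hJ'⟩
    · have s1 := size_le_self (r + 1)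
      have s2 := size_le_self k
      rw [h0, hi', h1', a0, a1, Nat.size_one]
      have : (r + 1) * (Tb + 3 * B + 5) = r * (Tb + 3 * B + 5) + (Tb + 3 * B + 5) := by ring
      omega
    · rw [hd' c h h', hS₃, RamState.setReg_reg, if_neg (by omega), hS₂, RamState.setReg_reg,
        if_neg (by omega), hd₁ c (by omega) h']

/-- The machine has no move instruction, so values are copied by adding the zero kept in the
temporary `d + 3`. Saving and restoring `i` makes the loop invisible on the level of variables, as
the semantics of bound variables in `ArithExpr.eval` demands. -/
theorem exec_forVar {i b d K Tb B : ℕ} {body : RamProg} {S₀ : RamState} {J : ℕ → RamState → Prop}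
    (hJi : ∀ k S v w, J k S → J k (S.setReg (2 * w) v))
    (hJd : ∀ k S v c, d ≤ c → J k S → J k (S.setReg (2 * c + 1) v))
    (hB : ∀ v, S₀.reg (2 * v) ≤ B)
    (hbody : ∀ k < S₀.reg (2 * b), ∀ S, (∀ v, S.reg (2 * v) = if v = i then k else S₀.reg (2 * v)) →
      (∀ c < K, S.reg (2 * c + 1) = S₀.reg (2 * c + 1)) → J k S →
      ∃ S' t, Exec body S S' t ∧ t ≤ Tb ∧ (∀ v, S'.reg (2 * v) = S.reg (2 * v)) ∧
        (∀ c < K, S'.reg (2 * c + 1) = S.reg (2 * c + 1)) ∧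
        (∀ c, d ≤ c → c < d + 4 → S'.reg (2 * c + 1) = S.reg (2 * c + 1)) ∧ J (k + 1) S')
    (hKd : K ≤ d) (hJ : J 0 S₀) :
    ∃ S' t, Exec (RamProg.forVar i b d body) S₀ S' t ∧
      t ≤ B * (Tb + 3 * B + 5) + 3 * B + 8 ∧
      (∀ v, S'.reg (2 * v) = S₀.reg (2 * v)) ∧
      (∀ c < K, S'.reg (2 * c + 1) = S₀.reg (2 * c + 1)) ∧ J (S₀.reg (2 * b)) S' := by
  set N := S₀.reg (2 * b) with hN
  set S₁ := S₀.setReg (2 * (d + 1) + 1) 1 with hS₁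
  set S₂ := S₁.setReg (2 * (d + 3) + 1) 0 with hS₂
  set S₃ := S₂.setReg (2 * d + 1) (S₂.reg (2 * b) + S₂.reg (2 * (d + 3) + 1)) with hS₃
  set S₄ := S₃.setReg (2 * (d + 2) + 1) (S₃.reg (2 * i) + S₃.reg (2 * (d + 3) + 1)) with hS₄
  set S₅ := S₄.setReg (2 * i) 0 with hS₅
  have z2 : S₂.reg (2 * (d + 3) + 1) = 0 := by simp [hS₂]
  have b2 : S₂.reg (2 * b) = N := by
    rw [hS₂, RamState.setReg_reg, if_neg (by omega), hS₁, RamState.setReg_reg, if_neg (by omega)]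
  have z3 : S₃.reg (2 * (d + 3) + 1) = 0 := by
    rw [hS₃, RamState.setReg_reg, if_neg (by omega), z2]
  have v3 : ∀ v, S₃.reg (2 * v) = S₀.reg (2 * v) := fun v => by
    rw [hS₃, RamState.setReg_reg, if_neg (by omega), hS₂, RamState.setReg_reg, if_neg (by omega),
      hS₁, RamState.setReg_reg, if_neg (by omega)]
  obtain ⟨S₆, t₆, e₆, ht₆, hv₆, hc₆, hd₆, hJ₆⟩ := exec_loop_forVar (J := J) (N := N) (S₀ := S₀)
    (fun k S v h => hJi k S v i h) (fun k S v h => hJd k S v d le_rfl h) (hB b) hbody hKd N 0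
    (by omega) S₅
    (fun v => by
      rw [hS₅, RamState.setReg_reg]
      by_cases hvi : v = i
      · simp [hvi]
      · rw [if_neg (by omega), if_neg hvi, hS₄, RamState.setReg_reg, if_neg (by omega), v3])
    (fun c hc => by simp only [hS₅, hS₄, hS₃, hS₂, hS₁, RamState.setReg_reg]; split_ifs <;> omega)
    (by
      rw [hS₅, RamState.setReg_reg, if_neg (by omega), hS₄, RamState.setReg_reg, if_neg (by omega),
        hS₃, RamState.setReg_reg, if_pos rfl, z2, b2]; rfl)
    (by
      rw [hS₅, RamState.setReg_reg, if_neg (by omega), hS₄, RamState.setReg_reg, if_neg (by omega),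
        hS₃, RamState.setReg_reg, if_neg (by omega), hS₂, RamState.setReg_reg, if_neg (by omega),
        hS₁, RamState.setReg_reg, if_pos rfl])
    (hJi _ _ _ _ (hJd _ _ _ _ (by omega) (hJd _ _ _ _ le_rfl (hJd _ _ _ _ (by omega)
      (hJd _ _ _ _ (by omega) hJ)))))
  have z6 : S₆.reg (2 * (d + 3) + 1) = 0 := by
    rw [hd₆ _ (by omega) (by omega), hS₅, RamState.setReg_reg, if_neg (by omega), hS₄,
      RamState.setReg_reg, if_neg (by omega), z3]
  have s6 : S₆.reg (2 * (d + 2) + 1) = S₀.reg (2 * i) := by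
    rw [hd₆ _ (by omega) (by omega), hS₅, RamState.setReg_reg, if_neg (by omega), hS₄,
      RamState.setReg_reg, if_pos rfl, z3, v3]; rfl
  have e₁ : Exec (.const (2 * (d + 1) + 1) 1) S₀ S₁ _ := Exec.const _ _ _
  have e₂ : Exec (.const (2 * (d + 3) + 1) 0) S₁ S₂ _ := Exec.const _ _ _
  have e₃ : Exec (.add (2 * d + 1) (2 * b) (2 * (d + 3) + 1)) S₂ S₃ _ := Exec.add _ _ _ _
  have e₄ : Exec (.add (2 * (d + 2) + 1) (2 * i) (2 * (d + 3) + 1)) S₃ S₄ _ := Exec.add _ _ _ _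
  have e₅ : Exec (.const (2 * i) 0) S₄ S₅ _ := Exec.const _ _ _
  refine ⟨_, _, Exec.seq e₁ <| Exec.seq e₂ <| Exec.seq e₃ <| Exec.seq e₄ <| Exec.seq e₅ <|
    Exec.seq e₆ (Exec.add _ _ _ _), ?_, ?_, ?_, ?_⟩
  · rw [b2, z2, v3, z3, z6, s6]
    have s1 := (size_le_self N).trans (hB b)
    have s2 := (size_le_self _).trans (hB i)
    have : N * (Tb + 3 * B + 5) ≤ B * (Tb + 3 * B + 5) := Nat.mul_le_mul_right _ (hB b)
    simp only [Nat.size_one, Nat.size_zero]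
    omega
  · intro v
    rw [RamState.setReg_reg]
    by_cases hvi : v = i
    · rw [if_pos (by omega), s6, z6, hvi]; rfl
    · rw [if_neg (by omega), hv₆, if_neg hvi]
  · intro c hc
    rw [RamState.setReg_reg, if_neg (by omega), hc₆ c hc]
  · exact hJi _ _ _ _ hJ₆

namespace ArithExpr

/-- The value of an expression. -/
def eval (m : ℕ → ℕ) : ArithExpr → (ℕ → ℕ) → ℕ
  | var i, ρ => ρ i
  | const c, _ => c
  | add e f, ρ => e.eval m ρ + f.eval m ρ
  | sub e f, ρ => e.eval m ρ - f.eval m ρ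
  | mul e f, ρ => e.eval m ρ * f.eval m ρ
  | div e f, ρ => e.eval m ρ / f.eval m ρ
  | load e, ρ => m (e.eval m ρ)
  | sum i b e, ρ => ∑ k ∈ Finset.range (ρ b), e.eval m (Function.update ρ i k)
  | prod i b e, ρ => ∏ k ∈ Finset.range (ρ b), e.eval m (Function.update ρ i k)

/-- A program that evaluates an expression into the temporary `d`. -/
def compile : ArithExpr → ℕ → RamProg
  | var i, d => .seq (.const (2 * d + 1) 0) (.add (2 * d + 1) (2 * i) (2 * d + 1))
  | const c, d => .const (2 * d + 1) c
  | add e f, d => .seq (e.compile d) (.seq (f.compile (d + 1))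
      (.add (2 * d + 1) (2 * d + 1) (2 * (d + 1) + 1)))
  | sub e f, d => .seq (e.compile d) (.seq (f.compile (d + 1))
      (.sub (2 * d + 1) (2 * d + 1) (2 * (d + 1) + 1)))
  | mul e f, d => .seq (e.compile d) (.seq (f.compile (d + 1))
      (.mul (2 * d + 1) (2 * d + 1) (2 * (d + 1) + 1)))
  | div e f, d => .seq (e.compile d) (.seq (f.compile (d + 1))
      (.div (2 * d + 1) (2 * d + 1) (2 * (d + 1) + 1)))
  | load e, d => .seq (e.compile d) (.load (2 * d + 1) (2 * d + 1))
  | sum i b e, d => .seq (.const (2 * d + 1) 0) (.forVar i b (d + 1)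
      (.seq (e.compile (d + 5)) (.add (2 * d + 1) (2 * d + 1) (2 * (d + 5) + 1))))
  | prod i b e, d => .seq (.const (2 * d + 1) 1) (.forVar i b (d + 1)
      (.seq (e.compile (d + 5)) (.mul (2 * d + 1) (2 * d + 1) (2 * (d + 5) + 1))))

open Polynomial in
/-- A bound for the running time and the size of the value of an expression, in terms of a bound
for the variables and the sizes of the numbers in the memory. -/
noncomputable def cost : ArithExpr → ℕ[X]
  | var _ => X + 2
  | const c => C (c + 1)
  | add e f => 2 * e.cost + 2 * f.cost + 1
  | sub e f => 2 * e.cost + 2 * f.cost + 1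
  | mul e f => 2 * e.cost + 2 * f.cost + 1
  | div e f => 2 * e.cost + 2 * f.cost + 1
  | load e => 2 * e.cost + X + 1
  | sum _ _ e => X * (3 * e.cost + X + 1 + 3 * X + 5) + 3 * X + 10 + e.cost
  | prod _ _ e => X * (2 * e.cost + (X * e.cost + 1) + 1 + 3 * X + 5) + 3 * X + 10 + e.cost

/-- The program `p` evaluates to the value `v` in the temporary `d` in time at most `T`. -/
def Yields (p : RamProg) (S : RamState) (d v T : ℕ) : Prop :=
  ∃ S' t, Exec p S S' t ∧ t ≤ T ∧ S'.mem = S.mem ∧ (∀ w, S'.reg (2 * w) = S.reg (2 * w)) ∧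
    (∀ c < d, S'.reg (2 * c + 1) = S.reg (2 * c + 1)) ∧ S'.reg (2 * d + 1) = v

theorem Yields.mono {p : RamProg} {S : RamState} {d v T T' : ℕ} (h : Yields p S d v T)
    (hT : T ≤ T') : Yields p S d v T' := by
  obtain ⟨S', t, h1, h2, h3⟩ := h
  exact ⟨S', t, h1, h2.trans hT, h3⟩

/-- The second operand is computed in `d + 1` and touches no lower temporary, so the first one is
still in `d` when the operation `o` is executed. -/
theorem Yields.binary {p q o : RamProg} {S : RamState} {d v w r T U V : ℕ}
    (hp : Yields p S d v T)
    (hq : ∀ S', S'.mem = S.mem → (∀ w, S'.reg (2 * w) = S.reg (2 * w)) → Yields q S' (d + 1) w U)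
    (ho : ∀ S', S'.reg (2 * d + 1) = v → S'.reg (2 * (d + 1) + 1) = w →
      ∃ t ≤ V, Exec o S' (S'.setReg (2 * d + 1) r) t) :
    Yields (.seq p (.seq q o)) S d r (T + (U + V)) := by
  obtain ⟨S₁, t₁, e₁, ht₁, hm₁, hv₁, hc₁, hr₁⟩ := hp
  obtain ⟨S₂, t₂, e₂, ht₂, hm₂, hv₂, hc₂, hr₂⟩ := hq S₁ hm₁ hv₁
  obtain ⟨t₃, ht₃, e₃⟩ := ho S₂ (by rw [hc₂ d (by omega), hr₁]) hr₂
  refine ⟨_, _, Exec.seq e₁ (Exec.seq e₂ e₃), by omega, by simp [hm₁, hm₂], fun w => ?_,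
    fun c hc => ?_, by simp⟩
  · rw [RamState.setReg_reg, if_neg (by omega), hv₂, hv₁]
  · rw [RamState.setReg_reg, if_neg (by omega), hc₂ c (by omega), hc₁ c hc]

/-- Common to sums and products. The accumulator sits in the temporary `d`, the loop occupies `d +
1, …, d + 4`, and the current term is computed in `d + 5`. The loop invariant says that the
accumulator holds `acc k`. -/
theorem Yields.fold {q o : RamProg} {S : RamState} {i b d init T U B : ℕ} (f acc : ℕ → ℕ)
    (hB : ∀ v, S.reg (2 * v) ≤ B) (hinit : acc 0 = init) (hsize : init.size ≤ 1)
    (hq : ∀ k < S.reg (2 * b), ∀ S', S'.mem = S.mem →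
      (∀ w, S'.reg (2 * w) = if w = i then k else S.reg (2 * w)) → Yields q S' (d + 5) (f k) T)
    (ho : ∀ k < S.reg (2 * b), ∀ S', S'.reg (2 * d + 1) = acc k → S'.reg (2 * (d + 5) + 1) = f k →
      ∃ t ≤ U, Exec o S' (S'.setReg (2 * d + 1) (acc (k + 1))) t) :
    Yields (.seq (.const (2 * d + 1) init) (.forVar i b (d + 1) (.seq q o))) S d
      (acc (S.reg (2 * b))) (B * (T + U + 3 * B + 5) + 3 * B + 10) := by
  set S₁ := S.setReg (2 * d + 1) init with hS₁
  have hv₁ : ∀ v, S₁.reg (2 * v) = S.reg (2 * v) := fun v => by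
    rw [hS₁, RamState.setReg_reg, if_neg (by omega)]
  obtain ⟨S₂, t₂, e₂, ht₂, hv₂, hc₂, hJ₂⟩ := exec_forVar (i := i) (b := b) (d := d + 1) (K := d)
    (Tb := T + U) (B := B) (body := .seq q o) (S₀ := S₁)
    (J := fun k S' => S'.reg (2 * d + 1) = acc k ∧ S'.mem = S.mem)
    (fun k S v w h => ⟨by rw [RamState.setReg_reg, if_neg (by omega), h.1], h.2⟩)
    (fun k S v c hc h => ⟨by rw [RamState.setReg_reg, if_neg (by omega), h.1], h.2⟩)
    (fun v => by rw [hv₁]; exact hB v)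
    (fun k hk S' hv' hc' hJ' => by
      rw [hv₁] at hk
      obtain ⟨S₃, t₃, e₃, ht₃, hm₃, hv₃, hc₃, hr₃⟩ := hq k hk S' hJ'.2
        (fun w => by rw [hv', hv₁])
      obtain ⟨t₄, ht₄, e₄⟩ := ho k hk S₃ (by rw [hc₃ d (by omega), hJ'.1]) hr₃
      refine ⟨_, _, Exec.seq e₃ e₄, by omega, fun v => ?_, fun c hc => ?_, fun c h h' => ?_, ?_, ?_⟩
      · rw [RamState.setReg_reg, if_neg (by omega), hv₃]
      · rw [RamState.setReg_reg, if_neg (by omega), hc₃ c (by omega)]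
      · rw [RamState.setReg_reg, if_neg (by omega), hc₃ c (by omega)]
      · simp
      · rw [RamState.setReg_mem, hm₃, hJ'.2])
    (by omega) ⟨by simp [hS₁, hinit], rfl⟩
  refine ⟨S₂, _, Exec.seq (Exec.const _ _ _) e₂, by omega, hJ₂.2, fun w => by rw [hv₂, hv₁],
    fun c hc => ?_, by rw [hJ₂.1, hv₁]⟩
  rw [hc₂ c hc, hS₁, RamState.setReg_reg, if_neg (by omega)]

/-- Under logarithmic cost an operation takes time according to the size of its operands, so one
polynomial bounds size and time in a joint induction. Variables are bounded in value, because they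
bound loops; memory cells and values of expressions only in bit length, which leaves room for
numbers like `n!`. -/
theorem size_eval_le_and_yields {m : ℕ → ℕ} {B : ℕ} (hm : ∀ a, (m a).size ≤ B) (e : ArithExpr) :
    ∀ (ρ : ℕ → ℕ), (∀ v, ρ v ≤ B) →
      (e.eval m ρ).size ≤ e.cost.eval B ∧
      ∀ (d : ℕ) (S : RamState), S.mem = m → (∀ v, S.reg (2 * v) = ρ v) →
        Yields (e.compile d) S d (e.eval m ρ) (e.cost.eval B) := by
  induction e with
  | var i =>
    intro ρ hρ
    have hs := (size_le_self _).trans (hρ i)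
    refine ⟨by simp only [eval, cost]; simp; omega, fun d S hS hv => ?_⟩
    refine ⟨_, _, Exec.seq (Exec.const _ _ _) (Exec.add _ _ _ _), ?_, rfl, fun w => ?_,
      fun c hc => ?_, ?_⟩
    · simp only [RamState.setReg_reg, if_true, if_neg (show ¬ (2 * i = 2 * d + 1) by omega), hv]
      simp only [cost, Nat.size_zero, Polynomial.eval_add, Polynomial.eval_X,
        Polynomial.eval_ofNat]
      omega
    · simp only [RamState.setReg_reg, if_neg (show ¬ (2 * w = 2 * d + 1) by omega)]
    · simp only [RamState.setReg_reg, if_neg (show ¬ (2 * c + 1 = 2 * d + 1) by omega)]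
    · simp only [RamState.setReg_reg, if_true, if_neg (show ¬ (2 * i = 2 * d + 1) by omega), hv]
      rfl
  | const c =>
    intro ρ hρ
    have hs := size_le_self c
    refine ⟨by simp only [eval, cost, Polynomial.eval_C]; omega, fun d S hS hv => ?_⟩
    refine ⟨_, _, Exec.const _ _ _, by simp only [cost, Polynomial.eval_C]; omega, rfl,
      fun w => ?_, fun c' hc => ?_, by simp [eval]⟩
    · rw [RamState.setReg_reg, if_neg (by omega)]
    · rw [RamState.setReg_reg, if_neg (by omega)]
  | add e f ihe ihf =>
    intro ρ hρ
    obtain ⟨se, ye⟩ := ihe ρ hρ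
    obtain ⟨sf, yf⟩ := ihf ρ hρ
    have hs := size_add_le (e.eval m ρ) (f.eval m ρ)
    simp only [eval, cost, Polynomial.eval_add, Polynomial.eval_mul, Polynomial.eval_ofNat,
      Polynomial.eval_one]
    refine ⟨by omega, fun d S hS hv => Yields.mono (Yields.binary
      (V := 1 + (e.eval m ρ).size + (f.eval m ρ).size) (ye d S hS hv)
      (fun S' hm' hv' => yf _ S' (hm'.trans hS) fun v => (hv' v).trans (hv v))
      (fun S' h1 h2 => ⟨_, le_rfl, by rw [← h1, ← h2]; exact Exec.add _ _ _ _⟩)) (by omega)⟩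
  | sub e f ihe ihf =>
    intro ρ hρ
    obtain ⟨se, ye⟩ := ihe ρ hρ
    obtain ⟨sf, yf⟩ := ihf ρ hρ
    have hs := Nat.size_le_size (Nat.sub_le (e.eval m ρ) (f.eval m ρ))
    simp only [eval, cost, Polynomial.eval_add, Polynomial.eval_mul, Polynomial.eval_ofNat,
      Polynomial.eval_one]
    refine ⟨by omega, fun d S hS hv => Yields.mono (Yields.binary
      (V := 1 + (e.eval m ρ).size + (f.eval m ρ).size) (ye d S hS hv)
      (fun S' hm' hv' => yf _ S' (hm'.trans hS) fun v => (hv' v).trans (hv v))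
      (fun S' h1 h2 => ⟨_, le_rfl, by rw [← h1, ← h2]; exact Exec.sub _ _ _ _⟩)) (by omega)⟩
  | mul e f ihe ihf =>
    intro ρ hρ
    obtain ⟨se, ye⟩ := ihe ρ hρ
    obtain ⟨sf, yf⟩ := ihf ρ hρ
    have hs := size_mul_le (e.eval m ρ) (f.eval m ρ)
    simp only [eval, cost, Polynomial.eval_add, Polynomial.eval_mul, Polynomial.eval_ofNat,
      Polynomial.eval_one]
    refine ⟨by omega, fun d S hS hv => Yields.mono (Yields.binary
      (V := 1 + (e.eval m ρ).size + (f.eval m ρ).size) (ye d S hS hv)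
      (fun S' hm' hv' => yf _ S' (hm'.trans hS) fun v => (hv' v).trans (hv v))
      (fun S' h1 h2 => ⟨_, le_rfl, by rw [← h1, ← h2]; exact Exec.mul _ _ _ _⟩)) (by omega)⟩
  | div e f ihe ihf =>
    intro ρ hρ
    obtain ⟨se, ye⟩ := ihe ρ hρ
    obtain ⟨sf, yf⟩ := ihf ρ hρ
    have hs := Nat.size_le_size (Nat.div_le_self (e.eval m ρ) (f.eval m ρ))
    simp only [eval, cost, Polynomial.eval_add, Polynomial.eval_mul, Polynomial.eval_ofNat,
      Polynomial.eval_one]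
    refine ⟨by omega, fun d S hS hv => Yields.mono (Yields.binary
      (V := 1 + (e.eval m ρ).size + (f.eval m ρ).size) (ye d S hS hv)
      (fun S' hm' hv' => yf _ S' (hm'.trans hS) fun v => (hv' v).trans (hv v))
      (fun S' h1 h2 => ⟨_, le_rfl, by rw [← h1, ← h2]; exact Exec.div _ _ _ _⟩)) (by omega)⟩
  | load e ih =>
    intro ρ hρ
    obtain ⟨se, ye⟩ := ih ρ hρ
    have hs := hm (e.eval m ρ)
    simp only [eval, cost, Polynomial.eval_add, Polynomial.eval_mul, Polynomial.eval_ofNat,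
      Polynomial.eval_one, Polynomial.eval_X]
    refine ⟨by omega, fun d S hS hv => ?_⟩
    obtain ⟨S₁, t₁, e₁, ht₁, hm₁, hv₁, hc₁, hr₁⟩ := ye d S hS hv
    refine ⟨_, _, Exec.seq e₁ (Exec.load _ _ _), by rw [hr₁, hm₁, hS]; omega, hm₁, fun w => ?_,
      fun c hc => ?_, by simp [hr₁, hm₁, hS]⟩
    · rw [RamState.setReg_reg, if_neg (by omega), hv₁]
    · rw [RamState.setReg_reg, if_neg (by omega), hc₁ c hc]
  | sum i b e ih =>
    intro ρ hρ
    have ih' : ∀ k < ρ b, _ := fun k hk => ih (Function.update ρ i k) (fun v => by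
      rw [Function.update_apply]; split_ifs
      · exact hk.le.trans (hρ b)
      · exact hρ v)
    -- All partial sums are needed, since each round is charged for the current accumulator.
    have hs : ∀ k ≤ ρ b, (∑ k ∈ Finset.range k, e.eval m (Function.update ρ i k)).size
        ≤ B + e.cost.eval B := fun k hk =>
      (size_sum_range_le _ (e.cost.eval B) k fun j hj => (ih' j (by omega)).1).trans
        (Nat.add_le_add_right (hk.trans (hρ b)) _)
    simp only [eval, cost, Polynomial.eval_add, Polynomial.eval_mul, Polynomial.eval_ofNat,
      Polynomial.eval_one, Polynomial.eval_X]
    refine ⟨by have := hs _ le_rfl; omega, fun d S hS hv => ?_⟩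
    have key := Yields.fold (q := e.compile (d + 5))
      (o := .add (2 * d + 1) (2 * d + 1) (2 * (d + 5) + 1)) (S := S) (i := i) (b := b) (d := d)
      (init := 0) (B := B) (T := e.cost.eval B) (U := 2 * e.cost.eval B + B + 1)
      (fun k => e.eval m (Function.update ρ i k))
      (fun k => ∑ k ∈ Finset.range k, e.eval m (Function.update ρ i k))
      (fun v => by rw [hv]; exact hρ v) (by simp) (by simp)
      (fun k hk S' hm' hv' => (ih' k (by rwa [hv] at hk)).2 _ S' (hm'.trans hS) (fun w => by
        rw [hv', Function.update_apply, hv]))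
      (fun k hk S' h1 h2 => ⟨1 + (S'.reg (2 * d + 1)).size + (S'.reg (2 * (d + 5) + 1)).size, by
        rw [hv] at hk
        have a1 := hs k hk.le
        have a2 := (ih' k hk).1
        rw [← h1] at a1
        rw [← h2] at a2
        omega, by
        rw [Finset.sum_range_succ, ← h1, ← h2]; exact Exec.add _ _ _ _⟩)
    rw [hv] at key
    exact key.mono (by
      have : B * (e.cost.eval B + (2 * e.cost.eval B + B + 1) + 3 * B + 5)
        = B * (3 * e.cost.eval B + B + 1 + 3 * B + 5) := by ring
      omega)
  | prod i b e ih =>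
    intro ρ hρ
    have ih' : ∀ k < ρ b, _ := fun k hk => ih (Function.update ρ i k) (fun v => by
      rw [Function.update_apply]; split_ifs
      · exact hk.le.trans (hρ b)
      · exact hρ v)
    have hs : ∀ k ≤ ρ b, (∏ k ∈ Finset.range k, e.eval m (Function.update ρ i k)).size
        ≤ B * e.cost.eval B + 1 := fun k hk =>
      (size_prod_range_le _ (e.cost.eval B) k fun j hj => (ih' j (by omega)).1).trans
        (Nat.add_le_add_right (Nat.mul_le_mul_right _ (hk.trans (hρ b))) _)
    simp only [eval, cost, Polynomial.eval_add, Polynomial.eval_mul, Polynomial.eval_ofNat,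
      Polynomial.eval_one, Polynomial.eval_X]
    refine ⟨?_, fun d S hS hv => ?_⟩
    · have h1 := hs _ le_rfl
      have h2 : B * e.cost.eval B ≤ B * (2 * e.cost.eval B + (B * e.cost.eval B + 1) + 1 + 3 * B + 5) :=
        Nat.mul_le_mul_left _ (by omega)
      omega
    have key := Yields.fold (q := e.compile (d + 5))
      (o := .mul (2 * d + 1) (2 * d + 1) (2 * (d + 5) + 1)) (S := S) (i := i) (b := b) (d := d)
      (init := 1) (B := B) (T := e.cost.eval B) (U := e.cost.eval B + (B * e.cost.eval B + 1) + 1)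
      (fun k => e.eval m (Function.update ρ i k))
      (fun k => ∏ k ∈ Finset.range k, e.eval m (Function.update ρ i k))
      (fun v => by rw [hv]; exact hρ v) (by simp) (by simp)
      (fun k hk S' hm' hv' => (ih' k (by rwa [hv] at hk)).2 _ S' (hm'.trans hS) (fun w => by
        rw [hv', Function.update_apply, hv]))
      (fun k hk S' h1 h2 => ⟨1 + (S'.reg (2 * d + 1)).size + (S'.reg (2 * (d + 5) + 1)).size, by
        rw [hv] at hk
        have a1 := hs k hk.le
        have a2 := (ih' k hk).1
        rw [← h1] at a1
        rw [← h2] at a2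
        omega, by
        rw [Finset.prod_range_succ, ← h1, ← h2]; exact Exec.mul _ _ _ _⟩)
    rw [hv] at key
    exact key.mono (by
      have : B * (e.cost.eval B + (e.cost.eval B + (B * e.cost.eval B + 1) + 1) + 3 * B + 5)
        = B * (2 * e.cost.eval B + (B * e.cost.eval B + 1) + 1 + 3 * B + 5) := by ring
      omega)

end ArithExpr

/-! ### Straight-line programs and loops on the level of variables and memory -/

/-- The variables of the state `S` have the values `ρ`, and its memory is `m`. -/
def Rep (S : RamState) (ρ m : ℕ → ℕ) : Prop := S.mem = m ∧ ∀ v, S.reg (2 * v) = ρ v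

/-- Assign the value of an expression to a variable. -/
def RamProg.assign (i : ℕ) (e : ArithExpr) : RamProg :=
  .seq (e.compile 0) (.seq (.const 3 0) (.add (2 * i) 1 3))

/-- Assign the values of `e 0, …, e (c - 1)` to the variables `0, …, c - 1`, one after the
other. -/
def RamProg.assignFirst (e : ℕ → ArithExpr) : ℕ → RamProg
  | 0 => .skip
  | c + 1 => .seq (RamProg.assignFirst e c) (.assign c (e c))

/-- Store the value of the expression `e` in the memory cell whose address is the value of the
expression `a`. -/
def RamProg.storeAt (d : ℕ) (a e : ArithExpr) : RamProg :=
  .seq (a.compile d) (.seq (e.compile (d + 1)) (.store (2 * d + 1) (2 * (d + 1) + 1)))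

theorem exec_assign {S : RamState} {ρ m : ℕ → ℕ} {B : ℕ} (hS : Rep S ρ m) (hρ : ∀ v, ρ v ≤ B)
    (hm : ∀ a, (m a).size ≤ B) (i : ℕ) (e : ArithExpr) :
    ∃ S' t, Exec (.assign i e) S S' t ∧ t ≤ 2 * e.cost.eval B + 2 ∧
      Rep S' (Function.update ρ i (e.eval m ρ)) m := by
  obtain ⟨hs, hy⟩ := e.size_eval_le_and_yields hm ρ hρ
  obtain ⟨S₁, t₁, e₁, ht₁, hm₁, hv₁, -, hr₁⟩ := hy 0 S hS.1 hS.2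
  refine ⟨_, _, Exec.seq e₁ (Exec.seq (Exec.const _ _ _) (Exec.add _ _ _ _)), ?_, hm₁.trans hS.1,
    fun v => ?_⟩
  · simp only [RamState.setReg_reg]
    simp only [mul_zero, zero_add] at hr₁
    simp [hr₁]
    omega
  · simp only [RamState.setReg_reg]
    simp only [mul_zero, zero_add] at hr₁
    rw [Function.update_apply]
    by_cases h : v = i
    · simp [h, hr₁]
    · rw [if_neg (by omega), if_neg (by omega), if_neg h, hv₁, hS.2]

/-- When variable `i` is computed, exactly the variables below `i` have their final values and all
others are still zero; `he` asks for no more than this. -/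
theorem exec_assignFirst {S : RamState} {ρ m : ℕ → ℕ} {B : ℕ} (e : ℕ → ArithExpr) (c : ℕ)
    (hS : Rep S (fun _ => 0) m) (hρ : ∀ v, ρ v ≤ B) (hm : ∀ a, (m a).size ≤ B)
    (he : ∀ i < c, (e i).eval m (fun v => if v < i then ρ v else 0) = ρ i) :
    ∃ S' t, Exec (.assignFirst e c) S S' t ∧
      t ≤ (∑ i ∈ Finset.range c, (2 * (e i).cost + 2)).eval B + 1 ∧
      Rep S' (fun v => if v < c then ρ v else 0) m := by
  induction c with
  | zero => exact ⟨S, 1, Exec.skip S, by simp, by simpa using hS⟩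
  | succ c ih =>
    obtain ⟨S₁, t₁, e₁, ht₁, h₁⟩ := ih fun i hi => he i (by omega)
    obtain ⟨S₂, t₂, e₂, ht₂, h₂⟩ := exec_assign h₁
      (fun v => show (if v < c then ρ v else 0) ≤ B by
        split_ifs
        · exact hρ v
        · exact Nat.zero_le _) hm c (e c)
    refine ⟨S₂, _, Exec.seq e₁ e₂, ?_, ?_⟩
    · rw [Finset.sum_range_succ]
      simp only [Polynomial.eval_add, Polynomial.eval_mul, Polynomial.eval_ofNat]
      omega
    · rw [he c (by omega)] at h₂
      convert h₂ using 1
      funext v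
      rw [Function.update_apply]
      split_ifs <;> first | omega | simp_all

theorem exec_storeAt {S : RamState} {ρ m : ℕ → ℕ} {B : ℕ} (hS : Rep S ρ m) (hρ : ∀ v, ρ v ≤ B)
    (hm : ∀ a, (m a).size ≤ B) (d : ℕ) (a e : ArithExpr) :
    ∃ S' t, Exec (.storeAt d a e) S S' t ∧ t ≤ 2 * a.cost.eval B + 2 * e.cost.eval B + 1 ∧
      Rep S' ρ (Function.update m (a.eval m ρ) (e.eval m ρ)) ∧
      ∀ c < d, S'.reg (2 * c + 1) = S.reg (2 * c + 1) := by
  obtain ⟨hs, hy⟩ := a.size_eval_le_and_yields hm ρ hρ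
  obtain ⟨S₁, t₁, e₁, ht₁, hm₁, hv₁, hc₁, hr₁⟩ := hy d S hS.1 hS.2
  obtain ⟨hs', hy'⟩ := e.size_eval_le_and_yields hm ρ hρ
  obtain ⟨S₂, t₂, e₂, ht₂, hm₂, hv₂, hc₂, hr₂⟩ := hy' (d + 1) S₁ (hm₁.trans hS.1)
    fun v => (hv₁ v).trans (hS.2 v)
  have hr₁' : S₂.reg (2 * d + 1) = a.eval m ρ := by rw [hc₂ d (by omega), hr₁]
  refine ⟨_, _, Exec.seq e₁ (Exec.seq e₂ (Exec.store _ _ _)), ?_, ⟨?_, fun v => ?_⟩,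
    fun c hc => ?_⟩
  · rw [hr₁', hr₂]; omega
  · rw [RamState.setMem_mem, hr₁', hr₂, hm₂, hm₁, hS.1]
  · rw [RamState.setMem_reg, hv₂, hv₁, hS.2]
  · rw [RamState.setMem_reg, hc₂ c (by omega), hc₁ c hc]

/-- For loops whose body writes to memory: `mm k` is the memory before round `k`. The body must
leave the four temporaries of the loop alone, which fixes the offsets of nested loops in
`decoderProg`. -/
theorem exec_forVar_mem {S : RamState} {ρ : ℕ → ℕ} {i b d B Tb : ℕ} {body : RamProg}
    (mm : ℕ → ℕ → ℕ) (hS : Rep S ρ (mm 0)) (hρ : ∀ v, ρ v ≤ B)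
    (hbody : ∀ k < ρ b, ∀ S, Rep S (Function.update ρ i k) (mm k) →
      ∃ S' t, Exec body S S' t ∧ t ≤ Tb ∧ Rep S' (Function.update ρ i k) (mm (k + 1)) ∧
        ∀ c < d + 4, S'.reg (2 * c + 1) = S.reg (2 * c + 1)) :
    ∃ S' t, Exec (.forVar i b d body) S S' t ∧ t ≤ B * (Tb + 3 * B + 5) + 3 * B + 8 ∧
      Rep S' ρ (mm (ρ b)) ∧ ∀ c < d, S'.reg (2 * c + 1) = S.reg (2 * c + 1) := by
  obtain ⟨S', t, e', ht, hv, hc, hJ⟩ := exec_forVar (i := i) (b := b) (d := d) (K := d) (Tb := Tb)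
    (B := B) (body := body) (S₀ := S) (J := fun k S => S.mem = mm k)
    (fun _ _ _ _ h => h) (fun _ _ _ _ _ h => h) (fun v => (hS.2 v).trans_le (hρ v))
    (fun k hk S₁ hv hc hJ => by
      have hR : Rep S₁ (Function.update ρ i k) (mm k) :=
        ⟨hJ, fun v => by rw [hv, Function.update_apply, hS.2]⟩
      obtain ⟨S₂, t, e, ht, hR', hc'⟩ := hbody k (by rwa [hS.2] at hk) S₁ hR
      exact ⟨S₂, t, e, ht, fun v => by rw [hR'.2, hR.2], fun c hc => hc' c (by omega),
        fun c _ h => hc' c h, hR'.1⟩) le_rfl hS.1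
  exact ⟨S', t, e', ht, ⟨by rw [hJ, hS.2], fun v => by rw [hv, hS.2]⟩, hc⟩

/-! ### The input in memory -/

theorem getD_flatMap_finRange {α : Type*} (R len : ℕ) (f : Fin R → List α)
    (hf : ∀ b, (f b).length = len) (b : Fin R) (r : ℕ) (hr : r < len) (z : α) :
    ((List.finRange R).flatMap f).getD (b.val * len + r) z = (f b).getD r z := by
  induction R with
  | zero => exact b.elim0
  | succ R ih =>
    rw [List.finRange_succ, List.flatMap_cons]
    induction b using Fin.cases with
    | zero =>
      rw [Fin.val_zero, zero_mul, zero_add, List.getD_append _ _ _ _ (by rw [hf]; exact hr)]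
    | succ b =>
      have : ((b.succ : Fin (R + 1)).val) * len + r = len + (b.val * len + r) := by
        rw [Fin.val_succ]; ring
      rw [List.getD_append_right _ _ _ _ (by rw [hf, this]; omega), hf, this,
        Nat.add_sub_cancel_left, List.flatMap_map, ← ih (fun b => f b.succ) (fun b => hf _)]

theorem length_flatMap_finRange {α : Type*} (R len : ℕ) (f : Fin R → List α)
    (hf : ∀ b, (f b).length = len) : ((List.finRange R).flatMap f).length = R * len := by
  simp [List.length_flatMap, hf]

theorem getD_ofFn {α : Type*} {N : ℕ} (f : Fin N → α) (i : Fin N) (z : α) :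
    (List.ofFn f).getD i.val z = f i := by
  simp [List.getD_eq_getElem?_getD]

section Layout

variable (n : ℕ) (P : Params)

/-- Address of the auxiliary labels. -/
def offLabels : ℕ := 6 + P.ring * (P.p * (P.numAux n + n))

/-- Address of the results of the coupled pools. -/
def offCoupled : ℕ := offLabels n P + P.numAux n

/-- Address of the results of the additional pools. -/
def offExtra : ℕ := offCoupled n P + P.ring * P.p

/-- Address of the estimate. -/
def offOut : ℕ := offExtra n P + P.ℓ

end Layout

section Encoding

variable {n : ℕ} {P : Params} (k : ℕ) (G : Graph n P) (τ : Fin (P.numAux n) → Fin 2)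
  (res : PoolIdx P → ℕ)

/-- The row of the adjacency matrix that belongs to a pool. -/
def adjRow (b : Fin P.ring) (a : Fin P.p) : List ℕ :=
  (List.ofFn fun y : Fin (P.numAux n) => if Sum.inl y ∈ G b a then 1 else 0) ++
    (List.ofFn fun x : Fin n => if Sum.inr x ∈ G b a then 1 else 0)

theorem length_adjRow (b : Fin P.ring) (a : Fin P.p) :
    (adjRow G b a).length = P.numAux n + n := by simp [adjRow]

theorem length_adj : ((List.finRange P.ring).flatMap fun b =>
    (List.finRange P.p).flatMap fun a => adjRow G b a).length =
      P.ring * (P.p * (P.numAux n + n)) :=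
  length_flatMap_finRange _ _ _ fun b => length_flatMap_finRange _ _ _ fun a => length_adjRow G b a

/-- Nested to the right, each block is reached by dropping prefixes of known length. Singleton
blocks in place of `map` let `getD_flatMap_finRange` handle both levels of the list of results. -/
theorem encodeInput_eq : encodeInput k G τ res =
    ([n, k, P.ℓ, P.s, P.g, P.p] ++ (((List.finRange P.ring).flatMap fun b =>
      (List.finRange P.p).flatMap fun a => adjRow G b a) ++
    ((List.ofFn fun y => (τ y).val) ++
    (((List.finRange P.ring).flatMap fun b => (List.finRange P.p).flatMap fun a =>
      [res (Sum.inl (b, a))]) ++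
    (List.ofFn fun c : Fin P.ℓ => res (Sum.inr c)))))) := by
  simp only [encodeInput, adjRow, List.append_assoc, List.map_eq_flatMap]

theorem length_encodeInput : (encodeInput k G τ res).length = offOut n P := by
  rw [encodeInput_eq, List.length_append, List.length_append, length_adj, List.length_append,
    List.length_append, length_flatMap_finRange _ P.p _ fun b => by
      simp]
  simp only [List.length_cons, List.length_nil, List.length_ofFn, offOut, offExtra, offCoupled,
    offLabels]
  ring

theorem getD_adj (b : Fin P.ring) (a : Fin P.p) (w : ℕ) (hw : w < P.numAux n + n) :
    (encodeInput k G τ res).getD (6 + ((b.val * P.p + a.val) * (P.numAux n + n) + w)) 0 =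
      (adjRow G b a).getD w 0 := by
  have hr : a.val * (P.numAux n + n) + w < P.p * (P.numAux n + n) := by
    have : (a.val + 1) * (P.numAux n + n) ≤ P.p * (P.numAux n + n) := Nat.mul_le_mul_right _ a.2
    rw [Nat.succ_mul] at this
    omega
  have hr' : b.val * (P.p * (P.numAux n + n)) + (a.val * (P.numAux n + n) + w) <
      P.ring * (P.p * (P.numAux n + n)) := by
    have : (b.val + 1) * (P.p * (P.numAux n + n)) ≤ P.ring * (P.p * (P.numAux n + n)) :=
      Nat.mul_le_mul_right _ b.2
    rw [Nat.succ_mul] at this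
    omega
  have e : (b.val * P.p + a.val) * (P.numAux n + n) + w =
      b.val * (P.p * (P.numAux n + n)) + (a.val * (P.numAux n + n) + w) := by ring
  rw [encodeInput_eq, List.getD_append_right _ _ _ _ (by simp), e,
    List.getD_append _ _ _ _ (by rw [length_adj]; simpa using hr')]
  simp only [List.length_cons, List.length_nil, zero_add, Nat.reduceAdd, Nat.add_sub_cancel_left]
  rw [getD_flatMap_finRange _ (P.p * (P.numAux n + n)) _
      (fun b => length_flatMap_finRange _ _ _ fun a => length_adjRow G b a) b _ hr,
    getD_flatMap_finRange _ _ _ (fun a => length_adjRow G b a) a _ hw]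

theorem getD_adj_aux (b : Fin P.ring) (a : Fin P.p) (y : Fin (P.numAux n)) :
    (encodeInput k G τ res).getD (6 + ((b.val * P.p + a.val) * (P.numAux n + n) + y.val)) 0 =
      if Sum.inl y ∈ G b a then 1 else 0 := by
  rw [getD_adj _ _ _ _ _ _ _ (by omega), adjRow,
    List.getD_append _ _ _ _ (by simp), getD_ofFn]

theorem getD_adj_item (b : Fin P.ring) (a : Fin P.p) (x : Fin n) :
    (encodeInput k G τ res).getD
      (6 + ((b.val * P.p + a.val) * (P.numAux n + n) + (P.numAux n + x.val))) 0 =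
      if Sum.inr x ∈ G b a then 1 else 0 := by
  rw [getD_adj _ _ _ _ _ _ _ (by omega), adjRow,
    List.getD_append_right _ _ _ _ (by simp), List.length_ofFn, Nat.add_sub_cancel_left, getD_ofFn]

theorem getD_labels (y : Fin (P.numAux n)) :
    (encodeInput k G τ res).getD (offLabels n P + y.val) 0 = (τ y).val := by
  rw [encodeInput_eq, List.getD_append_right _ _ _ _ (by simp [offLabels]; omega),
    List.getD_append_right _ _ _ _ (by rw [length_adj]; simp [offLabels]; omega), length_adj]
  have : offLabels n P + y.val - [n, k, P.ℓ, P.s, P.g, P.p].length -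
      P.ring * (P.p * (P.numAux n + n)) = y.val := by simp [offLabels]; omega
  rw [this, List.getD_append _ _ _ _ (by simp), getD_ofFn]

theorem getD_coupled (b : Fin P.ring) (a : Fin P.p) :
    (encodeInput k G τ res).getD (offCoupled n P + (b.val * P.p + a.val)) 0 =
      res (Sum.inl (b, a)) := by
  have hl : ∀ b : Fin P.ring, ((List.finRange P.p).flatMap fun a =>
      [res (Sum.inl (b, a))]).length = P.p := fun b => by
    simp
  have hr' : b.val * P.p + a.val < P.ring * P.p := by
    have : (b.val + 1) * P.p ≤ P.ring * P.p := Nat.mul_le_mul_right _ b.2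
    rw [Nat.succ_mul] at this
    omega
  rw [encodeInput_eq, List.getD_append_right _ _ _ _ (by simp [offCoupled, offLabels]; omega),
    List.getD_append_right _ _ _ _ (by rw [length_adj]; simp [offCoupled, offLabels]; omega),
    length_adj,
    List.getD_append_right _ _ _ _ (by simp [offCoupled, offLabels]; omega)]
  have : offCoupled n P + (b.val * P.p + a.val) - [n, k, P.ℓ, P.s, P.g, P.p].length -
      P.ring * (P.p * (P.numAux n + n)) - (List.ofFn fun y => (τ y).val).length =
      b.val * P.p + a.val := by simp [offCoupled, offLabels]; omega
  rw [this, List.getD_append _ _ _ _ (by rw [length_flatMap_finRange _ _ _ hl]; exact hr'),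
    getD_flatMap_finRange _ _ _ hl b _ a.2]
  have h1 := getD_flatMap_finRange P.p 1 (fun a => [res (Sum.inl (b, a))]) (fun _ => rfl) a 0
    one_pos 0
  simpa using h1

theorem getD_extra (c : Fin P.ℓ) :
    (encodeInput k G τ res).getD (offExtra n P + c.val) 0 = res (Sum.inr c) := by
  have hl : ∀ b : Fin P.ring, ((List.finRange P.p).flatMap fun a =>
      [res (Sum.inl (b, a))]).length = P.p := fun b => by
    simp
  rw [encodeInput_eq,
    List.getD_append_right _ _ _ _ (by simp [offExtra, offCoupled, offLabels]; omega),
    List.getD_append_right _ _ _ _ (by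
      rw [length_adj]; simp [offExtra, offCoupled, offLabels]; omega),
    length_adj,
    List.getD_append_right _ _ _ _ (by simp [offExtra, offCoupled, offLabels]; omega),
    List.getD_append_right _ _ _ _ (by
      rw [length_flatMap_finRange _ _ _ hl]; simp [offExtra, offCoupled, offLabels]; omega),
    length_flatMap_finRange _ _ _ hl]
  have : offExtra n P + c.val - [n, k, P.ℓ, P.s, P.g, P.p].length -
      P.ring * (P.p * (P.numAux n + n)) - (List.ofFn fun y => (τ y).val).length - P.ring * P.p =
      c.val := by simp [offExtra, offCoupled, offLabels]; omega
  rw [this, getD_ofFn]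

theorem le_of_mem_encodeInput {B v : ℕ} (h1 : 1 ≤ B) (hn : n ≤ B) (hk : k ≤ B) (hℓ : P.ℓ ≤ B)
    (hs : P.s ≤ B) (hg : P.g ≤ B) (hp : P.p ≤ B) (hres : ∀ i, res i ≤ B)
    (hv : v ∈ encodeInput k G τ res) : v ≤ B := by
  have hτ : ∀ y, (τ y).val ≤ B := fun y => by omega
  simp only [encodeInput, List.mem_append, List.mem_cons, List.mem_flatMap, List.mem_ofFn,
    List.mem_map, List.not_mem_nil] at hv
  rcases hv with (((((rfl | rfl | rfl | rfl | rfl | rfl | h) | ⟨b, -, a, -, ⟨y, rfl⟩ | ⟨y, rfl⟩⟩) |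
    ⟨y, rfl⟩) | ⟨b, -, a, -, rfl⟩) | ⟨c, rfl⟩) <;> try assumption
  · exact h.elim
  · split_ifs <;> omega
  · split_ifs <;> omega
  · exact hτ y
  · exact hres _
  · exact hres _

end Encoding

/-! ### Expressions for the quantities of the thresholding algorithm -/

namespace ArithExpr

/-- Indicator of `e < f`. -/
def ltE (e f : ArithExpr) : ArithExpr := sub (const 1) (sub (const 1) (sub f e))

/-- Indicator of `e ≤ f`. -/
def leE (e f : ArithExpr) : ArithExpr := sub (const 1) (sub e f)

/-- Indicator of `e = f`. -/
def eqE (e f : ArithExpr) : ArithExpr := mul (leE e f) (leE f e)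

/-- Remainder. -/
def modE (e f : ArithExpr) : ArithExpr := sub e (mul f (div e f))

variable (m ρ : ℕ → ℕ) (e f : ArithExpr)

@[simp] theorem eval_ltE :
    (ltE e f).eval m ρ = if e.eval m ρ < f.eval m ρ then 1 else 0 := by
  simp only [ltE, eval]; split_ifs <;> omega

@[simp] theorem eval_leE :
    (leE e f).eval m ρ = if e.eval m ρ ≤ f.eval m ρ then 1 else 0 := by
  simp only [leE, eval]; split_ifs <;> omega

@[simp] theorem eval_eqE :
    (eqE e f).eval m ρ = if e.eval m ρ = f.eval m ρ then 1 else 0 := by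
  simp only [eqE, eval, eval_leE]; split_ifs <;> omega

theorem eval_eqE_of {m ρ : ℕ → ℕ} {e f : ArithExpr} {a b : ℕ} (he : e.eval m ρ = a)
    (hf : f.eval m ρ = b) : (eqE e f).eval m ρ = if a = b then 1 else 0 := by
  subst he hf; simp

@[simp] theorem eval_modE : (modE e f).eval m ρ = e.eval m ρ % f.eval m ρ := by
  simp only [modE, eval]
  have := Nat.mod_add_div (e.eval m ρ) (f.eval m ρ)
  omega

theorem eval_sum_fin {m ρ : ℕ → ℕ} {i b N : ℕ} {e : ArithExpr} (hb : ρ b = N) (f : Fin N → ℕ)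
    (h : ∀ k : Fin N, e.eval m (Function.update ρ i k.val) = f k) :
    (sum i b e).eval m ρ = ∑ k, f k := by
  rw [eval, hb, Finset.sum_range]
  exact Finset.sum_congr rfl fun k _ => h k

theorem eval_sum_range {m ρ : ℕ → ℕ} {i b N : ℕ} {e : ArithExpr} (hb : ρ b = N) (f : ℕ → ℕ)
    (h : ∀ k < N, e.eval m (Function.update ρ i k) = f k) :
    (sum i b e).eval m ρ = ∑ k ∈ Finset.range N, f k := by
  rw [eval, hb]
  exact Finset.sum_congr rfl fun k hk => h k (Finset.mem_range.1 hk)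

/-- The factorial of `n` (variable `0`). -/
def factE : ArithExpr := prod 20 0 (add (var 20) (const 1))

/-- The compartment of the item `x` (variable `14`). -/
def compE : ArithExpr := add (sub (var 3) (const 1)) (modE (var 14) (var 2))

/-- The compartment of pools `comp x + j` (`j` is the variable `15`). -/
def poolE : ArithExpr := modE (add compE (var 15)) (var 8)

/-- The compartment of items `comp x + r` (`r` is the variable `16`). -/
def itemE : ArithExpr := modE (add compE (var 16)) (var 8)

/-- Entry of the adjacency matrix in column `w`, for the pool with number `a` (variable `17`)
in compartment `comp x + j`. -/
def adjE (w : ArithExpr) : ArithExpr :=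
  load (add (const 6) (add (mul (add (mul poolE (var 5)) (var 17)) (add (var 7) (var 0))) w))

/-- The auxiliary label `y` (variable `18`). -/
def labelE : ArithExpr := load (add (var 9) (var 18))

/-- The number of items of label one in the pool. -/
def poolCountE : ArithExpr :=
  add (load (add (var 10) (add (mul poolE (var 5)) (var 17))))
    (sum 18 7 (mul (adjE (var 18)) labelE))

/-- The number of items of label one in the compartment `comp x + r`. -/
def compCountE : ArithExpr :=
  add (sum 18 7 (mul (eqE (div (var 18) (var 6)) itemE) labelE))
    (sum 20 2 (mul (eqE (add (sub (var 3) (const 1)) (var 20)) itemE)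
      (load (add (var 11) (var 20)))))

/-- The number of items in the compartment `comp x + r`. -/
def compCardE : ArithExpr :=
  add (mul (ltE itemE (sub (var 3) (const 1))) (var 6))
    (mul (leE (sub (var 3) (const 1)) itemE)
      (div (sub (add (var 0) (sub (var 2) (const 1))) (sub itemE (sub (var 3) (const 1)))) (var 2)))

/-- The number of pools in compartment `comp x + j` that contain `x`. -/
def degE : ArithExpr := sum 17 5 (adjE (add (var 7) (var 14)))

/-- The total count of the pools in compartment `comp x + j` that contain `x`. -/
def gainE : ArithExpr := sum 17 5 (mul (adjE (add (var 7) (var 14))) poolCountE)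

/-- Indicator that the compartment `c` belongs to the explained part of the window. -/
def explainedE (c : ArithExpr) : ArithExpr :=
  mul (leE (add (add compE (var 15)) (const 1)) (add c (var 3))) (ltE c compE)

/-- The explained part of the counts of the pools in compartment `comp x + j` that contain
`x`. -/
def lossE : ArithExpr :=
  sum 17 5 (mul (adjE (add (var 7) (var 14)))
    (add (sum 18 7 (mul (mul (adjE (var 18)) (explainedE (div (var 18) (var 6)))) labelE))
      (sum 19 0 (mul (mul (adjE (add (var 7) (var 19)))
        (explainedE (add (sub (var 3) (const 1)) (modE (var 19) (var 2)))))
          (load (add (var 12) (var 19)))))))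

/-- The centring term, times `n!` and without the factor `Δ_x[j]`. -/
def centringE : ArithExpr :=
  sum 16 3 (mul (mul (mul (leE (var 16) (var 15)) (sub (var 4) (eqE (var 16) (const 0))))
    compCountE) (div factE (sub compCardE (eqE (var 16) (const 0)))))

/-- The negative part of the rescaled difference of score and threshold. -/
def lhsE (a₁ a₂ : ℕ) : ArithExpr :=
  sum 15 3 (mul (add (add (mul (mul (mul (const a₁) (var 5)) (var 4)) factE)
    (mul (mul (mul (const a₂) (var 6)) degE) centringE))
      (mul (mul (mul (const a₂) (var 6)) factE) lossE))
    (div factE (add (var 15) (const 1))))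

/-- The positive part of the rescaled difference of score and threshold. -/
def rhsE (a₂ : ℕ) : ArithExpr :=
  sum 15 3 (mul (mul (mul (mul (const a₂) (var 6)) factE) gainE)
    (div factE (add (var 15) (const 1))))

/-- The new estimate of the label of `x` in round `t` (variable `13`). -/
def updateE (a₁ a₂ : ℕ) : ArithExpr :=
  add (mul (eqE (modE (var 14) (var 2)) (var 13)) (ltE (lhsE a₁ a₂) (rhsE a₂)))
    (mul (sub (const 1) (mul (eqE (modE (var 14) (var 2)) (var 13)) (ltE (lhsE a₁ a₂) (rhsE a₂))))
      (load (add (var 12) (var 14))))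

end ArithExpr

/-- The values of the parameter variables. -/
structure Env (n : ℕ) (P : Params) (ρ : ℕ → ℕ) : Prop where
  h0 : ρ 0 = n
  h2 : ρ 2 = P.ℓ
  h3 : ρ 3 = P.s
  h4 : ρ 4 = P.g
  h5 : ρ 5 = P.p
  h6 : ρ 6 = P.compSize n
  h7 : ρ 7 = P.numAux n
  h8 : ρ 8 = P.ring
  h9 : ρ 9 = offLabels n P
  h10 : ρ 10 = offCoupled n P
  h11 : ρ 11 = offExtra n P
  h12 : ρ 12 = offOut n P

theorem Env.update {n : ℕ} {P : Params} {ρ : ℕ → ℕ} (h : Env n P ρ) {i : ℕ} (hi : 13 ≤ i)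
    (v : ℕ) : Env n P (Function.update ρ i v) := by
  constructor <;> rw [Function.update_of_ne (by omega)]
  exacts [h.h0, h.h2, h.h3, h.h4, h.h5, h.h6, h.h7, h.h8, h.h9, h.h10, h.h11, h.h12]

/-- The memory holds the input and an estimate of the labels. -/
structure Holds {n : ℕ} {P : Params} (G : Graph n P) (τ : Fin (P.numAux n) → Fin 2)
    (res : PoolIdx P → ℕ) (est : Item n P → Fin 2) (m : ℕ → ℕ) : Prop where
  adj_aux : ∀ (b : Fin P.ring) (a : Fin P.p) (y : Fin (P.numAux n)),
    m (6 + ((b.val * P.p + a.val) * (P.numAux n + n) + y.val)) = if Sum.inl y ∈ G b a then 1 else 0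
  adj_item : ∀ (b : Fin P.ring) (a : Fin P.p) (x : Fin n),
    m (6 + ((b.val * P.p + a.val) * (P.numAux n + n) + (P.numAux n + x.val))) =
      if Sum.inr x ∈ G b a then 1 else 0
  labels : ∀ y, m (offLabels n P + y.val) = (τ y).val
  coupled : ∀ (b : Fin P.ring) (a : Fin P.p),
    m (offCoupled n P + (b.val * P.p + a.val)) = res (Sum.inl (b, a))
  extra : ∀ c : Fin P.ℓ, m (offExtra n P + c.val) = res (Sum.inr c)
  est_aux : ∀ y, est (Sum.inl y) = τ y
  est_item : ∀ x : Fin n, m (offOut n P + x.val) = (est (Sum.inr x)).val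

/-! ### Sizes of the compartments and sums over neighbourhoods -/

section Comp

variable {n : ℕ} {P : Params}

@[simp] theorem comp_inl (y : Fin (P.numAux n)) :
    comp (n := n) (P := P) (Sum.inl y) = y.val / P.compSize n := rfl

@[simp] theorem comp_inr (x : Fin n) :
    comp (n := n) (P := P) (Sum.inr x) = P.s - 1 + x.val % P.ℓ := rfl

@[simp] theorem mem_compartment {c : ℕ} {v : Item n P} : v ∈ compartment n P c ↔ comp v = c := by
  simp [compartment]

theorem comp_inl_lt (y : Fin (P.numAux n)) : y.val / P.compSize n < P.s - 1 :=
  Nat.div_lt_of_lt_mul (by rw [mul_comm]; exact y.2)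

theorem card_compartment_aux (hN : 0 < P.compSize n) {c : ℕ} (hc : c < P.s - 1) :
    (compartment n P c).card = P.compSize n := by
  have : compartment n P c = (Finset.univ.filter fun y : Fin (P.numAux n) =>
      y.val / P.compSize n = c).map Function.Embedding.inl := by
    ext v
    rcases v with y | x
    · simp
    · simp; omega
  rw [this, Finset.card_map, ← Finset.card_map Fin.valEmbedding]
  have e : Finset.map Fin.valEmbedding (Finset.univ.filter fun y : Fin (P.numAux n) =>
      y.val / P.compSize n = c) = Finset.Ico (c * P.compSize n) (c * P.compSize n + P.compSize n) := by
    ext v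
    simp only [Finset.mem_map, Finset.mem_filter, Finset.mem_univ, true_and, Fin.valEmbedding_apply,
      Finset.mem_Ico]
    have hle : (c + 1) * P.compSize n ≤ P.numAux n := Nat.mul_le_mul_right _ (by omega)
    rw [Nat.succ_mul] at hle
    constructor
    · rintro ⟨y, hy, rfl⟩
      rw [Nat.div_eq_iff hN] at hy
      omega
    · intro hv
      refine ⟨⟨v, by omega⟩, ?_, rfl⟩
      rw [Nat.div_eq_iff hN]
      simp only
      omega
  rw [e]; simp

/-- Counts the numbers below `n` in a residue class modulo `ℓ`. The form without case distinction is
the one that `compCardE` evaluates. -/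
theorem card_compartment_item (hℓ : 0 < P.ℓ) {i : ℕ} (hi : i < P.ℓ) :
    (compartment n P (P.s - 1 + i)).card = (n + (P.ℓ - 1) - i) / P.ℓ := by
  have : compartment n P (P.s - 1 + i) = (Finset.univ.filter fun x : Fin n =>
      x.val % P.ℓ = i).map Function.Embedding.inr := by
    ext v
    rcases v with y | x
    · have := comp_inl_lt y
      simp; omega
    · simp
  rw [this, Finset.card_map, ← Finset.card_map Fin.valEmbedding]
  have e : Finset.map Fin.valEmbedding (Finset.univ.filter fun x : Fin n => x.val % P.ℓ = i) =
      (Finset.range n).filter fun x => x ≡ i [MOD P.ℓ] := by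
    ext v
    simp only [Finset.mem_map, Finset.mem_filter, Finset.mem_univ, true_and, Fin.valEmbedding_apply,
      Finset.mem_range, Nat.ModEq, Nat.mod_eq_of_lt hi]
    exact ⟨fun ⟨y, hy, h⟩ => h ▸ ⟨y.2, hy⟩, fun ⟨h1, h2⟩ => ⟨⟨v, h1⟩, h2, rfl⟩⟩
  rw [e, ← Nat.count_eq_card_filter_range, Nat.count_modEq_card _ hℓ, Nat.mod_eq_of_lt hi]
  have hd := Nat.div_add_mod n P.ℓ
  have hm := Nat.mod_lt n hℓ
  set q := n / P.ℓ
  set r := n % P.ℓ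
  symm
  rw [← hd]
  split_ifs with h
  · rw [Nat.div_eq_iff hℓ, Nat.add_mul, mul_comm q]; omega
  · rw [Nat.div_eq_iff hℓ, add_zero, mul_comm q]; omega

theorem sum_nbrs {M : Type*} [AddCommMonoid M] (G : Graph n P) (x : Fin n) (j : ℕ) (b : Fin P.ring)
    (hb : b.val = (comp (P := P) (Sum.inr x) + j) % P.ring) (f : Fin P.ring × Fin P.p → M) :
    ∑ ba ∈ nbrs G x j, f ba = ∑ a, if Sum.inr x ∈ G b a then f (b, a) else 0 := by
  rw [← Finset.sum_filter]
  symm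
  refine Finset.sum_bij (fun a _ => (b, a)) (fun a ha => ?_) (fun a _ a' _ h => by simpa using h)
    (fun ba hba => ?_) (fun _ _ => rfl)
  · simp only [Finset.mem_filter, Finset.mem_univ, true_and] at ha
    simp only [nbrs, Finset.mem_filter, Finset.mem_univ, true_and]
    exact ⟨hb, ha⟩
  · obtain ⟨b', a⟩ := ba
    simp only [nbrs, Finset.mem_filter, Finset.mem_univ, true_and] at hba
    obtain rfl : b' = b := Fin.ext (hba.1.trans hb.symm)
    exact ⟨a, by simpa using hba.2, rfl⟩

end Comp

/-! ### Correctness of the expressions -/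

section Eval

open ArithExpr

variable {n : ℕ} {P : Params} {G : Graph n P} {τ : Fin (P.numAux n) → Fin 2}
  {res : PoolIdx P → ℕ} {est : Item n P → Fin 2} {m ρ : ℕ → ℕ}

theorem eval_compE (hE : Env n P ρ) (x : Fin n) (hx : ρ 14 = x.val) :
    compE.eval m ρ = comp (P := P) (Sum.inr x) := by
  simp [compE, eval, hE.h3, hE.h2, hx]

theorem eval_poolE (hE : Env n P ρ) (x : Fin n) (hx : ρ 14 = x.val) {j : ℕ} (hj : ρ 15 = j) :
    poolE.eval m ρ = (comp (P := P) (Sum.inr x) + j) % P.ring := by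
  simp only [poolE, eval_modE, eval, eval_compE hE x hx, hE.h8, hj]

theorem eval_itemE (hE : Env n P ρ) (x : Fin n) (hx : ρ 14 = x.val) {r : ℕ} (hr : ρ 16 = r) :
    itemE.eval m ρ = (comp (P := P) (Sum.inr x) + r) % P.ring := by
  simp only [itemE, eval_modE, eval, eval_compE hE x hx, hE.h8, hr]

theorem eval_factE (hE : Env n P ρ) : factE.eval m ρ = n.factorial := by
  simp [factE, eval, hE.h0, Finset.prod_range_add_one_eq_factorial]

theorem eval_adjE_aux (hE : Env n P ρ) (hm : Holds G τ res est m) {x : Fin n} (hx : ρ 14 = x.val)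
    {j : ℕ} (hj : ρ 15 = j) {b : Fin P.ring}
    (hb : b.val = (comp (P := P) (Sum.inr x) + j) % P.ring) {a : Fin P.p} (ha : ρ 17 = a.val)
    {y : Fin (P.numAux n)} (hy : ρ 18 = y.val) :
    (adjE (var 18)).eval m ρ = if Sum.inl y ∈ G b a then 1 else 0 := by
  rw [← hm.adj_aux b a y]
  simp only [adjE, eval, eval_poolE hE x hx hj, hE.h5, ha, hE.h7, hE.h0, hy, hb]

theorem eval_adjE_item (hE : Env n P ρ) (hm : Holds G τ res est m) {x : Fin n} (hx : ρ 14 = x.val)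
    {j : ℕ} (hj : ρ 15 = j) {b : Fin P.ring}
    (hb : b.val = (comp (P := P) (Sum.inr x) + j) % P.ring) {a : Fin P.p} (ha : ρ 17 = a.val)
    {i : ℕ} {z : Fin n} (hz : ρ i = z.val) :
    (adjE (add (var 7) (var i))).eval m ρ = if Sum.inr z ∈ G b a then 1 else 0 := by
  rw [← hm.adj_item b a z]
  simp only [adjE, eval, eval_poolE hE x hx hj, hE.h5, ha, hE.h7, hE.h0, hz, hb]

theorem eval_labelE (hE : Env n P ρ) (hm : Holds G τ res est m) {y : Fin (P.numAux n)}
    (hy : ρ 18 = y.val) : labelE.eval m ρ = (τ y).val := by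
  simp only [labelE, eval, hE.h9, hy, hm.labels]

theorem eval_poolCountE (hE : Env n P ρ) (hm : Holds G τ res est m) {x : Fin n} (hx : ρ 14 = x.val)
    {j : ℕ} (hj : ρ 15 = j) {b : Fin P.ring}
    (hb : b.val = (comp (P := P) (Sum.inr x) + j) % P.ring) {a : Fin P.p} (ha : ρ 17 = a.val) :
    poolCountE.eval m ρ = poolCount G τ res b a := by
  rw [poolCountE, poolCount, eval]
  congr 1
  · simp only [eval, eval_poolE hE x hx hj, hE.h10, hE.h5, ha, ← hb, hm.coupled]
  · refine eval_sum_fin hE.h7 _ fun y => ?_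
    have hE' := hE.update (i := 18) (by norm_num) y.val
    rw [eval, eval_adjE_aux (j := j) (b := b) (a := a) (y := y) hE' hm (by simpa using hx)
      (by simpa using hj) hb (by simpa using ha) (by simp), eval_labelE (y := y) hE' hm (by simp), ite_mul, one_mul, zero_mul]

theorem eval_compCountE (hE : Env n P ρ) (hm : Holds G τ res est m) {x : Fin n} (hx : ρ 14 = x.val)
    {r : ℕ} (hr : ρ 16 = r) :
    compCountE.eval m ρ = compCount τ res ((comp (P := P) (Sum.inr x) + r) % P.ring) := by
  simp only [compCountE, compCount]
  rw [eval]
  congr 1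
  · refine eval_sum_fin hE.h7 _ fun y => ?_
    have hE' := hE.update (i := 18) (by norm_num) y.val
    rw [eval, eval_eqE_of (a := y.val / P.compSize n) (by simp [eval, hE.h6])
      (eval_itemE hE' x (by simpa using hx) (r := r) (by simpa using hr)),
      eval_labelE (y := y) hE' hm (by simp)]
    simp only [mem_compartment, comp_inl, ite_mul, one_mul, zero_mul]
  · refine eval_sum_fin hE.h2 _ fun c => ?_
    have hE' := hE.update (i := 20) (by norm_num) c.val
    rw [eval, eval_eqE_of (a := P.s - 1 + c.val) (by simp [eval, hE.h3])
      (eval_itemE hE' x (by simpa using hx) (r := r) (by simpa using hr)), eval, eval, eval, eval,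
      hE'.h11, Function.update_self, hm.extra, ite_mul, one_mul, zero_mul]

theorem eval_compCardE (hE : Env n P ρ) (hN : 0 < P.compSize n) (hℓ : 0 < P.ℓ)
    (hR : 0 < P.ring) {x : Fin n}
    (hx : ρ 14 = x.val) {r : ℕ} (hr : ρ 16 = r) :
    (compCardE.eval m ρ) =
      (compartment n P ((comp (P := P) (Sum.inr x) + r) % P.ring)).card := by
  simp only [compCardE, eval, eval_ltE, eval_leE, eval_itemE hE x hx hr, hE.h0, hE.h2, hE.h3, hE.h6]
  have hlt : (comp (P := P) (Sum.inr x) + r) % P.ring < P.ring :=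
    Nat.mod_lt _ hR
  set c := (comp (P := P) (Sum.inr x) + r) % P.ring
  by_cases hc : c < P.s - 1
  · rw [card_compartment_aux hN hc, if_pos hc, if_neg (by omega)]; simp
  · obtain ⟨i, hi⟩ : ∃ i, c = P.s - 1 + i := ⟨c - (P.s - 1), by omega⟩
    rw [if_neg hc, if_pos (by omega), hi,
      card_compartment_item hℓ (by unfold Params.ring at hlt; omega)]
    simp

theorem eval_degE (hE : Env n P ρ) (hm : Holds G τ res est m) (hR : 0 < P.ring) {x : Fin n}
    (hx : ρ 14 = x.val) {j : ℕ} (hj : ρ 15 = j) : degE.eval m ρ = (nbrs G x j).card := by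
  rw [Finset.card_eq_sum_ones, sum_nbrs G x j ⟨_, Nat.mod_lt _ hR⟩ rfl]
  refine eval_sum_fin hE.h5 _ fun a => ?_
  exact eval_adjE_item (hE.update (by norm_num) _) hm (x := x) (by simpa using hx) (j := j)
    (by simpa using hj) rfl (by simp) (by simpa using hx)

theorem eval_gainE (hE : Env n P ρ) (hm : Holds G τ res est m) (hR : 0 < P.ring) {x : Fin n}
    (hx : ρ 14 = x.val) {j : ℕ} (hj : ρ 15 = j) :
    gainE.eval m ρ = ∑ ba ∈ nbrs G x j, poolCount G τ res ba.1 ba.2 := by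
  rw [sum_nbrs G x j ⟨_, Nat.mod_lt _ hR⟩ rfl]
  refine eval_sum_fin hE.h5 _ fun a => ?_
  have hE' := hE.update (i := 17) (by norm_num) a.val
  rw [eval, eval_adjE_item hE' hm (x := x) (by simpa using hx) (j := j)
      (b := ⟨_, Nat.mod_lt _ hR⟩) (by simpa using hj) rfl (a := a) (by simp) (z := x)
      (by simpa using hx),
    eval_poolCountE hE' hm (x := x) (by simpa using hx) (j := j)
      (b := ⟨_, Nat.mod_lt _ hR⟩) (by simpa using hj) rfl (a := a) (by simp),
    ite_mul, one_mul, zero_mul]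

theorem eval_explainedE (hE : Env n P ρ) {x : Fin n} (hx : ρ 14 = x.val) {j : ℕ} (hj : ρ 15 = j)
    {e : ArithExpr} {c : ℕ} (he : e.eval m ρ = c) :
    (explainedE e).eval m ρ = if comp (P := P) (Sum.inr x) + j + 1 ≤ c + P.s ∧
      c < comp (P := P) (Sum.inr x) then 1 else 0 := by
  simp only [explainedE, eval, eval_leE, eval_ltE, eval_compE hE x hx, hj, he, hE.h3]
  split_ifs <;> omega

theorem eval_lossE (hE : Env n P ρ) (hm : Holds G τ res est m) (hR : 0 < P.ring) {x : Fin n}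
    (hx : ρ 14 = x.val) {j : ℕ} (hj : ρ 15 = j) :
    lossE.eval m ρ = ∑ ba ∈ nbrs G x j, ∑ v ∈ (G ba.1 ba.2).filter fun v =>
        comp (P := P) (Sum.inr x) + j + 1 ≤ comp v + P.s ∧ comp v < comp (P := P) (Sum.inr x),
        (est v).val := by
  obtain ⟨b, hb⟩ : ∃ b : Fin P.ring, b.val = (comp (P := P) (Sum.inr x) + j) % P.ring :=
    ⟨⟨_, Nat.mod_lt _ hR⟩, rfl⟩
  rw [sum_nbrs G x j b hb]
  refine eval_sum_fin hE.h5 _ fun a => ?_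
  have hE' := hE.update (i := 17) (by norm_num) a.val
  rw [eval, eval_adjE_item hE' hm (x := x) (by simpa using hx) (j := j)
      (b := b) (by simpa using hj) hb (a := a) (by simp) (z := x)
      (by simpa using hx)]
  simp only [ite_mul, one_mul, zero_mul]
  refine if_congr Iff.rfl ?_ rfl
  rw [← Finset.univ_inter (G _ _), ← Finset.filter_mem_eq_inter, Finset.filter_filter,
    Finset.sum_filter, Fintype.sum_sum_type, eval]
  congr 1
  · refine eval_sum_fin hE'.h7 _ fun y => ?_
    have hE'' := hE'.update (i := 18) (by norm_num) y.val
    rw [eval, eval, eval_adjE_aux hE'' hm (x := x) (by simpa using hx) (j := j)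
        (b := b) (by simpa using hj) hb (a := a) (by simp) (y := y) (by simp),
      eval_explainedE hE'' (x := x) (by simpa using hx) (j := j) (by simpa using hj)
        (c := comp (n := n) (P := P) (Sum.inl y)) (by simp [eval, hE.h6]),
      eval_labelE hE'' hm (y := y) (by simp), hm.est_aux]
    by_cases h : Sum.inl y ∈ G b a
    · simp only [h, true_and, if_true, one_mul, ite_mul, zero_mul]
    · simp only [h, false_and, if_false, zero_mul]
  · refine eval_sum_fin hE'.h0 _ fun z => ?_
    have hE'' := hE'.update (i := 19) (by norm_num) z.val
    rw [eval, eval, eval_adjE_item hE'' hm (x := x) (by simpa using hx) (j := j)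
        (b := b) (by simpa using hj) hb (a := a) (by simp) (z := z) (by simp),
      eval_explainedE hE'' (x := x) (by simpa using hx) (j := j) (by simpa using hj)
        (c := comp (n := n) (P := P) (Sum.inr z))
        (by simp only [eval, eval_modE, hE''.h3, hE''.h2, comp_inr, Function.update_self])]
    simp only [eval, hE''.h12, Function.update_self, hm.est_item]
    by_cases h : Sum.inr z ∈ G b a
    · simp only [h, true_and, if_true, one_mul, ite_mul, zero_mul]
    · simp only [h, false_and, if_false, zero_mul]

theorem eval_centringE (hE : Env n P ρ) (hm : Holds G τ res est m) (hN : 0 < P.compSize n)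
    (hℓ : 0 < P.ℓ) (hR : 0 < P.ring) {x : Fin n} (hx : ρ 14 = x.val) {j : ℕ} (hj : ρ 15 = j) :
    centringE.eval m ρ = ∑ r ∈ Finset.range P.s, (if r ≤ j then 1 else 0) *
      (P.g - if r = 0 then 1 else 0) * compCount τ res ((comp (P := P) (Sum.inr x) + r) % P.ring) *
      (n.factorial / ((compartment n P ((comp (P := P) (Sum.inr x) + r) % P.ring)).card -
        if r = 0 then 1 else 0)) := by
  refine eval_sum_range hE.h3 _ fun r _ => ?_
  have hE' := hE.update (i := 16) (by norm_num) r
  simp only [eval, eval_leE, eval_eqE]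
  rw [eval_compCountE hE' hm (x := x) (by simpa using hx) (r := r) (by simp),
    eval_compCardE hE' hN hℓ hR (x := x) (by simpa using hx) (r := r) (by simp),
    eval_factE hE', hE'.h4]
  simp [hj]

theorem eval_lhsE (hE : Env n P ρ) (hm : Holds G τ res est m) (hN : 0 < P.compSize n)
    (hℓ : 0 < P.ℓ) (hR : 0 < P.ring) (a₁ a₂ : ℕ) {x : Fin n} (hx : ρ 14 = x.val) :
    (lhsE a₁ a₂).eval m ρ = ∑ j ∈ Finset.range P.s, (a₁ * P.p * P.g * n.factorial +
      a₂ * P.compSize n * (nbrs G x j).card * (∑ r ∈ Finset.range P.s, (if r ≤ j then 1 else 0) *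
      (P.g - if r = 0 then 1 else 0) * compCount τ res ((comp (P := P) (Sum.inr x) + r) % P.ring) *
      (n.factorial / ((compartment n P ((comp (P := P) (Sum.inr x) + r) % P.ring)).card -
        if r = 0 then 1 else 0))) +
      a₂ * P.compSize n * n.factorial * ∑ ba ∈ nbrs G x j, ∑ v ∈ (G ba.1 ba.2).filter fun v =>
        comp (P := P) (Sum.inr x) + j + 1 ≤ comp v + P.s ∧ comp v < comp (P := P) (Sum.inr x),
        (est v).val) * (n.factorial / (j + 1)) := by
  refine eval_sum_range hE.h3 _ fun j _ => ?_
  have hE' := hE.update (i := 15) (by norm_num) j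
  simp only [eval]
  rw [eval_centringE hE' hm hN hℓ hR (x := x) (by simpa using hx) (j := j) (by simp),
    eval_degE hE' hm hR (x := x) (by simpa using hx) (j := j) (by simp),
    eval_lossE hE' hm hR (x := x) (by simpa using hx) (j := j) (by simp),
    eval_factE hE', hE'.h4, hE'.h5, hE'.h6, Function.update_self]

theorem eval_rhsE (hE : Env n P ρ) (hm : Holds G τ res est m) (hR : 0 < P.ring) (a₂ : ℕ)
    {x : Fin n} (hx : ρ 14 = x.val) :
    (rhsE a₂).eval m ρ = ∑ j ∈ Finset.range P.s, (a₂ * P.compSize n * n.factorial *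
      ∑ ba ∈ nbrs G x j, poolCount G τ res ba.1 ba.2) * (n.factorial / (j + 1)) := by
  refine eval_sum_range hE.h3 _ fun j _ => ?_
  have hE' := hE.update (i := 15) (by norm_num) j
  simp only [eval]
  rw [eval_gainE hE' hm hR (x := x) (by simpa using hx) (j := j) (by simp),
    eval_factE hE', hE'.h6, Function.update_self]

end Eval

/-! ### Rational form of the comparison of score and threshold -/

section Rational

variable {n : ℕ} {P : Params}

/-- The threshold `a * H_s * √(m / k)`, where `H_s` is the harmonic number. -/
noncomputable def harmonicThreshold (k : ℕ) (P : Params) (a : ℝ) : ℝ :=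
  a * (∑ j ∈ Finset.range P.s, 1 / ((j : ℝ) + 1)) * √((numCoupled P : ℝ) / (k : ℝ))

/-- The score of an item without the normalisation by `Δ / s * √(k / m)`. -/
noncomputable def rawScore (G : Graph n P) (τ : Fin (P.numAux n) → Fin 2) (res : PoolIdx P → ℕ)
    (est : Item n P → Fin 2) (x : Fin n) : ℝ :=
  ∑ j ∈ Finset.range P.s,
    ((unexplained G τ res est x j : ℝ) - centring G τ res x j) / ((j : ℝ) + 1)

/-- The root `√(m / k)` in the threshold cancels the root `√(k / m)` in the normalisation of the
score. As the threshold contains a harmonic number instead of a logarithm, the comparison is one of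
rational numbers whenever `a` is rational. -/
theorem harmonicThreshold_lt_score_iff {k : ℕ} (hk : 0 < k) (hm : 0 < numCoupled P)
    (hD : 0 < meanDeg n P) (a : ℝ) (G : Graph n P) (τ : Fin (P.numAux n) → Fin 2)
    (res : PoolIdx P → ℕ) (est : Item n P → Fin 2) (x : Fin n) :
    harmonicThreshold k P a < score k G τ res est x ↔
      a * (∑ j ∈ Finset.range P.s, 1 / ((j : ℝ) + 1)) * meanDeg n P <
        rawScore G τ res est x := by
  have hk' : (0 : ℝ) < k := by exact_mod_cast hk
  have hm' : (0 : ℝ) < numCoupled P := by exact_mod_cast hm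
  have hκ : 0 < √((k : ℝ) / (numCoupled P : ℝ)) := Real.sqrt_pos.2 (by positivity)
  have hs : score k G τ res est x =
      rawScore G τ res est x / (meanDeg n P * √((k : ℝ) / (numCoupled P : ℝ))) := by
    rw [score, rawScore, Finset.sum_div]
    refine Finset.sum_congr rfl fun j _ => ?_
    rw [div_div, mul_assoc]
  have ht : √((numCoupled P : ℝ) / (k : ℝ)) * √((k : ℝ) / (numCoupled P : ℝ)) = 1 := by
    rw [← Real.sqrt_mul (by positivity), div_mul_div_comm, mul_comm, div_self (by positivity),
      Real.sqrt_one]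
  rw [hs, lt_div_iff₀ (by positivity), harmonicThreshold]
  have e : ∀ H κ' κ D : ℝ, κ' * κ = 1 → a * H * κ' * (D * κ) = a * H * D := fun H κ' κ D h => by
    linear_combination a * H * D * h
  rw [e _ _ _ _ ht]

/-- The rational inequality is multiplied by `a₂ * P.compSize n * n! * n!`. One factorial clears the
weights `1 / (j + 1)`, where `j + 1 ≤ P.s ≤ n`, the other one the denominators of the centring term,
which lie between `1` and `n`. Subtracted terms go to the left-hand side, so that no truncated
subtraction interferes. -/
theorem natDecision_iff {G : Graph n P} {τ : Fin (P.numAux n) → Fin 2} {res : PoolIdx P → ℕ}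
    {est : Item n P → Fin 2} (x : Fin n) (a₁ : ℕ) {a₂ : ℕ} (ha₂ : 0 < a₂)
    (hN : 0 < P.compSize n) (hg : 0 < P.g) (hs₀ : 0 < P.s) (hs : P.s ≤ n)
    (hc : ∀ c < P.ring, 2 ≤ (compartment n P c).card ∧ (compartment n P c).card ≤ n)
    (hR : 0 < P.ring) (hℓ : 0 < P.ℓ) :
    (∑ j ∈ Finset.range P.s, (a₁ * P.p * P.g * n.factorial +
      a₂ * P.compSize n * (nbrs G x j).card * (∑ r ∈ Finset.range P.s, (if r ≤ j then 1 else 0) *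
      (P.g - if r = 0 then 1 else 0) * compCount τ res ((comp (P := P) (Sum.inr x) + r) % P.ring) *
      (n.factorial / ((compartment n P ((comp (P := P) (Sum.inr x) + r) % P.ring)).card -
        if r = 0 then 1 else 0))) +
      a₂ * P.compSize n * n.factorial * ∑ ba ∈ nbrs G x j, ∑ v ∈ (G ba.1 ba.2).filter fun v =>
        comp (P := P) (Sum.inr x) + j + 1 ≤ comp v + P.s ∧ comp v < comp (P := P) (Sum.inr x),
        (est v).val) * (n.factorial / (j + 1)) <
    ∑ j ∈ Finset.range P.s, (a₂ * P.compSize n * n.factorial *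
      ∑ ba ∈ nbrs G x j, poolCount G τ res ba.1 ba.2) * (n.factorial / (j + 1))) ↔
    (a₁ / a₂ : ℝ) * (∑ j ∈ Finset.range P.s, 1 / ((j : ℝ) + 1)) * meanDeg n P <
      rawScore G τ res est x := by
  have hF : (0 : ℝ) < n.factorial := by exact_mod_cast n.factorial_pos
  have hN' : (0 : ℝ) < P.compSize n := by exact_mod_cast hN
  have ha' : (0 : ℝ) < a₂ := by exact_mod_cast ha₂
  rw [← Nat.cast_lt (α := ℝ)]
  have hdiv : ∀ j < P.s, ((n.factorial / (j + 1) : ℕ) : ℝ) = n.factorial / ((j : ℝ) + 1) := by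
    intro j hj
    rw [Nat.cast_div (Nat.dvd_factorial (by omega) (by omega)) (by positivity)]
    simp
  set i := comp (P := P) (Sum.inr x) with hi
  have hiR : i < P.ring := by
    have h1 := Nat.mod_lt x.val hℓ
    have h2 : i = P.s - 1 + x.val % P.ℓ := comp_inr x
    show i < P.ℓ + P.s - 1
    omega
  have hcen : ∀ j < P.s, (((nbrs G x j).card * (∑ r ∈ Finset.range P.s, (if r ≤ j then 1 else 0) *
      (P.g - if r = 0 then 1 else 0) * compCount τ res ((i + r) % P.ring) *
      (n.factorial / ((compartment n P ((i + r) % P.ring)).card -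
        if r = 0 then 1 else 0))) : ℕ) : ℝ) = n.factorial * centring G τ res x j := by
    intro j hj
    rw [Nat.cast_mul, centring, mul_left_comm]
    congr 1
    rw [Finset.mul_sum, Nat.cast_sum]
    rw [← Finset.sum_subset (Finset.range_subset_range.2 (show j + 1 ≤ P.s by omega))
      (fun r _ hr => by
        rw [Finset.mem_range] at hr
        rw [if_neg (by omega)]; simp)]
    refine Finset.sum_congr rfl fun r hr => ?_
    rw [Finset.mem_range] at hr
    rw [if_pos (by omega), one_mul, ← hi]
    have hlt : (i + r) % P.ring < P.ring := Nat.mod_lt _ hR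
    have h2 := hc _ hlt
    -- Since `r < P.ring`, the window meets the compartment of `x` at `r = 0` only, so only there
    -- does erasing `x` have an effect.
    have hcard : (((compartment n P ((i + r) % P.ring)).erase (Sum.inr x)).card) =
        (compartment n P ((i + r) % P.ring)).card - if r = 0 then 1 else 0 := by
      by_cases hr0 : r = 0
      · rw [Finset.card_erase_of_mem, if_pos hr0]
        rw [mem_compartment, ← hi, hr0, add_zero, Nat.mod_eq_of_lt hiR]
      · rw [Finset.erase_eq_of_notMem, if_neg hr0, Nat.sub_zero]
        rw [mem_compartment, ← hi]
        intro h
        have hrs : r < P.ring := by unfold Params.ring; omega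
        by_cases hw : i + r < P.ring
        · rw [Nat.mod_eq_of_lt hw] at h; omega
        · rw [Nat.mod_eq_sub_mod (by omega), Nat.mod_eq_of_lt (by omega)] at h; omega
    rw [hcard]
    rw [Nat.cast_mul, Nat.cast_mul, Nat.cast_div]
    · rw [Nat.cast_sub (by split_ifs <;> omega)]
      push_cast
      ring
    · exact Nat.dvd_factorial (by split_ifs <;> omega) (by split_ifs <;> omega)
    · rw [Nat.cast_ne_zero]; split_ifs <;> omega
  have hL : ((∑ j ∈ Finset.range P.s, (a₁ * P.p * P.g * n.factorial +
      a₂ * P.compSize n * (nbrs G x j).card * (∑ r ∈ Finset.range P.s, (if r ≤ j then 1 else 0) *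
      (P.g - if r = 0 then 1 else 0) * compCount τ res ((i + r) % P.ring) *
      (n.factorial / ((compartment n P ((i + r) % P.ring)).card -
        if r = 0 then 1 else 0))) +
      a₂ * P.compSize n * n.factorial * ∑ ba ∈ nbrs G x j, ∑ v ∈ (G ba.1 ba.2).filter fun v =>
        i + j + 1 ≤ comp v + P.s ∧ comp v < i,
        (est v).val) * (n.factorial / (j + 1)) : ℕ) : ℝ) = a₂ * P.compSize n * n.factorial *
      n.factorial * ∑ j ∈ Finset.range P.s, ((a₁ / a₂ : ℝ) * meanDeg n P + centring G τ res x j +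
        ∑ ba ∈ nbrs G x j, ∑ v ∈ (G ba.1 ba.2).filter fun v =>
        i + j + 1 ≤ comp v + P.s ∧ comp v < i, ((est v).val : ℝ)) * (1 / ((j : ℝ) + 1)) := by
    rw [Nat.cast_sum, Finset.mul_sum]
    refine Finset.sum_congr rfl fun j hj => ?_
    rw [Finset.mem_range] at hj
    rw [mul_assoc (a₂ * P.compSize n), Nat.cast_mul, hdiv j hj, Nat.cast_add, Nat.cast_add,
      Nat.cast_mul _ (_ * _), hcen j hj, meanDeg]
    push_cast
    field_simp
  have hRr : ((∑ j ∈ Finset.range P.s, (a₂ * P.compSize n * n.factorial *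
      ∑ ba ∈ nbrs G x j, poolCount G τ res ba.1 ba.2) * (n.factorial / (j + 1)) : ℕ) : ℝ) =
      a₂ * P.compSize n * n.factorial * n.factorial * ∑ j ∈ Finset.range P.s,
        (∑ ba ∈ nbrs G x j, (poolCount G τ res ba.1 ba.2 : ℝ)) * (1 / ((j : ℝ) + 1)) := by
    rw [Nat.cast_sum, Finset.mul_sum]
    refine Finset.sum_congr rfl fun j hj => ?_
    rw [Finset.mem_range] at hj
    rw [Nat.cast_mul, hdiv j hj]
    push_cast
    field_simp
  rw [hL, hRr, mul_lt_mul_iff_right₀ (by positivity), ← sub_pos, ← sub_pos (b := _ * _ * meanDeg n P),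
    ← Finset.sum_sub_distrib]
  have e : rawScore G τ res est x - (a₁ / a₂ : ℝ) * (∑ j ∈ Finset.range P.s, 1 / ((j : ℝ) + 1)) *
      meanDeg n P = ∑ j ∈ Finset.range P.s,
      ((∑ ba ∈ nbrs G x j, (poolCount G τ res ba.1 ba.2 : ℝ)) * (1 / ((j : ℝ) + 1)) -
      ((a₁ / a₂ : ℝ) * meanDeg n P + centring G τ res x j +
        ∑ ba ∈ nbrs G x j, ∑ v ∈ (G ba.1 ba.2).filter fun v =>
        i + j + 1 ≤ comp v + P.s ∧ comp v < i, ((est v).val : ℝ)) * (1 / ((j : ℝ) + 1))) := by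
    rw [rawScore, Finset.mul_sum, Finset.sum_mul, ← Finset.sum_sub_distrib]
    refine Finset.sum_congr rfl fun j _ => ?_
    rw [unexplained]
    push_cast
    rw [Finset.sum_sub_distrib]
    ring
  rw [e]

end Rational

/-! ### The program -/

open ArithExpr in
/-- Expressions for the values of the parameter variables. -/
def paramE : ℕ → ArithExpr
  | 0 => load (const 0)
  | 1 => load (const 1)
  | 2 => load (const 2)
  | 3 => load (const 3)
  | 4 => load (const 4)
  | 5 => load (const 5)
  | 6 => div (sub (add (var 0) (var 2)) (const 1)) (var 2)
  | 7 => mul (sub (var 3) (const 1)) (var 6)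
  | 8 => sub (add (var 2) (var 3)) (const 1)
  | 9 => add (const 6) (mul (var 8) (mul (var 5) (add (var 7) (var 0))))
  | 10 => add (var 9) (var 7)
  | 11 => add (var 10) (mul (var 8) (var 5))
  | 12 => add (var 11) (var 2)
  | _ => const 0

/-- The values of the parameter variables. -/
def paramVal (n k : ℕ) (P : Params) : ℕ → ℕ
  | 0 => n
  | 1 => k
  | 2 => P.ℓ
  | 3 => P.s
  | 4 => P.g
  | 5 => P.p
  | 6 => P.compSize n
  | 7 => P.numAux n
  | 8 => P.ring
  | 9 => offLabels n P
  | 10 => offCoupled n P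
  | 11 => offExtra n P
  | 12 => offOut n P
  | _ => 0

open ArithExpr in
/-- The thresholding algorithm with threshold `a₁ / a₂ * H_s * √(m / k)`. -/
def decoderProg (a₁ a₂ : ℕ) : RamProg :=
  .seq (.assignFirst paramE 13) <|
  .seq (.forVar 13 2 0 (.forVar 14 0 4 (.storeAt 8 (add (var 12) (var 14)) (updateE a₁ a₂)))) <|
  .forVar 14 0 0 (.storeAt 4 (var 14) (load (add (var 12) (var 14))))

open ArithExpr Polynomial in
/-- A bound for the running time of `decoderProg` in terms of a bound for the parameters and the
input length. -/
noncomputable def decoderCost (a₁ a₂ : ℕ) : ℕ[X] :=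
  (∑ i ∈ Finset.range 13, (2 * (paramE i).cost + 2)) + 1 +
  (X * ((X * ((2 * (add (var 12) (var 14)).cost + 2 * (updateE a₁ a₂).cost + 1) + 3 * X + 5) +
    3 * X + 8) + 3 * X + 5) + 3 * X + 8) +
  (X * ((2 * (var 14).cost + 2 * (load (add (var 12) (var 14))).cost + 1) + 3 * X + 5) + 3 * X + 8)

/-! ### Updating the estimate in place -/

section Estimates

variable {n : ℕ} {P : Params}

theorem unexplained_congr (G : Graph n P) (τ : Fin (P.numAux n) → Fin 2) (res : PoolIdx P → ℕ)
    {est est' : Item n P → Fin 2} (x : Fin n) (j : ℕ)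
    (h : ∀ v, comp v < comp (P := P) (Sum.inr x) → est v = est' v) :
    unexplained G τ res est x j = unexplained G τ res est' x j := by
  unfold unexplained
  refine Finset.sum_congr rfl fun ba _ => ?_
  congr 1
  refine Finset.sum_congr rfl fun v hv => ?_
  rw [h v (Finset.mem_filter.1 hv).2.2]

/-- The estimate enters only through the subtracted labels, which belong to strictly earlier
compartments. This permits the program to overwrite labels within a round, and it drives the
induction in `decode_eq_of_score`. -/
theorem score_congr (k : ℕ) (G : Graph n P) (τ : Fin (P.numAux n) → Fin 2) (res : PoolIdx P → ℕ)
    {est est' : Item n P → Fin 2} (x : Fin n)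
    (h : ∀ v, comp v < comp (P := P) (Sum.inr x) → est v = est' v) :
    score k G τ res est x = score k G τ res est' x := by
  unfold score
  exact Finset.sum_congr rfl fun j _ => by rw [unexplained_congr G τ res x j h]

variable (k : ℕ) (T : ℝ) (G : Graph n P) (τ : Fin (P.numAux n) → Fin 2) (res : PoolIdx P → ℕ)

theorem estimate_inl (t : ℕ) (y : Fin (P.numAux n)) :
    estimate k T G τ res t (Sum.inl y) = τ y := by
  cases t <;> rfl

open Classical in
theorem estimate_succ_inr (t : ℕ) (x : Fin n) : estimate k T G τ res (t + 1) (Sum.inr x) =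
    if comp (P := P) (Sum.inr x) = P.s - 1 + t ∧ T < score k G τ res (estimate k T G τ res t) x
      then 1 else estimate k T G τ res t (Sum.inr x) := rfl

open Classical in
theorem estimate_succ_inr_mod (t : ℕ) (x : Fin n) : estimate k T G τ res (t + 1) (Sum.inr x) =
    if x.val % P.ℓ = t ∧ T < score k G τ res (estimate k T G τ res t) x
      then 1 else estimate k T G τ res t (Sum.inr x) := by
  rw [estimate_succ_inr]
  refine if_congr ?_ rfl rfl
  rw [comp_inr, Nat.add_left_cancel_iff]

theorem estimate_succ_of_ne (t : ℕ) (v : Item n P) (hv : comp v ≠ P.s - 1 + t) :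
    estimate k T G τ res (t + 1) v = estimate k T G τ res t v := by
  rcases v with y | x
  · rw [estimate_inl, estimate_inl]
  · rw [estimate_succ_inr, if_neg fun h => hv h.1]

/-- The estimate of the labels in round `t`, after the items less than `x` were treated. -/
noncomputable def partialEstimate (t x : ℕ) : Item n P → Fin 2
  | Sum.inl y => τ y
  | Sum.inr z => if z.val < x then estimate k T G τ res (t + 1) (Sum.inr z)
      else estimate k T G τ res t (Sum.inr z)

theorem partialEstimate_zero (t : ℕ) :
    partialEstimate k T G τ res t 0 = estimate k T G τ res t := by
  funext v
  rcases v with y | x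
  · rw [estimate_inl]; rfl
  · simp [partialEstimate]

theorem partialEstimate_last (t : ℕ) :
    partialEstimate k T G τ res t n = estimate k T G τ res (t + 1) := by
  funext v
  rcases v with y | x
  · rw [estimate_inl]; rfl
  · simp [partialEstimate]

theorem partialEstimate_of_ne (t x : ℕ) (v : Item n P) (hv : comp v ≠ P.s - 1 + t) :
    partialEstimate k T G τ res t x v = estimate k T G τ res t v := by
  rcases v with y | z
  · rw [estimate_inl]; rfl
  · rw [partialEstimate, estimate_succ_of_ne _ _ _ _ _ _ _ hv, ite_self]

/-- The memory that holds the input and, behind it, an estimate of the labels. -/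
def memOf (est : Item n P → Fin 2) (a : ℕ) : ℕ :=
  if h : offOut n P ≤ a ∧ a - offOut n P < n then (est (Sum.inr ⟨a - offOut n P, h.2⟩)).val
  else (encodeInput k G τ res).getD a 0

theorem memOf_of_lt (est : Item n P → Fin 2) {a : ℕ} (ha : a < offOut n P) :
    memOf k G τ res est a = (encodeInput k G τ res).getD a 0 := by
  rw [memOf, dif_neg (by omega)]

theorem memOf_add (est : Item n P → Fin 2) (x : Fin n) :
    memOf k G τ res est (offOut n P + x.val) = (est (Sum.inr x)).val := by
  rw [memOf, dif_pos ⟨by omega, by omega⟩]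
  congr 3
  ext
  simp

theorem update_memOf {est est' : Item n P → Fin 2} (x : Fin n)
    (h : ∀ z, z ≠ x → est' (Sum.inr z) = est (Sum.inr z)) :
    Function.update (memOf k G τ res est) (offOut n P + x.val) (est' (Sum.inr x)).val =
      memOf k G τ res est' := by
  funext a
  rw [Function.update_apply]
  split_ifs with ha
  · rw [ha, memOf_add]
  · unfold memOf
    split_ifs with hb
    · rw [h]
      intro hx
      rw [← hx] at ha
      simp only at ha
      omega
    · rfl

/-- The cells behind the input are zero, which is the initial estimate of the unknown labels, so the
program need not initialise them. -/
theorem memOf_initial : memOf k G τ res (estimate k T G τ res 0) =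
    (initState (encodeInput k G τ res)).mem := by
  funext a
  unfold memOf
  split_ifs with h
  · simp only [estimate, Sum.elim_inr, initState, Fin.val_zero]
    rw [List.getD_eq_default _ _ (by rw [length_encodeInput]; exact h.1)]
  · rfl

theorem holds_memOf {est : Item n P → Fin 2} (hest : ∀ y, est (Sum.inl y) = τ y) :
    Holds G τ res est (memOf k G τ res est) where
  adj_aux b a y := by
    rw [memOf, dif_neg, getD_adj_aux]
    have h1 : (b.val * P.p + a.val + 1) * (P.numAux n + n) ≤
        P.ring * (P.p * (P.numAux n + n)) := by
      rw [← mul_assoc]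
      refine Nat.mul_le_mul_right _ ?_
      have h2 : (b.val + 1) * P.p ≤ P.ring * P.p := Nat.mul_le_mul_right _ b.2
      rw [Nat.succ_mul] at h2
      omega
    rw [Nat.succ_mul] at h1
    simp only [offOut, offExtra, offCoupled, offLabels]
    omega
  adj_item b a x := by
    rw [memOf, dif_neg, getD_adj_item]
    have h1 : (b.val * P.p + a.val + 1) * (P.numAux n + n) ≤
        P.ring * (P.p * (P.numAux n + n)) := by
      rw [← mul_assoc]
      refine Nat.mul_le_mul_right _ ?_
      have h2 : (b.val + 1) * P.p ≤ P.ring * P.p := Nat.mul_le_mul_right _ b.2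
      rw [Nat.succ_mul] at h2
      omega
    rw [Nat.succ_mul] at h1
    simp only [offOut, offExtra, offCoupled, offLabels]
    omega
  labels y := by
    rw [memOf_of_lt _ _ _ _ _ (by simp only [offOut, offExtra, offCoupled]; omega), getD_labels]
  coupled b a := by
    have h2 : (b.val + 1) * P.p ≤ P.ring * P.p := Nat.mul_le_mul_right _ b.2
    rw [Nat.succ_mul] at h2
    rw [memOf_of_lt _ _ _ _ _ (by simp only [offOut, offExtra]; omega), getD_coupled]
  extra c := by
    rw [memOf_of_lt _ _ _ _ _ (by simp only [offOut]; omega), getD_extra]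
  est_aux := hest
  est_item x := memOf_add ..

end Estimates

theorem results_le {n : ℕ} {ι : Type} (A : ι → Finset (Fin n)) (σ : Fin n → Fin 2) (i : ι) :
    results A σ i ≤ n := by
  calc results A σ i ≤ ∑ x ∈ A i, 1 := Finset.sum_le_sum fun x _ => by omega
    _ ≤ n := by simpa using Finset.card_le_univ (A i)

/-- The conditions on the parameters under which the program is correct. -/
structure Params.Proper (n : ℕ) (P : Params) : Prop where
  s_pos : 0 < P.s
  s_le_n : P.s ≤ n
  g_pos : 0 < P.g
  p_pos : 0 < P.p
  ℓ_pos : 0 < P.ℓ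
  two_le_card : ∀ c < P.ring, 2 ≤ (compartment n P c).card
  card_le : ∀ c < P.ring, (compartment n P c).card ≤ n

namespace Params.Proper

variable {n : ℕ} {P : Params} (hP : P.Proper n)

theorem ring_pos (hP : P.Proper n) : 0 < P.ring := by
  have h1 := hP.s_pos
  have h2 := hP.ℓ_pos
  show 0 < P.ℓ + P.s - 1
  omega

theorem compSize_pos (hP : P.Proper n) : 0 < P.compSize n := by
  have h1 := hP.s_pos
  have h2 := hP.ℓ_pos
  have h3 := hP.s_le_n
  exact Nat.div_pos (by omega) h2

theorem meanDeg_pos (hP : P.Proper n) : 0 < meanDeg n P := by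
  have h1 : (0 : ℝ) < P.p := by exact_mod_cast hP.p_pos
  have h2 : (0 : ℝ) < P.g := by exact_mod_cast hP.g_pos
  have h3 : (0 : ℝ) < P.compSize n := by exact_mod_cast hP.compSize_pos
  unfold meanDeg
  positivity

theorem numCoupled_pos (hP : P.Proper n) : 0 < numCoupled P :=
  Nat.mul_pos hP.ring_pos hP.p_pos

end Params.Proper

open ArithExpr in
-- In the middle of round `t` the memory mixes old and new labels. They differ in the current
-- compartment only, which the score of `x` ignores by `score_congr`.
theorem eval_updateE {n k : ℕ} {P : Params} (hP : P.Proper n) (hk : 0 < k) (a₁ : ℕ) {a₂ : ℕ}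
    (ha₂ : 0 < a₂) {G : Graph n P} {τ : Fin (P.numAux n) → Fin 2} {res : PoolIdx P → ℕ}
    {m ρ : ℕ → ℕ} (hE : Env n P ρ) {t : ℕ} (x : Fin n) (ht : ρ 13 = t) (hx : ρ 14 = x.val)
    (hm : Holds G τ res
      (partialEstimate k (harmonicThreshold k P (a₁ / a₂)) G τ res t x.val) m) :
    (updateE a₁ a₂).eval m ρ =
      (estimate k (harmonicThreshold k P (a₁ / a₂)) G τ res (t + 1) (Sum.inr x)).val := by
  have h1 : (eqE (modE (var 14) (var 2)) (var 13)).eval m ρ = if x.val % P.ℓ = t then 1 else 0 :=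
    eval_eqE_of (by simp [eval, hx, hE.h2]) (by simp [eval, ht])
  have hcomp : comp (n := n) (P := P) (Sum.inr x) = P.s - 1 + t ↔ x.val % P.ℓ = t := by
    rw [comp_inr]; omega
  have h2 : (ltE (lhsE a₁ a₂) (rhsE a₂)).eval m ρ = if (lhsE a₁ a₂).eval m ρ < (rhsE a₂).eval m ρ
      then 1 else 0 := eval_ltE ..
  have h3 : (mul (eqE (modE (var 14) (var 2)) (var 13)) (ltE (lhsE a₁ a₂) (rhsE a₂))).eval m ρ =
      (if x.val % P.ℓ = t then 1 else 0) *
        if (lhsE a₁ a₂).eval m ρ < (rhsE a₂).eval m ρ then 1 else 0 := by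
    rw [eval, h1, h2]
  rw [estimate_succ_inr_mod, updateE, eval, h3, eval, eval, h3]
  simp only [eval, hE.h12, hx, hm.est_item]
  by_cases hxt : x.val % P.ℓ = t
  · rw [eval_lhsE hE hm hP.compSize_pos hP.ℓ_pos hP.ring_pos a₁ a₂ hx,
      eval_rhsE hE hm hP.ring_pos a₂ hx]
    have key := natDecision_iff (G := G) (τ := τ) (res := res)
      (est := partialEstimate k (harmonicThreshold k P (a₁ / a₂)) G τ res t x.val) x a₁ ha₂
      hP.compSize_pos hP.g_pos hP.s_pos hP.s_le_n
      (fun c hc => ⟨hP.two_le_card c hc, hP.card_le c hc⟩) hP.ring_pos hP.ℓ_pos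
    rw [← harmonicThreshold_lt_score_iff hk hP.numCoupled_pos hP.meanDeg_pos,
      score_congr k G τ res x (est' := estimate k (harmonicThreshold k P (a₁ / a₂)) G τ res t)
        (fun v hv => partialEstimate_of_ne _ _ _ _ _ _ _ _ (by rw [hcomp.2 hxt] at hv; omega))]
      at key
    simp only [key, hxt, true_and, if_true, one_mul]
    split_ifs <;> simp [partialEstimate]
  · simp [hxt, partialEstimate]

open ArithExpr in
theorem computesWithin_decoderProg {n k : ℕ} {P : Params} (hP : P.Proper n) (hk : 0 < k) (a₁ : ℕ)
    {a₂ : ℕ} (ha₂ : 0 < a₂) {B : ℕ} (hB : ∀ i, paramVal n k P i ≤ B) :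
    ComputesWithin (decoderProg a₁ a₂) n k P (harmonicThreshold k P (a₁ / a₂))
      ((decoderCost a₁ a₂).eval B) := by
  intro G τ σ _
  set res := results (pools G) σ with hres
  set T := harmonicThreshold k P (a₁ / a₂)
  set m₀ := memOf k G τ res (estimate k T G τ res 0) with hm₀
  have h1B : 1 ≤ B := le_trans (show 1 ≤ paramVal n k P 12 by
    simp only [paramVal, offOut, offExtra, offCoupled, offLabels]; omega) (hB 12)
  have hval : ∀ a, (encodeInput k G τ res).getD a 0 ≤ B := by
    intro a
    rw [List.getD_eq_getElem?_getD]
    by_cases ha : a < (encodeInput k G τ res).length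
    · rw [List.getElem?_eq_getElem ha, Option.getD_some]
      exact le_of_mem_encodeInput k G τ res h1B (hB 0) (hB 1) (hB 2) (hB 3) (hB 4) (hB 5)
        (fun i => (results_le _ _ _).trans (hB 0)) (List.getElem_mem ha)
    · rw [List.getElem?_eq_none (by omega)]; simp
  have hmem : ∀ est a, (memOf k G τ res est a).size ≤ B := by
    intro est a
    refine (size_le_self _).trans ?_
    unfold memOf
    split_ifs
    · have := (est (Sum.inr ⟨a - offOut n P, by omega⟩)).2
      omega
    · exact hval a
  have hR0 : Rep (initState (encodeInput k G τ res)) (fun _ => 0) m₀ :=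
    ⟨(memOf_initial k T G τ res).symm, fun _ => rfl⟩
  have hlo : ∀ a < 6, m₀ a = [n, k, P.ℓ, P.s, P.g, P.p].getD a 0 := by
    intro a ha
    rw [hm₀, memOf_of_lt _ _ _ _ _ (by
      simp only [offOut, offExtra, offCoupled, offLabels]; omega), encodeInput_eq,
      List.getD_append _ _ _ _ (by simpa using ha)]
  obtain ⟨S₁, t₁, e₁, ht₁, hR₁⟩ := exec_assignFirst (ρ := paramVal n k P) (B := B) paramE 13 hR0 hB
    (hmem _) (fun i hi => by
      interval_cases i <;>
        simp [paramE, eval, hlo, paramVal, Params.compSize, Params.numAux, Params.ring, offLabels,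
          offCoupled, offExtra, offOut])
  have hρ₁ : (fun v => if v < 13 then paramVal n k P v else 0) = paramVal n k P := by
    funext v
    split_ifs with h
    · rfl
    · obtain ⟨w, rfl⟩ : ∃ w, v = w + 13 := ⟨v - 13, by omega⟩
      rfl
  rw [hρ₁] at hR₁
  have hE : Env n P (paramVal n k P) := ⟨rfl, rfl, rfl, rfl, rfl, rfl, rfl, rfl, rfl, rfl, rfl, rfl⟩
  have hupd : ∀ ρ : ℕ → ℕ, (∀ v, ρ v ≤ B) → ∀ i w, w ≤ B → ∀ v, Function.update ρ i w v ≤ B := by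
    intro ρ hρ i w hw v
    rw [Function.update_apply]
    split_ifs
    · exact hw
    · exact hρ v
  obtain ⟨S₂, t₂, e₂, ht₂, hR₂, -⟩ := exec_forVar_mem (i := 13) (b := 2) (d := 0) (B := B)
    (Tb := B * ((2 * (add (var 12) (var 14)).cost.eval B + 2 * (updateE a₁ a₂).cost.eval B + 1) +
      3 * B + 5) + 3 * B + 8)
    (body := .forVar 14 0 4 (.storeAt 8 (add (var 12) (var 14)) (updateE a₁ a₂)))
    (fun t => memOf k G τ res (estimate k T G τ res t)) hR₁ hB (fun t ht S hS => by
      have ht' : t < P.ℓ := ht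
      have hBt := hupd _ hB 13 t (ht'.le.trans (hB 2))
      obtain ⟨S', t', e', htime, hR', hc'⟩ := exec_forVar_mem (i := 14) (b := 0) (d := 4) (B := B)
        (Tb := 2 * (add (var 12) (var 14)).cost.eval B + 2 * (updateE a₁ a₂).cost.eval B + 1)
        (body := .storeAt 8 (add (var 12) (var 14)) (updateE a₁ a₂))
        (fun x => memOf k G τ res (partialEstimate k T G τ res t x))
        (by simp only [partialEstimate_zero]; exact hS) hBt (fun x hx S hS => by
          have hx' : x < n := by simpa [paramVal] using hx
          have hBx := hupd _ hBt 14 x (hx'.le.trans (hB 0))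
          obtain ⟨S', t', e', ht', hR', hc'⟩ := exec_storeAt hS hBx (hmem _) 8
            (add (var 12) (var 14)) (updateE a₁ a₂)
          refine ⟨S', t', e', ht', ?_, fun c hc => hc' c (by omega)⟩
          have ha : (add (var 12) (var 14)).eval
              (memOf k G τ res (partialEstimate k T G τ res t x))
              (Function.update (Function.update (paramVal n k P) 13 t) 14 x) =
              offOut n P + (⟨x, hx'⟩ : Fin n).val := by simp [eval, paramVal]
          rw [ha, eval_updateE hP hk a₁ ha₂ ((hE.update (by norm_num) t).update (by norm_num) x)
            (t := t) ⟨x, hx'⟩ (by simp) (by simp) (holds_memOf k G τ res fun _ => rfl)] at hR'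
          have hself : partialEstimate k T G τ res t (x + 1) (Sum.inr ⟨x, hx'⟩) =
              estimate k T G τ res (t + 1) (Sum.inr ⟨x, hx'⟩) := by simp [partialEstimate]
          rw [← hself, update_memOf] at hR'
          · exact hR'
          · intro z hz
            have : z.val ≠ x := fun h => hz (Fin.ext h)
            simp only [partialEstimate]
            split_ifs <;> first | rfl | omega)
      refine ⟨S', t', e', htime, ?_, hc'⟩
      have h0 : Function.update (paramVal n k P) 13 t 0 = n := by simp [paramVal]
      simp only [h0, partialEstimate_last] at hR'
      exact hR')
  have h2 : paramVal n k P 2 = P.ℓ := rfl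
  simp only [h2] at hR₂
  -- The source and target of this copy may overlap. Round `x` reads the cell `offOut n P + x`, and
  -- only the cells below `x` have been overwritten by then.
  obtain ⟨S₃, t₃, e₃, ht₃, hR₃, -⟩ := exec_forVar_mem (i := 14) (b := 0) (d := 0) (B := B)
    (Tb := 2 * (var 14).cost.eval B + 2 * (load (add (var 12) (var 14))).cost.eval B + 1)
    (body := .storeAt 4 (var 14) (load (add (var 12) (var 14))))
    (fun x a => if a < x then memOf k G τ res (estimate k T G τ res P.ℓ) (offOut n P + a)
      else memOf k G τ res (estimate k T G τ res P.ℓ) a) (by simpa using hR₂) hB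
    (fun x hx S hS => by
      have hx' : x < n := hx
      obtain ⟨S', t', e', ht', hR', hc'⟩ := exec_storeAt hS
        (hupd _ hB 14 x (hx'.le.trans (hB 0)))
        (fun a => by split_ifs <;> exact hmem _ _) 4 (var 14) (load (add (var 12) (var 14)))
      refine ⟨S', t', e', ht', ?_, fun c hc => hc' c (by omega)⟩
      convert hR' using 1
      funext a
      have h12 : paramVal n k P 12 = offOut n P := rfl
      simp only [eval, Function.update_self, Function.update_apply]
      simp only [show ¬ ((12 : ℕ) = 14) by norm_num, if_false, h12]
      split_ifs <;> first | rfl | omega | (congr 1; omega))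
  refine ⟨S₃, _, Exec.seq e₁ (Exec.seq e₂ e₃), ?_, fun x => ?_⟩
  · simp only [decoderCost, Polynomial.eval_add, Polynomial.eval_mul, Polynomial.eval_X,
      Polynomial.eval_ofNat, Polynomial.eval_one]
    rw [← add_assoc]
    exact Nat.add_le_add (Nat.add_le_add ht₁ ht₂) ht₃
  · rw [hR₃.1]
    simp only [if_pos (show x.val < paramVal n k P 0 from x.2), memOf_add]
    rfl

/-! ### Moment generating functions of hypergeometric distributions -/

section Hypergeometric

variable {α : Type*} [DecidableEq α]

/-- A uniform set conditioned to contain `x` is `x` together with a uniform subset of the rest. -/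
theorem sum_powersetCard_filter_mem {M : Type*} [AddCommMonoid M] {V : Finset α} {x : α}
    (hx : x ∈ V) (g : ℕ) (F : Finset α → M) :
    ∑ A ∈ (V.powersetCard (g + 1)).filter (x ∈ ·), F A =
      ∑ A ∈ (V.erase x).powersetCard g, F (insert x A) := by
  symm
  refine Finset.sum_bij' (fun A _ => insert x A) (fun A _ => A.erase x) (fun A hA => ?_)
    (fun A hA => ?_) (fun A hA => ?_) (fun A hA => ?_) (fun _ _ => rfl)
  · rw [Finset.mem_powersetCard] at hA
    have hxA : x ∉ A := fun h => by simpa using hA.1 h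
    simp only [Finset.mem_filter, Finset.mem_powersetCard, Finset.mem_insert_self, and_true]
    refine ⟨Finset.insert_subset hx (hA.1.trans (Finset.erase_subset _ _)), ?_⟩
    rw [Finset.card_insert_of_notMem hxA, hA.2]
  · simp only [Finset.mem_filter, Finset.mem_powersetCard] at hA
    rw [Finset.mem_powersetCard, Finset.card_erase_of_mem hA.2, hA.1.2]
    exact ⟨Finset.erase_subset_erase _ hA.1.1, rfl⟩
  · rw [Finset.mem_powersetCard] at hA
    exact Finset.erase_insert fun h => by simpa using hA.1 h
  · simp only [Finset.mem_filter] at hA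
    exact Finset.insert_erase hA.2

theorem card_powersetCard_filter_mem {V : Finset α} {x : α} (hx : x ∈ V) (g : ℕ) :
    V.card * ((V.powersetCard g).filter (x ∈ ·)).card = g * V.card.choose g := by
  cases g with
  | zero => simp
  | succ g =>
    rw [Finset.card_eq_sum_ones (Finset.filter _ _), sum_powersetCard_filter_mem hx,
      ← Finset.card_eq_sum_ones, Finset.card_powersetCard, Finset.card_erase_of_mem hx]
    obtain ⟨N, hN⟩ : ∃ N, V.card = N + 1 :=
      ⟨V.card - 1, by have := Finset.card_pos.2 ⟨x, hx⟩; omega⟩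
    rw [hN, Nat.add_sub_cancel, Nat.add_one_mul_choose_eq, mul_comm]

theorem sum_powersetCard_card_inter (V S : Finset α) (g : ℕ) :
    V.card * ∑ A ∈ V.powersetCard g, (A ∩ S).card = g * (V ∩ S).card * V.card.choose g := by
  have h : ∀ A ∈ V.powersetCard g, (A ∩ S).card = ∑ v ∈ V ∩ S, if v ∈ A then 1 else 0 := by
    intro A hA
    rw [Finset.mem_powersetCard] at hA
    rw [← Finset.sum_filter, ← Finset.card_eq_sum_ones]
    congr 1
    ext v
    simp only [Finset.mem_inter, Finset.mem_filter]
    exact ⟨fun h => ⟨⟨hA.1 h.1, h.2⟩, h.1⟩, fun h => ⟨h.2, h.1.2⟩⟩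
  rw [Finset.sum_congr rfl h, Finset.sum_comm, Finset.mul_sum]
  have h2 : ∀ v ∈ V ∩ S, V.card * ∑ A ∈ V.powersetCard g, (if v ∈ A then 1 else 0) =
      g * V.card.choose g := by
    intro v hv
    rw [← card_powersetCard_filter_mem (Finset.mem_inter.1 hv).1, Finset.card_filter]
  rw [Finset.sum_congr rfl h2, Finset.sum_const, smul_eq_mul]
  ring

/-- Double counting: a set with `g + 1` elements arises in `g + 1` ways by adding a last element. -/
theorem sum_powersetCard_succ {M : Type*} [AddCommMonoid M] (V : Finset α) (g : ℕ)
    (F : Finset α → M) :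
    ∑ A ∈ V.powersetCard g, ∑ v ∈ V \ A, F (insert v A) =
      (g + 1) • ∑ B ∈ V.powersetCard (g + 1), F B := by
  have h : ∀ B ∈ V.powersetCard (g + 1), (g + 1) • F B = ∑ v ∈ B, F B := by
    intro B hB
    rw [Finset.sum_const, (Finset.mem_powersetCard.1 hB).2]
  rw [Finset.smul_sum, Finset.sum_congr rfl h, Finset.sum_sigma', Finset.sum_sigma']
  refine Finset.sum_bij' (fun p _ => ⟨insert p.2 p.1, p.2⟩) (fun p _ => ⟨p.1.erase p.2, p.2⟩)
    (fun p hp => ?_) (fun p hp => ?_) (fun p hp => ?_) (fun p hp => ?_) (fun _ _ => rfl)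
  · simp only [Finset.mem_sigma, Finset.mem_powersetCard, Finset.mem_sdiff] at hp ⊢
    refine ⟨⟨Finset.insert_subset hp.2.1 hp.1.1, ?_⟩, Finset.mem_insert_self _ _⟩
    rw [Finset.card_insert_of_notMem hp.2.2, hp.1.2]
  · simp only [Finset.mem_sigma, Finset.mem_powersetCard, Finset.mem_sdiff] at hp ⊢
    refine ⟨⟨(Finset.erase_subset _ _).trans hp.1.1, ?_⟩, hp.1.1 hp.2, by simp⟩
    rw [Finset.card_erase_of_mem hp.2, hp.1.2]; rfl
  · simp only [Finset.mem_sigma, Finset.mem_sdiff] at hp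
    simp [Finset.erase_insert hp.2.2]
  · simp only [Finset.mem_sigma] at hp
    simp [Finset.insert_erase hp.2]

/-- Sampling without replacement is dominated by the binomial distribution. The induction draws one
more element: given `X` marked elements among the first `g`, the generating function picks up a
factor proportional to `N - g + (y - 1) (K - X)`, and a correlation inequality allows `X` to be
replaced by its mean `g K / N`. Values `y < 1` are included, because items of label one need a
negative tilt. -/
theorem sum_powersetCard_pow_le {V : Finset α} (S : Finset α) (hV : V.Nonempty) {y : ℝ}
    (hy : 0 < y) (g : ℕ) (hg : g ≤ V.card) :
    ∑ A ∈ V.powersetCard g, y ^ (A ∩ S).card ≤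
      (V.card.choose g : ℝ) * (1 + (V ∩ S).card / V.card * (y - 1)) ^ g := by
  have hN : (0 : ℝ) < V.card := by exact_mod_cast hV.card_pos
  set N : ℝ := (V.card : ℝ) with hNdef
  set K : ℝ := ((V ∩ S).card : ℝ) with hK
  have hKN : K ≤ N := Nat.cast_le.2 (Finset.card_le_card Finset.inter_subset_left)
  have hK0 : 0 ≤ K := by positivity
  have hz : 0 ≤ 1 + K / N * (y - 1) := by
    have h1 : K / N ≤ 1 := (div_le_one hN).2 hKN
    have h2 : 0 ≤ K / N := by positivity
    nlinarith [mul_nonneg h2 hy.le]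
  induction g with
  | zero => simp
  | succ g ih =>
    have ih := ih (by omega)
    set E : ℝ := ∑ A ∈ V.powersetCard g, y ^ (A ∩ S).card with hE
    have hE0 : 0 ≤ E := Finset.sum_nonneg fun A _ => by positivity
    have hgN : (g : ℝ) + 1 ≤ N := by
      rw [hNdef]; exact_mod_cast hg
    have hstep : ((g : ℝ) + 1) * ∑ B ∈ V.powersetCard (g + 1), y ^ (B ∩ S).card =
        ∑ A ∈ V.powersetCard g, y ^ (A ∩ S).card * (N - g + (y - 1) * K - (y - 1) * (A ∩ S).card) := by
      have h := sum_powersetCard_succ V g fun B => y ^ (B ∩ S).card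
      rw [nsmul_eq_mul] at h
      push_cast at h
      rw [← h]
      refine Finset.sum_congr rfl fun A hA => ?_
      rw [Finset.mem_powersetCard] at hA
      have hv : ∀ v ∈ V \ A, y ^ (insert v A ∩ S).card =
          y ^ (A ∩ S).card * (1 + if v ∈ S then y - 1 else 0) := by
        intro v hv
        rw [Finset.mem_sdiff] at hv
        by_cases hS : v ∈ S
        · rw [Finset.insert_inter_of_mem hS, Finset.card_insert_of_notMem (by simp [hv.2]), pow_succ,
            if_pos hS]
          ring
        · rw [Finset.insert_inter_of_notMem hS, if_neg hS]; ring
      rw [Finset.sum_congr rfl hv, ← Finset.mul_sum]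
      congr 1
      rw [Finset.sum_add_distrib, ← Finset.sum_filter, Finset.sum_const, Finset.sum_const,
        Finset.filter_mem_eq_inter, Finset.card_sdiff_of_subset hA.1, hA.2]
      have hc : ((V \ A) ∩ S).card = (V ∩ S).card - (A ∩ S).card := by
        rw [← Finset.card_sdiff_of_subset (Finset.inter_subset_inter_right hA.1)]
        congr 1
        ext v
        simp only [Finset.mem_sdiff, Finset.mem_inter]
        tauto
      rw [hc, nsmul_eq_mul, nsmul_eq_mul, Nat.cast_sub (by omega), Nat.cast_sub
        (Finset.card_le_card (Finset.inter_subset_inter_right hA.1))]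
      ring
    -- Chebyshev's sum inequality: `y ^ X` and `(y - 1) * X` increase together in `X` if `y ≥ 1` and
    -- decrease together if `y < 1`.
    have hcheb := MonovaryOn.sum_mul_sum_le_card_mul_sum (s := V.powersetCard g)
      (f := fun A => y ^ (A ∩ S).card) (g := fun A => (y - 1) * ((A ∩ S).card : ℝ)) (by
        intro A _ B _ hAB
        simp only at hAB ⊢
        rcases le_or_gt 1 y with h1 | h1
        · refine pow_le_pow_right₀ h1 ?_
          have : ((A ∩ S).card : ℝ) < (B ∩ S).card := lt_of_mul_lt_mul_left hAB (by linarith)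
          exact_mod_cast this.le
        · refine pow_le_pow_of_le_one hy.le h1.le ?_
          have : ((B ∩ S).card : ℝ) < (A ∩ S).card := by nlinarith
          exact_mod_cast this.le)
    have hmean : N * ∑ A ∈ V.powersetCard g, ((A ∩ S).card : ℝ) = g * K * (V.card.choose g : ℝ) := by
      have := sum_powersetCard_card_inter V S g
      have h2 := congrArg (Nat.cast (R := ℝ)) this
      push_cast at h2
      exact h2
    have hC : (0 : ℝ) < V.card.choose g := by exact_mod_cast Nat.choose_pos (by omega)
    rw [← Finset.mul_sum, Finset.card_powersetCard] at hcheb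
    have hcov : E * ((y - 1) * (g * K / N)) ≤
        ∑ A ∈ V.powersetCard g, y ^ (A ∩ S).card * ((y - 1) * ((A ∩ S).card : ℝ)) := by
      have hsum : ∑ A ∈ V.powersetCard g, ((A ∩ S).card : ℝ) =
          (V.card.choose g : ℝ) * (g * K / N) := by
        field_simp
        linarith
      rw [hsum] at hcheb
      refine le_of_mul_le_mul_left (le_trans (le_of_eq ?_) hcheb) hC
      ring
    have hle : ((g : ℝ) + 1) * ∑ B ∈ V.powersetCard (g + 1), y ^ (B ∩ S).card ≤
        E * ((N - g) * (1 + K / N * (y - 1))) := by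
      rw [hstep]
      have e1 : ∑ A ∈ V.powersetCard g, y ^ (A ∩ S).card *
          (N - g + (y - 1) * K - (y - 1) * (A ∩ S).card) =
          E * (N - g + (y - 1) * K) -
            ∑ A ∈ V.powersetCard g, y ^ (A ∩ S).card * ((y - 1) * ((A ∩ S).card : ℝ)) := by
        rw [hE, Finset.sum_mul, ← Finset.sum_sub_distrib]
        exact Finset.sum_congr rfl fun A _ => by ring
      have e2 : E * ((N - g) * (1 + K / N * (y - 1))) =
          E * (N - g + (y - 1) * K) - E * ((y - 1) * (g * K / N)) := by
        field_simp
        ring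
      rw [e1, e2]
      linarith
    have hch : (V.card.choose (g + 1) : ℝ) * (g + 1) = V.card.choose g * (N - g) := by
      have := Nat.choose_succ_right_eq V.card g
      have h2 := congrArg (Nat.cast (R := ℝ)) this
      rw [Nat.cast_mul, Nat.cast_mul, Nat.cast_sub (by omega)] at h2
      push_cast at h2
      exact h2
    have hg0 : (0 : ℝ) < g + 1 := by positivity
    refine le_of_mul_le_mul_left (hle.trans ?_) hg0
    calc E * ((N - g) * (1 + K / N * (y - 1))) ≤
          (V.card.choose g * (1 + K / N * (y - 1)) ^ g) * ((N - g) * (1 + K / N * (y - 1))) :=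
          mul_le_mul_of_nonneg_right ih (mul_nonneg (by linarith) hz)
      _ = (V.card.choose g * (N - g)) * (1 + K / N * (y - 1)) ^ (g + 1) := by ring
      _ = _ := by rw [← hch]; ring

/-- The moment generating function of a hypergeometric distribution is at most the one of a
Poisson distribution with the same mean. -/
theorem sum_powersetCard_exp_le (V S : Finset α) (t : ℝ) (g : ℕ) :
    ∑ A ∈ V.powersetCard g, Real.exp (t * (A ∩ S).card) ≤
      (V.powersetCard g).card * Real.exp (g * ((V ∩ S).card / V.card) * (Real.exp t - 1)) := by
  rcases lt_or_ge V.card g with hg | hg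
  · rw [Finset.powersetCard_eq_empty.2 hg]; simp
  rcases V.eq_empty_or_nonempty with rfl | hV
  · obtain rfl : g = 0 := by simpa using hg
    simp
  have h := sum_powersetCard_pow_le S hV (Real.exp_pos t) g hg
  simp only [← Real.exp_nat_mul, mul_comm _ t] at h
  rw [Finset.card_powersetCard]
  refine h.trans (mul_le_mul_of_nonneg_left ?_ (Nat.cast_nonneg _))
  rw [mul_assoc, Real.exp_nat_mul]
  have hN : (0 : ℝ) < V.card := by exact_mod_cast hV.card_pos
  have hKN : ((V ∩ S).card : ℝ) / V.card ≤ 1 :=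
    (div_le_one hN).2 (by exact_mod_cast Finset.card_le_card Finset.inter_subset_left)
  have h0 : (0 : ℝ) ≤ (V ∩ S).card / V.card := by positivity
  have hz : 0 ≤ 1 + ((V ∩ S).card : ℝ) / V.card * (Real.exp t - 1) := by
    nlinarith [mul_nonneg h0 (Real.exp_pos t).le]
  refine pow_le_pow_left₀ hz ?_ g
  linarith [Real.add_one_le_exp (((V ∩ S).card : ℝ) / V.card * (Real.exp t - 1))]

end Hypergeometric

/-! ### Sets with prescribed traces on the blocks of a partition -/

section Blocks

variable {α ι : Type*} [DecidableEq α] [Fintype ι] [DecidableEq ι]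

/-- A set is determined by its traces on the blocks, and they can be prescribed independently. This
is the independence of the draws of one pool from different compartments. -/
theorem sum_traces {R : Type*} [CommSemiring R] (κ : α → ι) (Q : ι → Finset (Finset α))
    (hQ : ∀ c, ∀ B ∈ Q c, ∀ v ∈ B, κ v = c) {𝒜 : Finset (Finset α)}
    (h𝒜 : ∀ A, A ∈ 𝒜 ↔ ∀ c, A.filter (κ · = c) ∈ Q c) (F : ι → Finset α → R) :
    ∑ A ∈ 𝒜, ∏ c, F c (A.filter (κ · = c)) = ∏ c, ∑ B ∈ Q c, F c B := by
  rw [Finset.prod_univ_sum]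
  have hbi : ∀ p ∈ Fintype.piFinset Q, ∀ c, (Finset.univ.biUnion p).filter (κ · = c) = p c := by
    intro p hp c
    rw [Fintype.mem_piFinset] at hp
    ext v
    simp only [Finset.mem_filter, Finset.mem_biUnion, Finset.mem_univ, true_and]
    constructor
    · rintro ⟨⟨d, hd⟩, hv⟩
      rw [← hv, hQ d (p d) (hp d) v hd]
      exact hd
    · exact fun hv => ⟨⟨c, hv⟩, hQ c (p c) (hp c) v hv⟩
  refine Finset.sum_bij' (fun A _ c => A.filter (κ · = c)) (fun p _ => Finset.univ.biUnion p)
    (fun A hA => ?_) (fun p hp => ?_) (fun A _ => ?_) (fun p hp => ?_) (fun _ _ => rfl)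
  · rw [Fintype.mem_piFinset]
    exact (h𝒜 A).1 hA
  · rw [h𝒜]
    intro c
    rw [hbi p hp]
    exact Fintype.mem_piFinset.1 hp c
  · ext v
    simp
  · funext c
    exact hbi p hp c

end Blocks

/-! ### The random pools -/

section Pools

variable {n : ℕ} {P : Params}

theorem Params.Proper.comp_lt (hP : P.Proper n) (v : Item n P) : comp v < P.ring := by
  have h1 := hP.s_pos
  show comp v < P.ℓ + P.s - 1
  rcases v with y | x
  · have := comp_inl_lt y
    rw [comp_inl]
    omega
  · have := Nat.mod_lt x.val hP.ℓ_pos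
    rw [comp_inr]
    omega

/-- The compartment of an item, as an element of `Fin P.ring`. -/
def block (hP : P.Proper n) (v : Item n P) : Fin P.ring := ⟨comp v, hP.comp_lt v⟩

theorem block_eq_iff (hP : P.Proper n) {v : Item n P} {c : Fin P.ring} :
    block hP v = c ↔ comp v = c.val := by
  rw [Fin.ext_iff]; rfl

/-- The item compartment `c` meets the pools of the pool compartment `b`. -/
def InWindow (P : Params) (b c : ℕ) : Prop := ∃ r < P.s, c = (b + P.ring - r) % P.ring

open Classical in
/-- The possible outcomes of a pool of the pool compartment `b`. -/
noncomputable def poolFamily (n : ℕ) (P : Params) (b : Fin P.ring) : Finset (Finset (Item n P)) :=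
  Finset.univ.filter fun A => (∀ v ∈ A, InWindow P b.val (comp v)) ∧
    ∀ r < P.s, (A ∩ compartment n P ((b.val + P.ring - r) % P.ring)).card = P.g

-- This product structure is the independence of the pools.
open Classical in
theorem filter_isCoupled_eq :
    (Finset.univ.filter fun G : Graph n P => IsCoupled G) =
      Fintype.piFinset fun b => Fintype.piFinset fun _ => poolFamily n P b := by
  ext G
  simp [IsCoupled, poolFamily, Fintype.mem_piFinset, InWindow]

open Classical in
/-- The possible intersections of a pool of the pool compartment `b` with the item compartment
`c`. -/
noncomputable def traceFamily (n : ℕ) (P : Params) (b c : Fin P.ring) :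
    Finset (Finset (Item n P)) :=
  if InWindow P b.val c.val then (compartment n P c.val).powersetCard P.g else {∅}

theorem filter_block (hP : P.Proper n) (A : Finset (Item n P)) (c : Fin P.ring) :
    A.filter (block hP · = c) = A ∩ compartment n P c.val := by
  ext v
  simp [block_eq_iff]

theorem mem_poolFamily_iff (hP : P.Proper n) {b : Fin P.ring} {A : Finset (Item n P)} :
    A ∈ poolFamily n P b ↔ ∀ c, A.filter (block hP · = c) ∈ traceFamily n P b c := by
  simp only [poolFamily, Finset.mem_filter, Finset.mem_univ, true_and]
  constructor
  · rintro ⟨h1, h2⟩ c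
    rw [filter_block, traceFamily]
    split_ifs with hc
    · obtain ⟨r, hr, hc⟩ := hc
      rw [Finset.mem_powersetCard]
      exact ⟨Finset.inter_subset_right, by rw [hc]; exact h2 r hr⟩
    · rw [Finset.mem_singleton]
      refine Finset.eq_empty_of_forall_notMem fun v hv => hc ?_
      rw [Finset.mem_inter, mem_compartment] at hv
      rw [← hv.2]
      exact h1 v hv.1
  · intro h
    refine ⟨fun v hv => ?_, fun r hr => ?_⟩
    · have h1 := h (block hP v)
      rw [traceFamily] at h1
      split_ifs at h1 with hc
      · exact hc
      · rw [Finset.mem_singleton] at h1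
        have : v ∈ A.filter (block hP · = block hP v) := by simp [hv]
        rw [h1] at this
        simp at this
    · have h1 := h ⟨(b.val + P.ring - r) % P.ring, Nat.mod_lt _ hP.ring_pos⟩
      rw [traceFamily, if_pos ⟨r, hr, rfl⟩, filter_block, Finset.mem_powersetCard] at h1
      exact h1.2

/-- The possible traces of a pool that contains the item `v`. -/
noncomputable def traceFamilyWith (hP : P.Proper n) (v : Item n P) (b c : Fin P.ring) :
    Finset (Finset (Item n P)) :=
  if c = block hP v then ((compartment n P c.val).powersetCard P.g).filter (v ∈ ·)
  else traceFamily n P b c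

theorem mem_block_of_mem_traceFamily (hP : P.Proper n) {b c : Fin P.ring} {B : Finset (Item n P)}
    (hB : B ∈ traceFamily n P b c) {v : Item n P} (hv : v ∈ B) : block hP v = c := by
  rw [traceFamily] at hB
  split_ifs at hB
  · rw [Finset.mem_powersetCard] at hB
    rw [block_eq_iff, ← mem_compartment]
    exact hB.1 hv
  · rw [Finset.mem_singleton] at hB
    simp [hB] at hv

theorem traceFamily_block (hP : P.Proper n) {v : Item n P} {b : Fin P.ring}
    (hb : InWindow P b.val (comp v)) :
    traceFamily n P b (block hP v) = (compartment n P (comp v)).powersetCard P.g := by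
  rw [traceFamily, if_pos (by exact hb)]; rfl

theorem mem_filter_poolFamily_iff (hP : P.Proper n) {v : Item n P} {b : Fin P.ring}
    (hb : InWindow P b.val (comp v)) :
    ∀ A, A ∈ (poolFamily n P b).filter (v ∈ ·) ↔
      ∀ c, A.filter (block hP · = c) ∈ traceFamilyWith hP v b c := by
  intro A
  simp only [Finset.mem_filter, mem_poolFamily_iff hP, traceFamilyWith]
  constructor
  · rintro ⟨h1, h2⟩ c
    split_ifs with hc
    · have h3 := h1 c
      rw [hc, traceFamily_block hP hb] at h3
      rw [hc, Finset.mem_filter]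
      exact ⟨h3, by simp [h2]⟩
    · exact h1 c
  · intro h
    have h1 := h (block hP v)
    rw [if_pos rfl, Finset.mem_filter] at h1
    refine ⟨fun c => ?_, (Finset.mem_filter.1 h1.2).1⟩
    have h2 := h c
    split_ifs at h2 with hc
    · rw [hc, traceFamily_block hP hb]
      exact h1.1
    · exact h2

theorem card_poolFamily (hP : P.Proper n) (b : Fin P.ring) :
    (poolFamily n P b).card = ∏ c, (traceFamily n P b c).card := by
  have h := sum_traces (R := ℕ) (block hP) (traceFamily n P b)
    (fun c B hB v hv => mem_block_of_mem_traceFamily hP hB hv) (fun _ => mem_poolFamily_iff hP)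
    (fun _ _ => 1)
  simpa only [Finset.prod_const_one, ← Finset.card_eq_sum_ones] using h

theorem mem_block_of_mem_traceFamilyWith (hP : P.Proper n) {v : Item n P} {b c : Fin P.ring}
    {B : Finset (Item n P)} (hB : B ∈ traceFamilyWith hP v b c) {w : Item n P} (hw : w ∈ B) :
    block hP w = c := by
  rw [traceFamilyWith] at hB
  split_ifs at hB
  · rw [Finset.mem_filter, Finset.mem_powersetCard] at hB
    rw [block_eq_iff, ← mem_compartment]
    exact hB.1.1 hw
  · exact mem_block_of_mem_traceFamily hP hB hw

theorem card_filter_mem_poolFamily (hP : P.Proper n) {v : Item n P} {b : Fin P.ring}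
    (hb : InWindow P b.val (comp v)) :
    ((poolFamily n P b).filter (v ∈ ·)).card = ∏ c, (traceFamilyWith hP v b c).card := by
  have h := sum_traces (R := ℕ) (block hP) (traceFamilyWith hP v b)
    (fun c B hB w hw => mem_block_of_mem_traceFamilyWith hP hB hw)
    (mem_filter_poolFamily_iff hP hb) (fun _ _ => 1)
  simpa only [Finset.prod_const_one, ← Finset.card_eq_sum_ones] using h

/-- Requiring `v` in the pool changes only the factor of the compartment of `v`, where a uniform set
of `g` items contains `v` with probability `g` over the size. -/
theorem compartment_card_mul_card_filter_mem (hP : P.Proper n) {v : Item n P} {b : Fin P.ring}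
    (hb : InWindow P b.val (comp v)) :
    (compartment n P (comp v)).card * ((poolFamily n P b).filter (v ∈ ·)).card =
      P.g * (poolFamily n P b).card := by
  rw [card_filter_mem_poolFamily hP hb, card_poolFamily hP,
    ← Finset.mul_prod_erase _ _ (Finset.mem_univ (block hP v)),
    ← Finset.mul_prod_erase _ (fun c => (traceFamily n P b c).card) (Finset.mem_univ (block hP v)),
    ← mul_assoc, ← mul_assoc, traceFamily_block hP hb, Finset.card_powersetCard]
  congr 1
  · rw [traceFamilyWith, if_pos rfl]
    exact card_powersetCard_filter_mem (mem_compartment.2 rfl) _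
  · refine Finset.prod_congr rfl fun c hc => ?_
    rw [traceFamilyWith, if_neg (Finset.ne_of_mem_erase hc)]

/-- The items of label one. -/
def onesOf (lab : Item n P → Fin 2) : Finset (Item n P) := Finset.univ.filter fun v => lab v = 1

theorem sum_val_eq_card_inter (lab : Item n P → Fin 2) (B : Finset (Item n P)) :
    ∑ v ∈ B, (lab v).val = (B ∩ onesOf lab).card := by
  have : B ∩ onesOf lab = B.filter fun v => lab v = 1 := by ext v; simp [onesOf]
  rw [this, Finset.card_filter]
  refine Finset.sum_congr rfl fun v _ => ?_
  generalize lab v = z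
  fin_cases z <;> rfl

/-- The mean number of ones, other than `v`, of a pool that contains `v` in the compartment
`c`. -/
noncomputable def meanOnes (lab : Item n P → Fin 2) (v : Item n P) (c : ℕ) : ℝ :=
  ((P.g : ℝ) - if c = comp v then 1 else 0) * (((compartment n P c ∩ onesOf lab).card : ℝ) /
    (((compartment n P c).erase v).card : ℝ))

/-- The centred number of ones, other than `v`, of the pool `A` in the compartments `C`, plus the
label of `v`. -/
noncomputable def centredCount (lab : Item n P → Fin 2) (v : Item n P) (C : Finset ℕ)
    (A : Finset (Item n P)) : ℝ :=
  ((lab v).val : ℝ) + ∑ c : Fin P.ring, if c.val ∈ C then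
    (((A ∩ compartment n P c.val).erase v ∩ onesOf lab).card : ℝ) - meanOnes lab v c.val else 0

/-- The exponent in the bound for the moment generating function of `centredCount`. -/
noncomputable def mgfExponent (lab : Item n P → Fin 2) (v : Item n P) (C : Finset ℕ) (t : ℝ) : ℝ :=
  (lab v).val * (t - ((P.g : ℝ) - 1) / (((compartment n P (comp v)).card : ℝ) - 1) *
    (Real.exp t - 1)) +
  (Real.exp t - 1 - t) * ∑ c : Fin P.ring, if c.val ∈ C then meanOnes lab v c.val else 0

/-- Conditioned on containing `v`, the pool still draws independently from its compartments, each
count being hypergeometric with a Poisson bound. Centring a Poisson variable of mean `μ` leaves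
`(exp t - 1 - t) * μ` in the exponent. The extra term of `mgfExponent` for label one comes from the
compartment of `v` itself. -/
theorem sum_filter_mem_exp_le (hP : P.Proper n) (lab : Item n P → Fin 2) {v : Item n P}
    {b : Fin P.ring} {C : Finset ℕ} (hC : ∀ c ∈ C, InWindow P b.val c) (hv : comp v ∈ C) (t : ℝ) :
    ∑ A ∈ (poolFamily n P b).filter (v ∈ ·), Real.exp (t * centredCount lab v C A) ≤
      ((poolFamily n P b).filter (v ∈ ·)).card * Real.exp (mgfExponent lab v C t) := by
  have hb := hC _ hv
  set S := onesOf lab with hS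
  set μ := meanOnes lab v with hμ
  set κ := block hP with hκ
  set e := Real.exp t - 1 with he
  let f : Fin P.ring → Finset (Item n P) → ℝ := fun c B =>
    if c.val ∈ C then Real.exp (t * ((B.erase v ∩ S).card - μ c.val)) else 1
  let E : Fin P.ring → ℝ := fun c => if c.val ∈ C then (e - t) * μ c.val -
    (if c = κ v then (lab v).val * (((P.g : ℝ) - 1) /
      (((compartment n P (comp v)).card : ℝ) - 1) * e) else 0) else 0
  have hexp : ∀ A : Finset (Item n P), Real.exp (t * centredCount lab v C A) =
      Real.exp (t * (lab v).val) * ∏ c, f c (A.filter (κ · = c)) := by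
    intro A
    rw [centredCount, mul_add, Real.exp_add, Finset.mul_sum, Real.exp_sum]
    congr 1
    refine Finset.prod_congr rfl fun c _ => ?_
    simp only [f, hκ, filter_block]
    split_ifs <;> simp [hS, hμ]
  have hblock : ∀ c, ∑ B ∈ traceFamilyWith hP v b c, f c B ≤
      (traceFamilyWith hP v b c).card * Real.exp (E c) := by
    intro c
    by_cases hcC : c.val ∈ C
    · simp only [f, E, if_pos hcC]
      by_cases hcv : c = κ v
      · have hcv' : c.val = comp v := by rw [hcv]; rfl
        have hvc : v ∈ compartment n P c.val := by rw [mem_compartment, hcv']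
        rw [if_pos hcv, traceFamilyWith, if_pos hcv]
        obtain ⟨g, hg⟩ : ∃ g, P.g = g + 1 := ⟨P.g - 1, by have := hP.g_pos; omega⟩
        rw [hg, sum_powersetCard_filter_mem hvc, Finset.card_eq_sum_ones,
          sum_powersetCard_filter_mem hvc, ← Finset.card_eq_sum_ones]
        have h1 : ∀ A ∈ ((compartment n P c.val).erase v).powersetCard g,
            Real.exp (t * ((((insert v A).erase v ∩ S).card : ℝ) - μ c.val)) =
              Real.exp (-(t * μ c.val)) * Real.exp (t * (A ∩ S).card) := by
          intro A hA
          rw [Finset.mem_powersetCard] at hA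
          rw [Finset.erase_insert fun h => by simpa using hA.1 h, ← Real.exp_add]
          ring_nf
        rw [Finset.sum_congr rfl h1, ← Finset.mul_sum]
        refine (mul_le_mul_of_nonneg_left (sum_powersetCard_exp_le _ S t g)
          (Real.exp_pos _).le).trans (le_of_eq ?_)
        rw [mul_left_comm, ← Real.exp_add]
        congr 2
        -- The centring term counts the label of `v` among the ones of its compartment, but the
        -- other `g - 1` items are drawn without `v`. The discrepancy is the correction by `lab v`.
        have hcard : ((((compartment n P c.val).erase v) ∩ S).card : ℝ) =
            (compartment n P c.val ∩ S).card - (lab v).val := by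
          rw [Finset.erase_inter]
          by_cases hvS : v ∈ S
          · have hl : lab v = 1 := by simpa [hS, onesOf] using hvS
            rw [Finset.card_erase_of_mem (Finset.mem_inter.2 ⟨hvc, hvS⟩), hl,
              Nat.cast_sub (Finset.card_pos.2 ⟨v, Finset.mem_inter.2 ⟨hvc, hvS⟩⟩)]
            simp
          · have hl : lab v = 0 := by
              have : lab v ≠ 1 := by simpa [hS, onesOf] using hvS
              generalize lab v = z at this
              fin_cases z
              · rfl
              · exact absurd rfl this
            rw [Finset.erase_eq_of_notMem fun h => hvS (Finset.mem_inter.1 h).2, hl]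
            simp
        have hcard' : (((compartment n P c.val).erase v).card : ℝ) =
            ((compartment n P (comp v)).card : ℝ) - 1 := by
          rw [Finset.card_erase_of_mem hvc, hcv', Nat.cast_sub]
          · simp
          · exact Finset.card_pos.2 ⟨v, mem_compartment.2 rfl⟩
        have hμc : μ c.val = g * ((compartment n P c.val ∩ S).card /
            (((compartment n P (comp v)).card : ℝ) - 1)) := by
          rw [hμ, meanOnes, if_pos hcv', hcard', hg]
          simp [hS]
        rw [hcard, hcard', hμc]
        push_cast
        ring
      · have hw : InWindow P b.val c.val := hC _ hcC
        rw [if_neg hcv, traceFamilyWith, if_neg hcv, traceFamily, if_pos hw]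
        have hcv' : c.val ≠ comp v := fun h => hcv (Fin.ext h)
        have hvc : v ∉ compartment n P c.val := by rw [mem_compartment]; exact fun h => hcv' h.symm
        have h1 : ∀ A ∈ (compartment n P c.val).powersetCard P.g,
            Real.exp (t * (((A.erase v ∩ S).card : ℝ) - μ c.val)) =
              Real.exp (-(t * μ c.val)) * Real.exp (t * (A ∩ S).card) := by
          intro A hA
          rw [Finset.mem_powersetCard] at hA
          rw [Finset.erase_eq_of_notMem fun h => hvc (hA.1 h), ← Real.exp_add]
          ring_nf
        rw [Finset.sum_congr rfl h1, ← Finset.mul_sum]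
        refine (mul_le_mul_of_nonneg_left (sum_powersetCard_exp_le _ S t P.g)
          (Real.exp_pos _).le).trans (le_of_eq ?_)
        rw [mul_left_comm, ← Real.exp_add]
        congr 2
        have hμc : μ c.val = P.g * ((compartment n P c.val ∩ S).card /
            ((compartment n P c.val).card : ℝ)) := by
          rw [hμ, meanOnes, if_neg hcv', Finset.erase_eq_of_notMem hvc]
          simp [hS]
        rw [hμc]
        ring
    · simp [f, E, hcC]
  have hsum := sum_traces (block hP) (traceFamilyWith hP v b)
    (fun c B hB w hw => mem_block_of_mem_traceFamilyWith hP hB hw)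
    (mem_filter_poolFamily_iff hP hb) f
  rw [Finset.sum_congr rfl fun A _ => hexp A, ← Finset.mul_sum, hsum]
  have hprod : ∏ c, ∑ B ∈ traceFamilyWith hP v b c, f c B ≤
      ∏ c, ((traceFamilyWith hP v b c).card * Real.exp (E c)) :=
    Finset.prod_le_prod (fun c _ => Finset.sum_nonneg fun B _ => by
      simp only [f]; split_ifs <;> positivity) fun c _ => hblock c
  refine (mul_le_mul_of_nonneg_left hprod (Real.exp_pos _).le).trans (le_of_eq ?_)
  rw [Finset.prod_mul_distrib, card_filter_mem_poolFamily hP hb,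
    ← Real.exp_sum, mul_left_comm, ← Real.exp_add]
  push_cast
  congr 2
  have hE : ∑ c, E c = (e - t) * (∑ c : Fin P.ring, if c.val ∈ C then μ c.val else 0) -
      (lab v).val * (((P.g : ℝ) - 1) / (((compartment n P (comp v)).card : ℝ) - 1) * e) := by
    have h1 : ∀ c, E c = (e - t) * (if c.val ∈ C then μ c.val else 0) -
        if c = κ v then (lab v).val * (((P.g : ℝ) - 1) /
          (((compartment n P (comp v)).card : ℝ) - 1) * e) else 0 := by
      intro c
      simp only [E]
      by_cases hcC : c.val ∈ C
      · simp [hcC]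
      · have : c ≠ κ v := by
          rintro rfl
          exact hcC hv
        simp [hcC, this]
    rw [Finset.sum_congr rfl fun c _ => h1 c, Finset.sum_sub_distrib, ← Finset.mul_sum]
    simp
  rw [hE, mgfExponent]
  ring

/-- The pool contains `v` with probability `g / |V|` and contributes the factor one otherwise, so `1
+ q * (M - 1) ≤ exp (q * (M - 1))` absorbs the randomness of the degree of `v`. -/
theorem sum_poolFamily_exp_le (hP : P.Proper n) (lab : Item n P → Fin 2) {v : Item n P}
    {b : Fin P.ring} {C : Finset ℕ} (hC : ∀ c ∈ C, InWindow P b.val c) (hv : comp v ∈ C) (t : ℝ) :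
    ∑ A ∈ poolFamily n P b, (if v ∈ A then Real.exp (t * centredCount lab v C A) else 1) ≤
      (poolFamily n P b).card * Real.exp ((P.g : ℝ) / (compartment n P (comp v)).card *
        (Real.exp (mgfExponent lab v C t) - 1)) := by
  have hN : (0 : ℝ) < (compartment n P (comp v)).card := by
    exact_mod_cast Finset.card_pos.2 ⟨v, mem_compartment.2 rfl⟩
  have h1 := sum_filter_mem_exp_le hP lab hC hv t
  have h2 := congrArg (Nat.cast (R := ℝ)) (compartment_card_mul_card_filter_mem hP (hC _ hv))
  push_cast at h2
  have h3 : (((poolFamily n P b).filter (v ∈ ·)).card : ℝ) =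
      P.g / (compartment n P (comp v)).card * (poolFamily n P b).card := by
    field_simp
    linarith
  have h4 : (((poolFamily n P b).filter fun A => ¬ v ∈ A).card : ℝ) =
      (poolFamily n P b).card - ((poolFamily n P b).filter (v ∈ ·)).card := by
    rw [eq_sub_iff_add_eq, add_comm]
    exact_mod_cast Finset.card_filter_add_card_filter_not (s := poolFamily n P b) (v ∈ ·)
  rw [Finset.sum_ite, Finset.sum_const, nsmul_eq_mul, mul_one, h4]
  calc _ ≤ (((poolFamily n P b).filter (v ∈ ·)).card : ℝ) * Real.exp (mgfExponent lab v C t) +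
        ((poolFamily n P b).card - ((poolFamily n P b).filter (v ∈ ·)).card) :=
        add_le_add_left h1 _
    _ = (poolFamily n P b).card * ((P.g : ℝ) / (compartment n P (comp v)).card *
        (Real.exp (mgfExponent lab v C t) - 1) + 1) := by rw [h3]; ring
    _ ≤ _ := mul_le_mul_of_nonneg_left (Real.add_one_le_exp _) (Nat.cast_nonneg _)

end Pools

/-! ### Scores computed from the true labels -/

section Genie

variable {n : ℕ} {P : Params}

/-- The labels of all items. -/
def trueLabels (τ : Fin (P.numAux n) → Fin 2) (σ : Fin n → Fin 2) : Item n P → Fin 2 :=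
  Sum.elim τ σ

theorem poolCount_results (G : Graph n P) (τ : Fin (P.numAux n) → Fin 2) (σ : Fin n → Fin 2)
    (b : Fin P.ring) (a : Fin P.p) :
    poolCount G τ (results (pools G) σ) b a = ∑ v ∈ G b a, (trueLabels τ σ v).val := by
  rw [← Finset.univ_inter (G b a), ← Finset.filter_mem_eq_inter, Finset.sum_filter,
    Fintype.sum_sum_type, add_comm]
  simp only [poolCount, results, pools, Finset.sum_filter, trueLabels, Sum.elim_inl, Sum.elim_inr]

theorem compCount_results (G : Graph n P) (τ : Fin (P.numAux n) → Fin 2) (σ : Fin n → Fin 2)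
    {c : ℕ} (hc : c < P.ring) :
    compCount τ (results (pools G) σ) c =
      (compartment n P c ∩ onesOf (trueLabels τ σ)).card := by
  rw [← sum_val_eq_card_inter, ← Finset.univ_inter (compartment n P c),
    ← Finset.filter_mem_eq_inter, Finset.sum_filter, Fintype.sum_sum_type, compCount]
  congr 1
  simp only [results, pools, Finset.sum_filter, trueLabels, Sum.elim_inr, mem_compartment]
  by_cases h : P.s - 1 ≤ c
  · have hi : c - (P.s - 1) < P.ℓ := by
      have : c < P.ℓ + P.s - 1 := hc
      omega
    rw [Finset.sum_eq_single ⟨c - (P.s - 1), hi⟩ (fun i _ hne => if_neg fun h' => hne (by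
      ext; simp only; omega)) (by simp), if_pos (by simp only; omega)]
    refine Finset.sum_congr rfl fun x _ => if_congr ?_ rfl rfl
    simp only
    rw [show P.s - 1 + (c - (P.s - 1)) = c by omega]
  · rw [Finset.sum_eq_zero fun i _ => if_neg (by omega), Finset.sum_eq_zero fun x _ => if_neg ?_]
    rw [comp_inr]
    omega

/-- The compartments `i, …, i + j` on the ring. -/
def ahead (P : Params) (i j : ℕ) : Finset ℕ :=
  (Finset.range (j + 1)).image fun r => (i + r) % P.ring

theorem mod_ring_cases {R a : ℕ} (h : a < 2 * R) :
    a < R ∧ a % R = a ∨ R ≤ a ∧ a % R = a - R := by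
  rcases lt_or_ge a R with h1 | h1
  · exact Or.inl ⟨h1, Nat.mod_eq_of_lt h1⟩
  · exact Or.inr ⟨h1, by rw [Nat.mod_eq_sub_mod h1, Nat.mod_eq_of_lt (by omega)]⟩

theorem Params.Proper.s_le_ring (hP : P.Proper n) : P.s ≤ P.ring := by
  have := hP.ℓ_pos
  show P.s ≤ P.ℓ + P.s - 1
  omega

theorem inWindow_of_mem_ahead (hP : P.Proper n) {i j c : ℕ} (hi : i < P.ring) (hj : j < P.s)
    (hc : c ∈ ahead P i j) : InWindow P ((i + j) % P.ring) c := by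
  have hs := hP.s_le_ring
  simp only [ahead, Finset.mem_image, Finset.mem_range] at hc
  obtain ⟨r, hr, rfl⟩ := hc
  refine ⟨j - r, by omega, ?_⟩
  have h1 := mod_ring_cases (R := P.ring) (a := i + j) (by omega)
  have h2 := mod_ring_cases (R := P.ring) (a := i + r) (by omega)
  have h3 := mod_ring_cases (R := P.ring) (a := (i + j) % P.ring + P.ring - (j - r)) (by omega)
  omega

/-- The seed matters here: as `P.s - 1 ≤ i`, the part of the window before `i` does not wrap around
the ring. The part ahead may wrap to compartments numbered below `i`, but `P.s ≤ P.ring` keeps them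
out of the range that is subtracted. -/
theorem explained_iff (hP : P.Proper n) {i j c : ℕ} (hi : i < P.ring) (hi' : P.s - 1 ≤ i)
    (hj : j < P.s) (hc : InWindow P ((i + j) % P.ring) c) :
    (i + j + 1 ≤ c + P.s ∧ c < i) ↔ c ∉ ahead P i j := by
  have hs := hP.s_le_ring
  obtain ⟨r, hr, hc⟩ := hc
  have h1 := mod_ring_cases (R := P.ring) (a := i + j) (by omega)
  have h3 := mod_ring_cases (R := P.ring) (a := (i + j) % P.ring + P.ring - r) (by omega)
  simp only [ahead, Finset.mem_image, Finset.mem_range, not_exists, not_and]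
  constructor
  · intro h r' hr' h'
    have h2 := mod_ring_cases (R := P.ring) (a := i + r') (by omega)
    omega
  · intro h
    by_cases hrj : r ≤ j
    · have h2 := mod_ring_cases (R := P.ring) (a := i + (j - r)) (by omega)
      exact absurd (by omega) (h (j - r) (by omega))
    · omega

theorem comp_mem_ahead (hP : P.Proper n) (v : Item n P) (j : ℕ) : comp v ∈ ahead P (comp v) j := by
  simp only [ahead, Finset.mem_image, Finset.mem_range]
  exact ⟨0, by omega, by rw [add_zero, Nat.mod_eq_of_lt (hP.comp_lt v)]⟩

theorem sum_ite_mem_ahead (hP : P.Proper n) {i j : ℕ} (hi : i < P.ring) (hj : j < P.s) (φ : ℕ → ℝ) :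
    (∑ c : Fin P.ring, if c.val ∈ ahead P i j then φ c.val else 0) =
      ∑ r ∈ Finset.range (j + 1), φ ((i + r) % P.ring) := by
  have hs := hP.s_le_ring
  rw [← Finset.sum_range (fun c => if c ∈ ahead P i j then φ c else 0), Finset.sum_ite_mem,
    Finset.inter_eq_right.2, ahead, Finset.sum_image]
  · intro r hr r' hr' h
    simp only [Finset.coe_range, Set.mem_Iio] at hr hr'
    have h1 := mod_ring_cases (R := P.ring) (a := i + r) (by omega)
    have h2 := mod_ring_cases (R := P.ring) (a := i + r') (by omega)
    simp only at h
    omega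
  · intro c hc
    simp only [ahead, Finset.mem_image] at hc
    obtain ⟨r, -, rfl⟩ := hc
    exact Finset.mem_range.2 (Nat.mod_lt _ hP.ring_pos)

theorem inWindow_of_mem_poolFamily {b : Fin P.ring} {A : Finset (Item n P)}
    (hA : A ∈ poolFamily n P b) {v : Item n P} (hv : v ∈ A) : InWindow P b.val (comp v) := by
  simp only [poolFamily, Finset.mem_filter] at hA
  exact hA.2.1 v hv

theorem sub_explained_eq (hP : P.Proper n) (lab : Item n P → Fin 2) {x : Fin n} {j : ℕ}
    (hj : j < P.s) {b : Fin P.ring} (hb : b.val = (comp (P := P) (Sum.inr x) + j) % P.ring)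
    {A : Finset (Item n P)} (hA : A ∈ poolFamily n P b) (hx : Sum.inr x ∈ A) :
    (∑ v ∈ A, ((lab v).val : ℝ)) - ∑ v ∈ A.filter fun v =>
      comp (P := P) (Sum.inr x) + j + 1 ≤ comp v + P.s ∧ comp v < comp (P := P) (Sum.inr x),
        ((lab v).val : ℝ) =
    (lab (Sum.inr x)).val + ∑ c : Fin P.ring, if c.val ∈ ahead P (comp (P := P) (Sum.inr x)) j then
      (((A ∩ compartment n P c.val).erase (Sum.inr x) ∩ onesOf lab).card : ℝ) else 0 := by
  set v₀ : Item n P := Sum.inr x with hv₀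
  set i := comp v₀ with hi
  have hiR : i < P.ring := hP.comp_lt v₀
  have his : P.s - 1 ≤ i := by rw [hi, hv₀, comp_inr]; omega
  have hfil : A.filter (fun v => i + j + 1 ≤ comp v + P.s ∧ comp v < i) =
      A.filter fun v => ¬ comp v ∈ ahead P i j := by
    refine Finset.filter_congr fun v hv => explained_iff hP hiR his hj ?_
    rw [← hb]
    exact inWindow_of_mem_poolFamily hA hv
  rw [hfil, ← Finset.sum_filter_add_sum_filter_not A (fun v => comp v ∈ ahead P i j),
    add_sub_cancel_right]
  have hmem : v₀ ∈ A.filter fun v => comp v ∈ ahead P i j :=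
    Finset.mem_filter.2 ⟨hx, comp_mem_ahead hP v₀ j⟩
  rw [← Finset.add_sum_erase _ _ hmem]
  congr 1
  rw [← Finset.sum_fiberwise _ (block hP)]
  refine Finset.sum_congr rfl fun c _ => ?_
  have h1 : (((A.filter fun v => comp v ∈ ahead P i j).erase v₀).filter (block hP · = c)) =
      if c.val ∈ ahead P i j then (A ∩ compartment n P c.val).erase v₀ else ∅ := by
    ext w
    by_cases hc : c.val ∈ ahead P i j
    · simp only [if_pos hc, Finset.mem_filter, Finset.mem_erase, Finset.mem_inter, mem_compartment,
        block_eq_iff]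
      constructor
      · rintro ⟨⟨h1, h2, -⟩, h3⟩
        exact ⟨h1, h2, h3⟩
      · rintro ⟨h1, h2, h3⟩
        exact ⟨⟨h1, h2, by rw [h3]; exact hc⟩, h3⟩
    · simp only [if_neg hc, Finset.mem_filter, Finset.mem_erase, block_eq_iff, Finset.notMem_empty,
        iff_false]
      rintro ⟨⟨-, -, h2⟩, h3⟩
      rw [h3] at h2
      exact hc h2
  rw [h1]
  split_ifs
  · rw [← sum_val_eq_card_inter, Nat.cast_sum]
  · simp

open Classical in
theorem unexplained_sub_centring (hP : P.Proper n) {G : Graph n P} (hG : IsCoupled G)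
    (τ : Fin (P.numAux n) → Fin 2) (σ : Fin n → Fin 2) (x : Fin n) {j : ℕ} (hj : j < P.s)
    {b : Fin P.ring} (hb : b.val = (comp (P := P) (Sum.inr x) + j) % P.ring) :
    (unexplained G τ (results (pools G) σ) (trueLabels τ σ) x j : ℝ) -
      centring G τ (results (pools G) σ) x j =
    ∑ a, if Sum.inr x ∈ G b a then centredCount (trueLabels τ σ) (Sum.inr x)
      (ahead P (comp (P := P) (Sum.inr x)) j) (G b a) else 0 := by
  have hGf : ∀ b a, G b a ∈ poolFamily n P b := by
    have : G ∈ Finset.univ.filter fun G : Graph n P => IsCoupled G := by simp [hG]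
    rw [filter_isCoupled_eq, Fintype.mem_piFinset] at this
    exact fun b a => Fintype.mem_piFinset.1 (this b) a
  have hiR : comp (n := n) (P := P) (Sum.inr x) < P.ring := hP.comp_lt _
  have hcen : centring G τ (results (pools G) σ) x j = ((nbrs G x j).card : ℝ) *
      ∑ c : Fin P.ring, if c.val ∈ ahead P (comp (P := P) (Sum.inr x)) j then
        meanOnes (trueLabels τ σ) (Sum.inr x) c.val else 0 := by
    rw [sum_ite_mem_ahead hP hiR hj, centring]
    congr 1
    refine Finset.sum_congr rfl fun r hr => ?_
    rw [Finset.mem_range] at hr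
    have hs := hP.s_le_ring
    rw [compCount_results G τ σ (Nat.mod_lt _ hP.ring_pos), meanOnes]
    congr 2
    refine if_congr ?_ rfl rfl
    have h1 := mod_ring_cases (R := P.ring)
      (a := comp (n := n) (P := P) (Sum.inr x) + r) (by omega)
    omega
  rw [hcen, ← nsmul_eq_mul, ← Finset.sum_const, unexplained, Int.cast_sum, ← Finset.sum_sub_distrib,
    sum_nbrs G x j b hb]
  refine Finset.sum_congr rfl fun a _ => ?_
  split_ifs with hx
  · rw [poolCount_results, centredCount]
    push_cast
    rw [sub_explained_eq hP _ hj hb (hGf b a) hx, add_sub_assoc, ← Finset.sum_sub_distrib]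
    congr 1
    refine Finset.sum_congr rfl fun c _ => ?_
    split_ifs <;> ring
  · rfl

/-- The pool compartment `i + j`. -/
def poolComp (hP : P.Proper n) (i j : ℕ) : Fin P.ring := ⟨(i + j) % P.ring, Nat.mod_lt _ hP.ring_pos⟩

theorem mul_rawScore (hP : P.Proper n) {G : Graph n P} (hG : IsCoupled G)
    (τ : Fin (P.numAux n) → Fin 2) (σ : Fin n → Fin 2) (x : Fin n) (w : ℝ) :
    w * rawScore G τ (results (pools G) σ) (trueLabels τ σ) x =
    ∑ j ∈ Finset.range P.s, ∑ a, if Sum.inr x ∈ G (poolComp hP (comp (P := P) (Sum.inr x)) j) a then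
      w / ((j : ℝ) + 1) * centredCount (trueLabels τ σ) (Sum.inr x)
      (ahead P (comp (P := P) (Sum.inr x)) j)
        (G (poolComp hP (comp (P := P) (Sum.inr x)) j) a) else 0 := by
  rw [rawScore, Finset.mul_sum]
  refine Finset.sum_congr rfl fun j hj => ?_
  rw [unexplained_sub_centring hP hG τ σ x (Finset.mem_range.1 hj)
    (b := poolComp hP (comp (P := P) (Sum.inr x)) j) rfl, mul_div_assoc', mul_comm, mul_div_assoc,
    mul_comm, Finset.mul_sum]
  refine Finset.sum_congr rfl fun a _ => ?_
  split_ifs <;> simp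

-- After exponentiation the score is a product over all pools, and the sum over graphs factorises.
-- Each pool compartment has at most one position `j` in the window of `x`, so it contributes one
-- factor of `sum_poolFamily_exp_le`, or the factor one.
open Classical in
theorem sum_exp_rawScore_le (hP : P.Proper n) (τ : Fin (P.numAux n) → Fin 2) (σ : Fin n → Fin 2)
    (x : Fin n) (w : ℝ) :
    ∑ G ∈ Finset.univ.filter (fun G : Graph n P => IsCoupled G),
      Real.exp (w * rawScore G τ (results (pools G) σ) (trueLabels τ σ) x) ≤
    ((Finset.univ.filter fun G : Graph n P => IsCoupled G).card : ℝ) *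
      Real.exp (∑ j ∈ Finset.range P.s, P.p * ((P.g : ℝ) /
        (compartment n P (comp (P := P) (Sum.inr x))).card * (Real.exp (mgfExponent (trueLabels τ σ)
          (Sum.inr x) (ahead P (comp (P := P) (Sum.inr x)) j) (w / ((j : ℝ) + 1))) - 1))) := by
  set v₀ : Item n P := Sum.inr x with hv₀
  set i := comp v₀ with hi
  have hiR : i < P.ring := hP.comp_lt v₀
  set lab := trueLabels τ σ with hlab
  let f : ℕ → Finset (Item n P) → ℝ := fun j A => if v₀ ∈ A then
    Real.exp (w / ((j : ℝ) + 1) * centredCount lab v₀ (ahead P i j) A) else 1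
  let F : Fin P.ring → Finset (Item n P) → ℝ := fun b A =>
    ∏ j ∈ Finset.range P.s, if poolComp hP i j = b then f j A else 1
  let z : ℕ → ℝ := fun j => (P.g : ℝ) / (compartment n P i).card *
    (Real.exp (mgfExponent lab v₀ (ahead P i j) (w / ((j : ℝ) + 1))) - 1)
  have hexp : ∀ G ∈ Finset.univ.filter (fun G : Graph n P => IsCoupled G),
      Real.exp (w * rawScore G τ (results (pools G) σ) lab x) = ∏ b, ∏ a, F b (G b a) := by
    intro G hG
    rw [mul_rawScore hP (Finset.mem_filter.1 hG).2, Real.exp_sum]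
    have h1 : ∀ b : Fin P.ring, ∏ a, F b (G b a) =
        ∏ j ∈ Finset.range P.s, if poolComp hP i j = b then ∏ a, f j (G b a) else 1 := by
      intro b
      rw [Finset.prod_comm]
      refine Finset.prod_congr rfl fun j _ => ?_
      split_ifs <;> simp
    rw [Finset.prod_congr rfl fun b _ => h1 b, Finset.prod_comm]
    refine Finset.prod_congr rfl fun j _ => ?_
    rw [Finset.prod_ite_eq, if_pos (Finset.mem_univ _), Real.exp_sum]
    refine Finset.prod_congr rfl fun a _ => ?_
    simp only [f]
    split_ifs <;> simp_all
  rw [Finset.sum_congr rfl hexp, filter_isCoupled_eq,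
    ← Finset.prod_univ_sum (fun b => Fintype.piFinset fun _ => poolFamily n P b)
      (fun b (Gb : Fin P.p → Finset (Item n P)) => ∏ a, F b (Gb a))]
  have hb : ∀ b, ∑ Gb ∈ Fintype.piFinset (fun _ : Fin P.p => poolFamily n P b), ∏ a, F b (Gb a) =
      ∏ _a : Fin P.p, ∑ A ∈ poolFamily n P b, F b A := by
    intro b
    rw [Finset.prod_univ_sum]
  have hF0 : ∀ b A, 0 ≤ F b A := fun b A => Finset.prod_nonneg fun j _ => by
    simp only [f]
    split_ifs <;> positivity
  have hFle : ∀ b, ∑ A ∈ poolFamily n P b, F b A ≤ (poolFamily n P b).card *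
      Real.exp (∑ j ∈ Finset.range P.s, if poolComp hP i j = b then z j else 0) := by
    intro b
    by_cases h : ∃ j < P.s, poolComp hP i j = b
    · obtain ⟨j, hj, hjb⟩ := h
      -- A window of length `P.s ≤ P.ring` does not overlap itself on the ring.
      have huniq : ∀ j' ∈ Finset.range P.s, j' ≠ j → poolComp hP i j' ≠ b := by
        intro j' hj' hne h'
        rw [Finset.mem_range] at hj'
        have hs := hP.s_le_ring
        have h1 := congrArg Fin.val (h'.trans hjb.symm)
        simp only [poolComp] at h1
        have h2 := mod_ring_cases (R := P.ring) (a := i + j) (by omega)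
        have h3 := mod_ring_cases (R := P.ring) (a := i + j') (by omega)
        omega
      have hFb : ∀ A, F b A = f j A := by
        intro A
        simp only [F]
        rw [Finset.prod_eq_single j (fun j' hj' hne => if_neg (huniq j' hj' hne))
          (fun h => absurd (Finset.mem_range.2 hj) h), if_pos hjb]
      rw [Finset.sum_eq_single j (fun j' hj' hne => if_neg (huniq j' hj' hne))
          (fun h => absurd (Finset.mem_range.2 hj) h), if_pos hjb,
        Finset.sum_congr rfl fun A _ => hFb A]
      refine sum_poolFamily_exp_le hP lab (fun c hc => ?_) (comp_mem_ahead hP v₀ j) _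
      rw [← hjb]
      exact inWindow_of_mem_ahead hP hiR hj hc
    · push Not at h
      have hFb : ∀ A, F b A = 1 := fun A =>
        Finset.prod_eq_one fun j hj => if_neg (h j (Finset.mem_range.1 hj))
      rw [Finset.sum_eq_zero fun j hj => if_neg (h j (Finset.mem_range.1 hj)),
        Finset.sum_congr rfl fun A _ => hFb A]
      simp
  rw [Finset.prod_congr rfl fun b _ => hb b]
  simp only [Finset.prod_const, Finset.card_univ, Fintype.card_fin, Fintype.card_piFinset]
  calc ∏ b, (∑ A ∈ poolFamily n P b, F b A) ^ P.p ≤ ∏ b, ((poolFamily n P b).card *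
        Real.exp (∑ j ∈ Finset.range P.s, if poolComp hP i j = b then z j else 0)) ^ P.p :=
        Finset.prod_le_prod (fun b _ => pow_nonneg (Finset.sum_nonneg fun A _ => hF0 b A) _)
          fun b _ => pow_le_pow_left₀ (Finset.sum_nonneg fun A _ => hF0 b A) (hFle b) _
    _ = _ := by
      simp only [mul_pow, Finset.prod_mul_distrib]
      push_cast
      congr 1
      simp only [← Real.exp_nat_mul]
      rw [← Real.exp_sum, ← Finset.mul_sum, Finset.sum_comm, Finset.mul_sum]
      congr 1
      refine Finset.sum_congr rfl fun j _ => ?_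
      rw [Finset.sum_ite_eq, if_pos (Finset.mem_univ _)]

end Genie

/-! ### Failure probabilities -/

section Failure

variable {n : ℕ} {P : Params}

theorem fin_two_ne_one {z : Fin 2} (h : z ≠ 1) : z = 0 := by
  fin_cases z
  · rfl
  · exact absurd rfl h

/-- Induction over the rounds: if all earlier compartments are correct, then in round `t` the actual
scores coincide with those computed from the true labels. This removes the dependence between the
rounds. -/
theorem decode_eq_of_score (hP : P.Proper n) (k : ℕ) (T : ℝ) (G : Graph n P)
    (τ : Fin (P.numAux n) → Fin 2) (σ : Fin n → Fin 2) (res : PoolIdx P → ℕ)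
    (h : ∀ x, T < score k G τ res (trueLabels τ σ) x ↔ σ x = 1) : decode k T G τ res = σ := by
  have key : ∀ t (x : Fin n), estimate k T G τ res t (Sum.inr x) =
      if x.val % P.ℓ < t then σ x else 0 := by
    intro t
    induction t with
    | zero => intro x; simp [estimate]
    | succ t ih =>
      intro x
      rw [estimate_succ_inr_mod]
      by_cases hx : x.val % P.ℓ = t
      · have hs : score k G τ res (estimate k T G τ res t) x =
            score k G τ res (trueLabels τ σ) x := by
          refine score_congr k G τ res x fun v hv => ?_
          rcases v with y | z
          · rw [estimate_inl]; rfl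
          · rw [comp_inr, comp_inr] at hv
            rw [ih, if_pos (by omega)]; rfl
        rw [hs]
        by_cases hσ : σ x = 1
        · rw [if_pos ⟨hx, (h x).2 hσ⟩, if_pos (by omega), hσ]
        · rw [if_neg fun h' => hσ ((h x).1 h'.2), ih, if_neg (by omega), if_pos (by omega),
            fin_two_ne_one hσ]
      · rw [if_neg fun h' => hx h'.1, ih]
        refine if_congr ?_ rfl rfl
        omega
  funext x
  rw [decode, key, if_pos (Nat.mod_lt _ hP.ℓ_pos)]

/-- The exponent in the bound for the moment generating function of the score of `x`. -/
noncomputable def scoreExponent (lab : Item n P → Fin 2) (x : Fin n) (w : ℝ) : ℝ :=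
  ∑ j ∈ Finset.range P.s, P.p * ((P.g : ℝ) /
    (compartment n P (comp (P := P) (Sum.inr x))).card * (Real.exp (mgfExponent lab
      (Sum.inr x) (ahead P (comp (P := P) (Sum.inr x)) j) (w / ((j : ℝ) + 1))) - 1))

theorem card_filter_le_sum_exp {β : Type*} (s : Finset β) (q : β → Prop) [DecidablePred q]
    (f : β → ℝ) (hf : ∀ b ∈ s, q b → 0 ≤ f b) :
    ((s.filter q).card : ℝ) ≤ ∑ b ∈ s, Real.exp (f b) := by
  rw [Finset.card_filter, Nat.cast_sum]
  refine Finset.sum_le_sum fun b hb => ?_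
  split_ifs with h
  · rw [Nat.cast_one, ← Real.exp_zero]
    exact Real.exp_le_exp.2 (hf b hb h)
  · simp [(Real.exp_pos _).le]

-- Exponential Markov inequality for each item and a union bound. Items of label zero fail upwards
-- and get a nonnegative tilt, items of label one fail downwards and get a nonpositive one.
open Classical in
theorem card_decode_ne_le (hP : P.Proper n) {k : ℕ} (hk : 0 < k) (a : ℝ)
    (τ : Fin (P.numAux n) → Fin 2) (σ : Fin n → Fin 2) (hσ : ∑ x, (σ x).val = k) {w₀ w₁ e₀ e₁ : ℝ}
    (hw₀ : 0 ≤ w₀) (hw₁ : w₁ ≤ 0)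
    (h₀ : ∀ x, σ x = 0 → scoreExponent (trueLabels τ σ) x w₀ -
      w₀ * (a * (∑ j ∈ Finset.range P.s, 1 / ((j : ℝ) + 1)) * meanDeg n P) ≤ -e₀)
    (h₁ : ∀ x, σ x = 1 → scoreExponent (trueLabels τ σ) x w₁ -
      w₁ * (a * (∑ j ∈ Finset.range P.s, 1 / ((j : ℝ) + 1)) * meanDeg n P) ≤ -e₁) :
    (((Finset.univ.filter fun G : Graph n P => IsCoupled G).filter fun G =>
      decode k (harmonicThreshold k P a) G τ (results (pools G) σ) ≠ σ).card : ℝ) ≤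
    ((Finset.univ.filter fun G : Graph n P => IsCoupled G).card : ℝ) *
      (n * Real.exp (-e₀) + k * Real.exp (-e₁)) := by
  set 𝒢 := Finset.univ.filter fun G : Graph n P => IsCoupled G with h𝒢
  set thr := a * (∑ j ∈ Finset.range P.s, 1 / ((j : ℝ) + 1)) * meanDeg n P with hthr
  set Bad : Fin n → Finset (Graph n P) := fun x => 𝒢.filter fun G =>
    ¬ (thr < rawScore G τ (results (pools G) σ) (trueLabels τ σ) x ↔ σ x = 1) with hBad
  have hsub : (𝒢.filter fun G =>
      decode k (harmonicThreshold k P a) G τ (results (pools G) σ) ≠ σ) ⊆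
      Finset.univ.biUnion Bad := by
    intro G hG
    rw [Finset.mem_filter] at hG
    by_contra hcon
    simp only [hBad, Finset.mem_biUnion, Finset.mem_univ, true_and, Finset.mem_filter, not_exists,
      not_and, not_not] at hcon
    refine hG.2 (decode_eq_of_score hP k _ G τ σ _ fun x => ?_)
    rw [harmonicThreshold_lt_score_iff hk hP.numCoupled_pos hP.meanDeg_pos]
    exact hcon x hG.1
  have hone : ∀ x, ((Bad x).card : ℝ) ≤
      𝒢.card * (if σ x = 1 then Real.exp (-e₁) else Real.exp (-e₀)) := by
    intro x
    have main : ∀ w e : ℝ, (∀ G ∈ 𝒢, ¬ (thr < rawScore G τ (results (pools G) σ) (trueLabels τ σ) x ↔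
        σ x = 1) → 0 ≤ w * rawScore G τ (results (pools G) σ) (trueLabels τ σ) x - w * thr) →
        scoreExponent (trueLabels τ σ) x w - w * thr ≤ -e →
        ((Bad x).card : ℝ) ≤ 𝒢.card * Real.exp (-e) := by
      intro w e hw he
      refine (card_filter_le_sum_exp 𝒢 _ _ hw).trans ?_
      simp only [sub_eq_add_neg, Real.exp_add]
      rw [← Finset.sum_mul]
      refine (mul_le_mul_of_nonneg_right (sum_exp_rawScore_le hP τ σ x w)
        (Real.exp_pos _).le).trans ?_
      rw [mul_assoc, ← Real.exp_add]
      refine mul_le_mul_of_nonneg_left (Real.exp_le_exp.2 ?_) (Nat.cast_nonneg _)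
      rw [← sub_eq_add_neg]
      exact he
    split_ifs with hx
    · refine main w₁ e₁ (fun G _ hG => ?_) (h₁ x hx)
      simp only [hx, iff_true, not_lt] at hG
      nlinarith
    · refine main w₀ e₀ (fun G _ hG => ?_) (h₀ x (fin_two_ne_one hx))
      simp only [hx, iff_false, not_not] at hG
      nlinarith
  have hcount : ∑ x, (if σ x = 1 then Real.exp (-e₁) else Real.exp (-e₀)) ≤
      n * Real.exp (-e₀) + k * Real.exp (-e₁) := by
    have h1 : ((Finset.univ.filter fun x => σ x = 1).card : ℝ) = k := by
      rw [← hσ, Finset.card_filter]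
      push_cast
      refine Finset.sum_congr rfl fun x _ => ?_
      generalize σ x = z
      fin_cases z <;> simp
    rw [Finset.sum_ite, Finset.sum_const, Finset.sum_const, nsmul_eq_mul, nsmul_eq_mul, h1, add_comm]
    refine add_le_add (mul_le_mul_of_nonneg_right ?_ (Real.exp_pos _).le) le_rfl
    exact_mod_cast (Finset.card_le_univ _).trans (by simp)
  calc _ ≤ ((Finset.univ.biUnion Bad).card : ℝ) := by exact_mod_cast Finset.card_le_card hsub
    _ ≤ ∑ x, ((Bad x).card : ℝ) := by exact_mod_cast Finset.card_biUnion_le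
    _ ≤ ∑ x, 𝒢.card * (if σ x = 1 then Real.exp (-e₁) else Real.exp (-e₀)) :=
        Finset.sum_le_sum fun x _ => hone x
    _ ≤ _ := by
        rw [← Finset.mul_sum]
        exact mul_le_mul_of_nonneg_left hcount (Nat.cast_nonneg _)

/-! ### Concentration of the numbers of ones in the compartments -/

theorem sum_labelings {M : Type*} [AddCommMonoid M] (N K : ℕ) (F : Finset (Fin N) → M) :
    ∑ f ∈ Finset.univ.filter (fun f : Fin N → Fin 2 => ∑ v, (f v).val = K),
      F (Finset.univ.filter fun v => f v = 1) = ∑ A ∈ Finset.univ.powersetCard K, F A := by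
  have hcard : ∀ f : Fin N → Fin 2,
      ∑ v, (f v).val = (Finset.univ.filter fun v => f v = 1).card := by
    intro f
    rw [Finset.card_filter]
    refine Finset.sum_congr rfl fun v _ => ?_
    generalize f v = z
    fin_cases z <;> rfl
  refine Finset.sum_bij' (fun f _ => Finset.univ.filter fun v => f v = 1)
    (fun A _ v => if v ∈ A then 1 else 0) (fun f hf => ?_) (fun A hA => ?_) (fun f _ => ?_)
    (fun A _ => ?_) (fun _ _ => rfl)
  · rw [Finset.mem_powersetCard, ← hcard]
    exact ⟨Finset.subset_univ _, (Finset.mem_filter.1 hf).2⟩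
  · rw [Finset.mem_powersetCard] at hA
    simp [hcard, hA.2]
  · funext v
    by_cases h : f v = 1
    · simp [h]
    · simp [fin_two_ne_one h]
  · ext v
    simp

theorem card_labelings (N K : ℕ) :
    (Finset.univ.filter fun f : Fin N → Fin 2 => ∑ v, (f v).val = K).card = N.choose K := by
  rw [Finset.card_eq_sum_ones, sum_labelings N K fun _ => 1]
  simp

/-- Here the set of ones is the random `K`-subset and `V` is the fixed set, so the hypergeometric
bound applies with exchanged roles. Only the upper tail is needed, because the ones of a compartment
enter the exponents as variance. -/
theorem card_labelings_gt_le (N K : ℕ) (V : Finset (Fin N)) {t B μ : ℝ} (ht : 0 ≤ t)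
    (hμ : (K : ℝ) * (V.card / N) ≤ μ) :
    (((Finset.univ.filter fun f : Fin N → Fin 2 => ∑ v, (f v).val = K).filter fun f =>
      B < (∑ v ∈ V, (f v).val : ℕ)).card : ℝ) ≤
    ((Finset.univ.filter fun f : Fin N → Fin 2 => ∑ v, (f v).val = K).card : ℝ) *
      Real.exp (μ * (Real.exp t - 1) - t * B) := by
  have hV : ∀ f : Fin N → Fin 2,
      (∑ v ∈ V, (f v).val : ℕ) = ((Finset.univ.filter fun v => f v = 1) ∩ V).card := by
    intro f
    rw [Finset.filter_inter, Finset.univ_inter, Finset.card_filter]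
    refine Finset.sum_congr rfl fun v _ => ?_
    generalize f v = z
    fin_cases z <;> rfl
  refine (card_filter_le_sum_exp _ _ (fun f => t * ((Finset.univ.filter fun v => f v = 1) ∩ V).card
    - t * B) fun f _ hf => ?_).trans ?_
  · rw [hV] at hf
    nlinarith
  · rw [sum_labelings N K fun A => Real.exp (t * (A ∩ V).card - t * B)]
    simp only [sub_eq_add_neg _ (t * B), Real.exp_add _ (-(t * B))]
    rw [← Finset.sum_mul]
    refine (mul_le_mul_of_nonneg_right (sum_powersetCard_exp_le _ V t K)
      (Real.exp_pos _).le).trans ?_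
    rw [mul_assoc, ← Real.exp_add, ← Real.exp_add, Finset.card_powersetCard, card_labelings]
    simp only [Finset.univ_inter, Finset.card_univ, Fintype.card_fin]
    refine mul_le_mul_of_nonneg_left (Real.exp_le_exp.2 ?_) (Nat.cast_nonneg _)
    have : 0 ≤ Real.exp t - 1 := by linarith [Real.add_one_le_exp t]
    nlinarith [mul_le_mul_of_nonneg_right hμ this]

/-- The auxiliary items of a compartment. -/
def auxBlock (n : ℕ) (P : Params) (c : ℕ) : Finset (Fin (P.numAux n)) :=
  Finset.univ.filter fun y => y.val / P.compSize n = c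

/-- The items of a bulk compartment. -/
def itemBlock (n : ℕ) (P : Params) (i : ℕ) : Finset (Fin n) :=
  Finset.univ.filter fun x => x.val % P.ℓ = i

theorem card_compartment_inter_onesOf (τ : Fin (P.numAux n) → Fin 2) (σ : Fin n → Fin 2) (c : ℕ) :
    (compartment n P c ∩ onesOf (trueLabels τ σ)).card =
      if c < P.s - 1 then ∑ y ∈ auxBlock n P c, (τ y).val
      else ∑ x ∈ itemBlock n P (c - (P.s - 1)), (σ x).val := by
  rw [← sum_val_eq_card_inter, ← Finset.univ_inter (compartment n P c),
    ← Finset.filter_mem_eq_inter, Finset.sum_filter, Fintype.sum_sum_type]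
  simp only [trueLabels, Sum.elim_inl, Sum.elim_inr, mem_compartment, comp_inl, comp_inr]
  split_ifs with hc
  · rw [Finset.sum_eq_zero (s := (Finset.univ : Finset (Fin n))) fun x _ => if_neg (by omega),
      add_zero, auxBlock, Finset.sum_filter]
  · rw [Finset.sum_eq_zero (s := (Finset.univ : Finset (Fin (P.numAux n)))) fun y _ => if_neg (by
      have := comp_inl_lt y
      omega), zero_add, itemBlock, Finset.sum_filter]
    exact Finset.sum_congr rfl fun x _ => if_congr (by omega) rfl rfl

open Classical in
theorem card_auxBad_le {B t μ : ℝ} (ht : 0 ≤ t) (k : ℕ)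
    (hμ : ∀ c < P.s - 1, (P.auxOnes k : ℝ) * ((auxBlock n P c).card / P.numAux n) ≤ μ) :
    (((Finset.univ.filter fun τ : Fin (P.numAux n) → Fin 2 =>
        ∑ y, (τ y).val = P.auxOnes k).filter fun τ =>
      ¬ ∀ c < P.s - 1, ((∑ y ∈ auxBlock n P c, (τ y).val : ℕ) : ℝ) ≤ B).card : ℝ) ≤
    ((Finset.univ.filter fun τ : Fin (P.numAux n) → Fin 2 =>
        ∑ y, (τ y).val = P.auxOnes k).card : ℝ) *
      (P.s * Real.exp (μ * (Real.exp t - 1) - t * B)) := by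
  set 𝒯 := Finset.univ.filter fun τ : Fin (P.numAux n) → Fin 2 => ∑ y, (τ y).val = P.auxOnes k
  have hsub : 𝒯.filter (fun τ => ¬ ∀ c < P.s - 1, ((∑ y ∈ auxBlock n P c, (τ y).val : ℕ) : ℝ) ≤ B) ⊆
      (Finset.range (P.s - 1)).biUnion fun c =>
        𝒯.filter fun τ => B < (∑ y ∈ auxBlock n P c, (τ y).val : ℕ) := by
    intro τ hτ
    simp only [Finset.mem_filter, not_forall, not_le] at hτ
    obtain ⟨hτ, c, hc, h⟩ := hτ
    simp only [Finset.mem_biUnion, Finset.mem_filter, Finset.mem_range]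
    exact ⟨c, hc, hτ, h⟩
  calc _ ≤ (((Finset.range (P.s - 1)).biUnion fun c =>
        𝒯.filter fun τ => B < (∑ y ∈ auxBlock n P c, (τ y).val : ℕ)).card : ℝ) := by
        exact_mod_cast Finset.card_le_card hsub
    _ ≤ ∑ c ∈ Finset.range (P.s - 1),
        ((𝒯.filter fun τ => B < (∑ y ∈ auxBlock n P c, (τ y).val : ℕ)).card : ℝ) := by
        exact_mod_cast Finset.card_biUnion_le
    _ ≤ ∑ c ∈ Finset.range (P.s - 1), 𝒯.card * Real.exp (μ * (Real.exp t - 1) - t * B) :=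
        Finset.sum_le_sum fun c hc =>
          card_labelings_gt_le _ _ (auxBlock n P c) ht (hμ c (Finset.mem_range.1 hc))
    _ ≤ _ := by
        rw [Finset.sum_const, Finset.card_range, nsmul_eq_mul, mul_left_comm]
        refine mul_le_mul_of_nonneg_left (mul_le_mul_of_nonneg_right ?_ (Real.exp_pos _).le)
          (Nat.cast_nonneg _)
        exact_mod_cast Nat.sub_le _ _

open Classical in
theorem card_itemBad_le {B t μ : ℝ} (ht : 0 ≤ t) (k : ℕ)
    (hμ : ∀ i < P.ℓ, (k : ℝ) * ((itemBlock n P i).card / n) ≤ μ) :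
    (((Finset.univ.filter fun σ : Fin n → Fin 2 => ∑ x, (σ x).val = k).filter fun σ =>
      ¬ ∀ i < P.ℓ, ((∑ x ∈ itemBlock n P i, (σ x).val : ℕ) : ℝ) ≤ B).card : ℝ) ≤
    ((Finset.univ.filter fun σ : Fin n → Fin 2 => ∑ x, (σ x).val = k).card : ℝ) *
      (P.ℓ * Real.exp (μ * (Real.exp t - 1) - t * B)) := by
  set 𝒮 := Finset.univ.filter fun σ : Fin n → Fin 2 => ∑ x, (σ x).val = k
  have hsub : 𝒮.filter (fun σ => ¬ ∀ i < P.ℓ, ((∑ x ∈ itemBlock n P i, (σ x).val : ℕ) : ℝ) ≤ B) ⊆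
      (Finset.range P.ℓ).biUnion fun i =>
        𝒮.filter fun σ => B < (∑ x ∈ itemBlock n P i, (σ x).val : ℕ) := by
    intro σ hσ
    simp only [Finset.mem_filter, not_forall, not_le] at hσ
    obtain ⟨hσ, c, hc, h⟩ := hσ
    simp only [Finset.mem_biUnion, Finset.mem_filter, Finset.mem_range]
    exact ⟨c, hc, hσ, h⟩
  calc _ ≤ (((Finset.range P.ℓ).biUnion fun i =>
        𝒮.filter fun σ => B < (∑ x ∈ itemBlock n P i, (σ x).val : ℕ)).card : ℝ) := by
        exact_mod_cast Finset.card_le_card hsub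
    _ ≤ ∑ i ∈ Finset.range P.ℓ,
        ((𝒮.filter fun σ => B < (∑ x ∈ itemBlock n P i, (σ x).val : ℕ)).card : ℝ) := by
        exact_mod_cast Finset.card_biUnion_le
    _ ≤ ∑ i ∈ Finset.range P.ℓ, 𝒮.card * Real.exp (μ * (Real.exp t - 1) - t * B) :=
        Finset.sum_le_sum fun i hi =>
          card_labelings_gt_le _ _ (itemBlock n P i) ht (hμ i (Finset.mem_range.1 hi))
    _ = _ := by
        rw [Finset.sum_const, Finset.card_range, nsmul_eq_mul, mul_left_comm]

/-! ### A union bound over a product of three sets -/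

-- For labels outside the bad sets the bound is `ε₃`; for bad labels the trivial bound by the whole
-- of `A` is enough.
open Classical in
theorem card_filter_product_le {α β γ : Type*} (A : Finset α) (S : Finset β) (U : Finset γ)
    (F : α × β × γ → Prop) (bS : β → Prop) (bU : γ → Prop) {ε₁ ε₂ ε₃ : ℝ}
    (h₁ : ((S.filter bS).card : ℝ) ≤ S.card * ε₁) (h₂ : ((U.filter bU).card : ℝ) ≤ U.card * ε₂)
    (hε₃ : 0 ≤ ε₃)
    (h₃ : ∀ b ∈ S, ∀ c ∈ U, ¬ bS b → ¬ bU c →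
      ((A.filter fun a => F (a, b, c)).card : ℝ) ≤ A.card * ε₃) :
    (((A ×ˢ S ×ˢ U).filter F).card : ℝ) ≤ (A ×ˢ S ×ˢ U).card * (ε₁ + ε₂ + ε₃) := by
  have hA : (0 : ℝ) ≤ A.card := Nat.cast_nonneg _
  have hsum : (((A ×ˢ S ×ˢ U).filter F).card : ℝ) =
      ∑ b ∈ S, ∑ c ∈ U, ((A.filter fun a => F (a, b, c)).card : ℝ) := by
    rw [Finset.card_filter, Nat.cast_sum, Finset.sum_product_right, Finset.sum_product]
    refine Finset.sum_congr rfl fun b _ => Finset.sum_congr rfl fun c _ => ?_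
    rw [Finset.card_filter, Nat.cast_sum]
  have hle : ∀ b ∈ S, ∀ c ∈ U, ((A.filter fun a => F (a, b, c)).card : ℝ) ≤
      A.card * ((if bS b then 1 else 0) + (if bU c then 1 else 0) + ε₃) := by
    intro b hb c hc
    have htriv : ((A.filter fun a => F (a, b, c)).card : ℝ) ≤ A.card := by
      exact_mod_cast Finset.card_filter_le _ _
    by_cases h1 : bS b
    · refine htriv.trans (le_mul_of_one_le_right hA ?_)
      rw [if_pos h1]
      split_ifs <;> linarith
    · by_cases h2 : bU c
      · refine htriv.trans (le_mul_of_one_le_right hA ?_)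
        rw [if_pos h2, if_neg h1]
        linarith
      · rw [if_neg h1, if_neg h2]
        simpa using h₃ b hb c hc h1 h2
  rw [hsum]
  refine (Finset.sum_le_sum fun b hb => Finset.sum_le_sum fun c hc => hle b hb c hc).trans ?_
  simp only [← Finset.mul_sum, Finset.sum_add_distrib, Finset.sum_const, Finset.sum_boole,
    nsmul_eq_mul, Finset.card_product]
  push_cast
  have e1 : (A.card : ℝ) * ((U.card * (S.filter bS).card + S.card * (U.filter bU).card) +
      S.card * (U.card * ε₃)) ≤ A.card * (S.card * U.card) * (ε₁ + ε₂ + ε₃) := by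
    have h4 := mul_le_mul_of_nonneg_left h₁ (Nat.cast_nonneg (α := ℝ) U.card)
    have h5 := mul_le_mul_of_nonneg_left h₂ (Nat.cast_nonneg (α := ℝ) S.card)
    have := mul_le_mul_of_nonneg_left (add_le_add h4 h5) hA
    nlinarith
  refine le_trans (le_of_eq ?_) e1
  ring

end Failure

/-! ### Explicit bound for the exponents -/

section Exponent

variable {n : ℕ} {P : Params}

theorem card_compartment_bounds (hℓ : 0 < P.ℓ) (hN : 0 < P.compSize n) {c : ℕ} (hc : c < P.ring) :
    P.compSize n - 1 ≤ (compartment n P c).card ∧ (compartment n P c).card ≤ P.compSize n := by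
  by_cases h : c < P.s - 1
  · rw [card_compartment_aux hN h]; omega
  · obtain ⟨i, rfl⟩ : ∃ i, c = P.s - 1 + i := ⟨c - (P.s - 1), by omega⟩
    have hi : i < P.ℓ := by
      have : P.s - 1 + i < P.ℓ + P.s - 1 := hc
      omega
    rw [card_compartment_item hℓ hi]
    have h1 : n + P.ℓ - 1 = n + (P.ℓ - 1) := by omega
    have h2 : P.compSize n = (n + (P.ℓ - 1)) / P.ℓ := by rw [Params.compSize, h1]
    constructor
    · rw [h2, ← Nat.sub_mul_div]
      exact Nat.div_le_div_right (by omega)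
    · rw [h2]
      exact Nat.div_le_div_right (by omega)

/-- Taylor expansion to third order: the coefficient `1 / 2` of the variance determines the number
of pools and must not be lost. -/
theorem exp_sub_one_sub_le {t : ℝ} (ht : |t| ≤ 1) : Real.exp t - 1 - t ≤ t ^ 2 * (1 / 2 + |t|) := by
  have h := Real.exp_bound ht (n := 3) (by norm_num)
  simp only [Finset.sum_range_succ, Finset.sum_range_zero] at h
  norm_num [Nat.factorial] at h
  have h1 := (abs_le.1 h).2
  have h3 : |t| ^ 3 = t ^ 2 * |t| := by rw [pow_succ, sq_abs]
  have h4 : 0 ≤ |t| ^ 3 := by positivity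
  nlinarith

theorem exp_sub_one_le {z : ℝ} (hz : |z| ≤ 1) : Real.exp z - 1 ≤ z + z ^ 2 := by
  have := (abs_le.1 (Real.abs_exp_sub_one_sub_id_le hz)).2
  linarith

theorem meanOnes_nonneg (hP : P.Proper n) (lab : Item n P → Fin 2) (v : Item n P) (c : ℕ) :
    0 ≤ meanOnes lab v c := by
  have : (1 : ℝ) ≤ P.g := by exact_mod_cast hP.g_pos
  unfold meanOnes
  refine mul_nonneg ?_ (by positivity)
  split_ifs <;> linarith

/-- In the denominator, one is lost because a compartment may have the size `⌊n / ℓ⌋`, and another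
one for the item `v`. -/
theorem meanOnes_le (hP : P.Proper n) (lab : Item n P → Fin 2) (v : Item n P) {c : ℕ}
    (hc : c < P.ring) {κ : ℝ} (hκ : ((compartment n P c ∩ onesOf lab).card : ℝ) ≤ κ)
    (hN : 3 ≤ P.compSize n) :
    meanOnes lab v c ≤ P.g * (κ / ((P.compSize n : ℝ) - 2)) := by
  have hg : (1 : ℝ) ≤ P.g := by exact_mod_cast hP.g_pos
  have hN' : (3 : ℝ) ≤ P.compSize n := by exact_mod_cast hN
  have hcard : ((P.compSize n : ℝ) - 2) ≤ ((compartment n P c).erase v).card := by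
    have h1 := (card_compartment_bounds hP.ℓ_pos (n := n) (by omega) hc).1
    have h2 := Finset.pred_card_le_card_erase (s := compartment n P c) (a := v)
    have h3 : P.compSize n - 2 ≤ ((compartment n P c).erase v).card := by omega
    have h4 : ((P.compSize n - 2 : ℕ) : ℝ) ≤ ((compartment n P c).erase v).card := by
      exact_mod_cast h3
    rw [Nat.cast_sub (by omega)] at h4
    exact_mod_cast h4
  unfold meanOnes
  refine mul_le_mul ?_ ?_ (by positivity) (by positivity)
  · split_ifs <;> linarith
  · exact div_le_div₀ ((Nat.cast_nonneg _).trans hκ) hκ (by linarith) hcard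

/-- The coefficient of `1 / (D (j + 1))` in the bound for `mgfExponent`. -/
noncomputable def leadingCoeff (label h D b q : ℝ) : ℝ :=
  label * h + 2 * b * |h| + h ^ 2 * (1 / 2 + |h| / D) * q

/-- The tilt is `t = h / (D (j + 1))`. The `j + 1` compartments ahead contribute a variance term of
order `t² (j + 1)`, which is again of order `1 / (j + 1)`, like the signal. Thus one coefficient
serves all `j`, which is the effect of the weights in the score. -/
theorem mgfExponent_le (hP : P.Proper n) (lab : Item n P → Fin 2) (x : Fin n) {j : ℕ} (hj : j < P.s)
    {h κ D : ℝ} (hD : 0 < D) (hhD : |h| ≤ D) (hN : 3 ≤ P.compSize n)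
    (hκ : ∀ c < P.ring, ((compartment n P c ∩ onesOf lab).card : ℝ) ≤ κ) :
    mgfExponent lab (Sum.inr x) (ahead P (comp (P := P) (Sum.inr x)) j) (h / D / ((j : ℝ) + 1)) ≤
      leadingCoeff (lab (Sum.inr x)).val h D (P.g / ((P.compSize n : ℝ) - 2))
        (P.g * κ / (D * ((P.compSize n : ℝ) - 2))) / (D * ((j : ℝ) + 1)) := by
  set v : Item n P := Sum.inr x with hv
  set i := comp v with hi
  have hiR : i < P.ring := hP.comp_lt v
  set t := h / D / ((j : ℝ) + 1) with ht
  have hj1 : (1 : ℝ) ≤ (j : ℝ) + 1 := by linarith [Nat.cast_nonneg (α := ℝ) j]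
  have hj0 : (0 : ℝ) < (j : ℝ) + 1 := by linarith
  have habs : |t| = |h| / D / ((j : ℝ) + 1) := by
    rw [ht, abs_div, abs_div, abs_of_pos hD, abs_of_pos hj0]
  have htD : |t| ≤ |h| / D := by
    rw [habs]
    exact div_le_self (by positivity) hj1
  have ht1 : |t| ≤ 1 := htD.trans ((div_le_one hD).2 hhD)
  have hg : (1 : ℝ) ≤ P.g := by exact_mod_cast hP.g_pos
  have hN' : (3 : ℝ) ≤ P.compSize n := by exact_mod_cast hN
  set N2 := (P.compSize n : ℝ) - 2 with hN2
  have hN2pos : 0 < N2 := by linarith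
  have hκ0 : 0 ≤ κ := (Nat.cast_nonneg _).trans (hκ i hiR)
  have hsum : (∑ c : Fin P.ring, if c.val ∈ ahead P i j then meanOnes lab v c.val else 0) ≤
      ((j : ℝ) + 1) * (P.g * (κ / N2)) := by
    rw [sum_ite_mem_ahead hP hiR hj]
    calc _ ≤ ∑ r ∈ Finset.range (j + 1), P.g * (κ / N2) := Finset.sum_le_sum fun r _ =>
          meanOnes_le hP lab v (Nat.mod_lt _ hP.ring_pos) (hκ _ (Nat.mod_lt _ hP.ring_pos)) hN
      _ = _ := by simp
  have hsum0 : 0 ≤ ∑ c : Fin P.ring, if c.val ∈ ahead P i j then meanOnes lab v c.val else 0 :=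
    Finset.sum_nonneg fun c _ => by
      split_ifs
      · exact meanOnes_nonneg hP lab v _
      · exact le_rfl
  have hφ0 : 0 ≤ Real.exp t - 1 - t := by linarith [Real.add_one_le_exp t]
  have hφ : Real.exp t - 1 - t ≤ t ^ 2 * (1 / 2 + |h| / D) :=
    (exp_sub_one_sub_le ht1).trans (mul_le_mul_of_nonneg_left (by linarith) (sq_nonneg _))
  have hsecond : (Real.exp t - 1 - t) *
      (∑ c : Fin P.ring, if c.val ∈ ahead P i j then meanOnes lab v c.val else 0) ≤
      h ^ 2 * (1 / 2 + |h| / D) * (P.g * κ / (D * N2)) / (D * ((j : ℝ) + 1)) := by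
    refine (mul_le_mul hφ hsum hsum0 (by positivity)).trans (le_of_eq ?_)
    rw [ht]
    field_simp
  set β := ((P.g : ℝ) - 1) / (((compartment n P i).card : ℝ) - 1) with hβ
  have hcard : N2 ≤ ((compartment n P i).card : ℝ) - 1 := by
    have h1 := (card_compartment_bounds hP.ℓ_pos (n := n) (by omega) hiR).1
    have h4 : ((P.compSize n - 1 : ℕ) : ℝ) ≤ (compartment n P i).card := by exact_mod_cast h1
    rw [Nat.cast_sub (by omega)] at h4
    push_cast at h4
    linarith
  have hβ0 : 0 ≤ β := div_nonneg (by linarith) (by linarith)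
  have hβ1 : β ≤ P.g / N2 := div_le_div₀ (by linarith) (by linarith) hN2pos hcard
  have hlab0 : (0 : ℝ) ≤ (lab v).val := Nat.cast_nonneg _
  have hlab1 : ((lab v).val : ℝ) ≤ 1 := by
    have : (lab v).val ≤ 1 := by omega
    exact_mod_cast this
  have hfirst : ((lab v).val : ℝ) * (t - β * (Real.exp t - 1)) ≤
      ((lab v).val * h + 2 * (P.g / N2) * |h|) / (D * ((j : ℝ) + 1)) := by
    have he := Real.abs_exp_sub_one_le ht1
    have h1 : -(β * (Real.exp t - 1)) ≤ P.g / N2 * (2 * |t|) := by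
      calc -(β * (Real.exp t - 1)) ≤ |β * (Real.exp t - 1)| := neg_le_abs _
        _ = β * |Real.exp t - 1| := by rw [abs_mul, abs_of_nonneg hβ0]
        _ ≤ _ := mul_le_mul hβ1 he (abs_nonneg _) (by positivity)
    have h2 : ((lab v).val : ℝ) * -(β * (Real.exp t - 1)) ≤ P.g / N2 * (2 * |t|) := by
      calc ((lab v).val : ℝ) * -(β * (Real.exp t - 1)) ≤ (lab v).val * (P.g / N2 * (2 * |t|)) :=
            mul_le_mul_of_nonneg_left h1 hlab0
        _ ≤ 1 * (P.g / N2 * (2 * |t|)) := mul_le_mul_of_nonneg_right hlab1 (by positivity)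
        _ = _ := one_mul _
    have h3 : ((lab v).val * h + 2 * (P.g / N2) * |h|) / (D * ((j : ℝ) + 1)) =
        (lab v).val * t + P.g / N2 * (2 * |t|) := by
      rw [habs, ht]
      field_simp
    rw [h3]
    linarith
  rw [mgfExponent, leadingCoeff, add_div]
  exact add_le_add hfirst hsecond

/-- The mean degree `D` cancels the `D` in `K / (D (j + 1))`, and the sum over `j` produces the
harmonic number. The two further terms account for compartments smaller than `⌈n / ℓ⌉` and for the
second order in `exp z - 1 ≤ z + z ^ 2`. -/
theorem scoreExponent_le (hP : P.Proper n) (lab : Item n P → Fin 2) (x : Fin n) {h κ : ℝ}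
    (hhD : |h| ≤ meanDeg n P) (hN : 3 ≤ P.compSize n)
    (hκ : ∀ c < P.ring, ((compartment n P c ∩ onesOf lab).card : ℝ) ≤ κ) {K : ℝ}
    (hK : leadingCoeff (lab (Sum.inr x)).val h (meanDeg n P) (P.g / ((P.compSize n : ℝ) - 2))
        (P.g * κ / (meanDeg n P * ((P.compSize n : ℝ) - 2))) = K) (hKD : |K| ≤ meanDeg n P) :
    scoreExponent lab x (h / meanDeg n P) ≤ (∑ j ∈ Finset.range P.s, 1 / ((j : ℝ) + 1)) *
      (K + ((P.compSize n : ℝ) / ((P.compSize n : ℝ) - 1) - 1) * |K| +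
        (P.compSize n : ℝ) / ((P.compSize n : ℝ) - 1) * (K ^ 2 / meanDeg n P)) := by
  set D := meanDeg n P with hDdef
  have hD : 0 < D := hP.meanDeg_pos
  set N : ℝ := (P.compSize n : ℝ) with hNdef
  have hN' : (3 : ℝ) ≤ N := by rw [hNdef]; exact_mod_cast hN
  set i := comp (n := n) (P := P) (Sum.inr x) with hi
  have hiR : i < P.ring := hP.comp_lt _
  set Ni : ℝ := ((compartment n P i).card : ℝ) with hNi
  have hb := card_compartment_bounds hP.ℓ_pos (n := n) (by omega) hiR
  have hNi1 : N - 1 ≤ Ni := by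
    have h4 : ((P.compSize n - 1 : ℕ) : ℝ) ≤ (compartment n P i).card := by exact_mod_cast hb.1
    rw [Nat.cast_sub (by omega)] at h4
    push_cast at h4
    exact h4
  have hNi2 : Ni ≤ N := by rw [hNi, hNdef]; exact_mod_cast hb.2
  have hNi0 : 0 < Ni := by linarith
  set ρ := N / Ni with hρ
  have hρ1 : 1 ≤ ρ := (one_le_div hNi0).2 hNi2
  have hρ2 : ρ ≤ N / (N - 1) := div_le_div_of_nonneg_left (by linarith) (by linarith) hNi1
  have hpg : (P.p : ℝ) * ((P.g : ℝ) / Ni) = D * ρ := by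
    have hN0 : N ≠ 0 := by linarith
    rw [hDdef, meanDeg, ← hNdef, hρ]
    field_simp
  rw [scoreExponent, Finset.sum_mul]
  refine Finset.sum_le_sum fun j hj => ?_
  have hj1 : (1 : ℝ) ≤ (j : ℝ) + 1 := by linarith [Nat.cast_nonneg (α := ℝ) j]
  have hj0 : (0 : ℝ) < (j : ℝ) + 1 := by linarith
  have hm := mgfExponent_le hP lab x (Finset.mem_range.1 hj) hD hhD hN hκ
  rw [hK] at hm
  set z := K / (D * ((j : ℝ) + 1)) with hz
  have hz1 : |z| ≤ 1 := by
    rw [hz, abs_div, abs_of_pos (by positivity : 0 < D * ((j : ℝ) + 1)),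
      div_le_one (by positivity)]
    exact hKD.trans (le_mul_of_one_le_right hD.le hj1)
  rw [← mul_assoc, hpg]
  have h1 : Real.exp (mgfExponent lab (Sum.inr x) (ahead P i j) (h / D / ((j : ℝ) + 1))) - 1 ≤
      z + z ^ 2 := (sub_le_sub_right (Real.exp_le_exp.2 hm) 1).trans (exp_sub_one_le hz1)
  refine (mul_le_mul_of_nonneg_left h1 (by positivity)).trans ?_
  have h2 : D * ρ * (z + z ^ 2) = 1 / ((j : ℝ) + 1) * (ρ * K + ρ * (K ^ 2 / D / ((j : ℝ) + 1))) := by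
    rw [hz]
    field_simp
  rw [h2]
  refine mul_le_mul_of_nonneg_left ?_ (by positivity)
  have h3 : ρ * K ≤ K + (N / (N - 1) - 1) * |K| := by
    have h5 : (ρ - 1) * K ≤ (N / (N - 1) - 1) * |K| :=
      (mul_le_mul_of_nonneg_left (le_abs_self K) (by linarith)).trans
        (mul_le_mul_of_nonneg_right (by linarith) (abs_nonneg K))
    linarith
  have h4 : ρ * (K ^ 2 / D / ((j : ℝ) + 1)) ≤ N / (N - 1) * (K ^ 2 / D) :=
    mul_le_mul hρ2 (div_le_self (by positivity) hj1) (by positivity) (by linarith)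
  linarith

end Exponent

/-! ### Lower bound for the success probability -/

section Success

variable {n : ℕ} {P : Params}

theorem card_compartment (c : ℕ) : (compartment n P c).card =
    if c < P.s - 1 then (auxBlock n P c).card else (itemBlock n P (c - (P.s - 1))).card := by
  rw [← Finset.univ_inter (compartment n P c), ← Finset.filter_mem_eq_inter,
    Finset.card_filter, Fintype.sum_sum_type]
  simp only [mem_compartment, comp_inl, comp_inr]
  split_ifs with hc
  · rw [Finset.sum_eq_zero (s := (Finset.univ : Finset (Fin n))) fun x _ => if_neg (by omega),
      add_zero, auxBlock, Finset.card_filter]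
  · rw [Finset.sum_eq_zero (s := (Finset.univ : Finset (Fin (P.numAux n)))) fun y _ => if_neg (by
      have := comp_inl_lt y
      omega), zero_add, itemBlock, Finset.card_filter]
    exact Finset.sum_congr rfl fun x _ => if_congr (by omega) rfl rfl

theorem auxOnes_mul_le (hℓ : 0 < P.ℓ) (hN : 0 < P.compSize n) (k : ℕ) {c : ℕ}
    (hc : c < P.s - 1) :
    (P.auxOnes k : ℝ) * ((auxBlock n P c).card / P.numAux n) ≤ (k : ℝ) / P.ℓ + 1 := by
  have h1 : (auxBlock n P c).card = P.compSize n := by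
    have := card_compartment (n := n) (P := P) c
    rw [if_pos hc, card_compartment_aux hN hc] at this
    exact this.symm
  have hN' : (0 : ℝ) < P.compSize n := by exact_mod_cast hN
  have hℓ' : (0 : ℝ) < P.ℓ := by exact_mod_cast hℓ
  have hs1 : (1 : ℝ) ≤ (P.s - 1 : ℕ) := by exact_mod_cast (by omega : 1 ≤ P.s - 1)
  have h2 : ((auxBlock n P c).card : ℝ) / P.numAux n = 1 / (P.s - 1 : ℕ) := by
    rw [h1, Params.numAux, Nat.cast_mul]
    field_simp
  have h3 : (P.auxOnes k : ℝ) ≤ (P.s - 1 : ℕ) * (k / P.ℓ) + 1 := by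
    have h4 : (P.auxOnes k : ℝ) ≤ (((P.s - 1) * k + P.ℓ - 1 : ℕ) : ℝ) / P.ℓ := Nat.cast_div_le
    have h5 : (((P.s - 1) * k + P.ℓ - 1 : ℕ) : ℝ) ≤ (P.s - 1 : ℕ) * k + P.ℓ := by
      have : (P.s - 1) * k + P.ℓ - 1 ≤ (P.s - 1) * k + P.ℓ := Nat.sub_le _ _
      exact_mod_cast this
    calc _ ≤ _ := h4
      _ ≤ ((P.s - 1 : ℕ) * k + P.ℓ : ℝ) / P.ℓ := by gcongr
      _ = _ := by field_simp
  rw [h2, mul_one_div, div_le_iff₀ (by linarith)]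
  have : (0 : ℝ) ≤ k / P.ℓ := by positivity
  nlinarith

theorem mul_card_itemBlock_le (hℓ : 0 < P.ℓ) {k : ℕ} (hn : 0 < n) (hkn : k ≤ n) {i : ℕ}
    (hi : i < P.ℓ) : (k : ℝ) * ((itemBlock n P i).card / n) ≤ (k : ℝ) / P.ℓ + 1 := by
  have h1 : (itemBlock n P i).card = (n + (P.ℓ - 1) - i) / P.ℓ := by
    have := card_compartment (n := n) (P := P) (P.s - 1 + i)
    rw [if_neg (by omega), card_compartment_item hℓ hi, Nat.add_sub_cancel_left] at this
    exact this.symm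
  have hℓ' : (0 : ℝ) < P.ℓ := by exact_mod_cast hℓ
  have hn' : (0 : ℝ) < n := by exact_mod_cast hn
  have h2 : ((itemBlock n P i).card : ℝ) ≤ n / P.ℓ + 1 := by
    have h4 : ((itemBlock n P i).card : ℝ) ≤ ((n + (P.ℓ - 1) - i : ℕ) : ℝ) / P.ℓ := by
      rw [h1]; exact Nat.cast_div_le
    have h5 : ((n + (P.ℓ - 1) - i : ℕ) : ℝ) ≤ n + P.ℓ := by
      exact_mod_cast (by omega : n + (P.ℓ - 1) - i ≤ n + P.ℓ)
    calc _ ≤ _ := h4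
      _ ≤ (n + P.ℓ : ℝ) / P.ℓ := by gcongr
      _ = _ := by field_simp
  have h3 : (k : ℝ) / n ≤ 1 := (div_le_one hn').2 (by exact_mod_cast hkn)
  calc (k : ℝ) * ((itemBlock n P i).card / n) ≤ k * ((n / P.ℓ + 1) / n) := by gcongr
    _ = k / P.ℓ + k / n := by field_simp
    _ ≤ _ := by linarith

theorem exists_isCoupled (hP : P.Proper n) (hg : ∀ c < P.ring, P.g ≤ (compartment n P c).card) :
    ∃ G : Graph n P, IsCoupled G := by
  classical
  have h : (Finset.univ.filter fun G : Graph n P => IsCoupled G).Nonempty := by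
    rw [filter_isCoupled_eq]
    refine Fintype.piFinset_nonempty.2 fun b => Fintype.piFinset_nonempty.2 fun _ => ?_
    rw [← Finset.card_pos, card_poolFamily hP]
    refine Finset.prod_pos fun c _ => ?_
    rw [Finset.card_pos, traceFamily]
    split_ifs
    · exact Finset.powersetCard_nonempty.2 (hg c.val c.isLt)
    · exact Finset.singleton_nonempty _
  obtain ⟨G, hG⟩ := h
  exact ⟨G, (Finset.mem_filter.1 hG).2⟩

theorem auxOnes_le_numAux (hℓ : 0 < P.ℓ) {k : ℕ} (hkn : k ≤ n) : P.auxOnes k ≤ P.numAux n := by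
  have h : n ≤ P.ℓ * P.compSize n := by
    have h1 : P.compSize n * P.ℓ + P.ℓ > n + P.ℓ - 1 := by
      have := Nat.lt_div_mul_add (a := n + P.ℓ - 1) hℓ
      exact this
    rw [mul_comm] at h1
    omega
  refine Nat.lt_succ_iff.1 ((Nat.div_lt_iff_lt_mul hℓ).2 ?_)
  have h2 : (P.s - 1) * k ≤ (P.s - 1) * (P.ℓ * P.compSize n) := Nat.mul_le_mul_left _ (hkn.trans h)
  have h3 : (P.numAux n + 1) * P.ℓ = (P.s - 1) * (P.ℓ * P.compSize n) + P.ℓ := by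
    rw [Params.numAux]; ring
  rw [Nat.succ_eq_add_one, h3]
  omega

theorem outcomes_nonempty (hP : P.Proper n) (hg : ∀ c < P.ring, P.g ≤ (compartment n P c).card)
    {k : ℕ} (hkn : k ≤ n) : (outcomes n k P).Nonempty := by
  classical
  obtain ⟨G, hG⟩ := exists_isCoupled hP hg
  refine Finset.Nonempty.product ⟨G, by simpa using hG⟩ (Finset.Nonempty.product ?_ ?_)
  · rw [← Finset.card_pos, card_labelings]
    exact Nat.choose_pos (auxOnes_le_numAux hP.ℓ_pos hkn)
  · rw [← Finset.card_pos, card_labelings]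
    exact Nat.choose_pos hkn

theorem successProb_le_one (n k : ℕ) (P : Params) (T : ℝ) : successProb n k P T ≤ 1 := by
  refine div_le_one_of_le₀ ?_ (Nat.cast_nonneg _)
  exact_mod_cast Finset.card_filter_le _ _

/-- The leading coefficient for an item with label `label` and tilt `h`, if no compartment has
more than `κ` ones. -/
noncomputable def leadingRate (n : ℕ) (P : Params) (label h κ : ℝ) : ℝ :=
  leadingCoeff label h (meanDeg n P) (P.g / ((P.compSize n : ℝ) - 2))
    (P.g * κ / (meanDeg n P * ((P.compSize n : ℝ) - 2)))

/-- The exponential rate of the moment generating function of the score, relative to `H_s`. -/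
noncomputable def scoreRate (n : ℕ) (P : Params) (label h κ : ℝ) : ℝ :=
  leadingRate n P label h κ +
    ((P.compSize n : ℝ) / ((P.compSize n : ℝ) - 1) - 1) * |leadingRate n P label h κ| +
    (P.compSize n : ℝ) / ((P.compSize n : ℝ) - 1) * (leadingRate n P label h κ ^ 2 / meanDeg n P)

/-- Three sources of failure: a seed compartment or a bulk compartment with more than `κ` ones,
which depends on the labels alone, and, for all other labels, a score on the wrong side of the
threshold. -/
theorem one_sub_le_successProb (hP : P.Proper n) (hN : 3 ≤ P.compSize n)
    (hgN : P.g < P.compSize n) {k : ℕ} (hk : 0 < k) (hkn : k ≤ n) {a t κ h₀ h₁ A₀ A₁ : ℝ}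
    (ht : 0 ≤ t) (hh₀ : 0 ≤ h₀) (hh₁ : h₁ ≤ 0) (hD₀ : |h₀| ≤ meanDeg n P)
    (hD₁ : |h₁| ≤ meanDeg n P) (hK₀ : |leadingRate n P 0 h₀ κ| ≤ meanDeg n P)
    (hK₁ : |leadingRate n P 1 h₁ κ| ≤ meanDeg n P) (hA₀ : scoreRate n P 0 h₀ κ - h₀ * a ≤ -A₀)
    (hA₁ : scoreRate n P 1 h₁ κ - h₁ * a ≤ -A₁) :
    1 - (((P.s : ℝ) + P.ℓ) * Real.exp ((k / P.ℓ + 1) * (Real.exp t - 1) - t * κ) +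
      (n * Real.exp (-((∑ j ∈ Finset.range P.s, 1 / ((j : ℝ) + 1)) * A₀)) +
        k * Real.exp (-((∑ j ∈ Finset.range P.s, 1 / ((j : ℝ) + 1)) * A₁)))) ≤
      successProb n k P (harmonicThreshold k P a) := by
  classical
  set H := ∑ j ∈ Finset.range P.s, 1 / ((j : ℝ) + 1) with hH
  have hH0 : 0 ≤ H := Finset.sum_nonneg fun j _ => by positivity
  have hn : 0 < n := hk.trans_le hkn
  have hD : 0 < meanDeg n P := hP.meanDeg_pos
  have hμ₁ := card_auxBad_le (n := n) (P := P) (B := κ) ht k fun c hc =>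
    auxOnes_mul_le hP.ℓ_pos hP.compSize_pos k hc
  have hμ₂ := card_itemBad_le (n := n) (P := P) (B := κ) ht k fun i hi =>
    mul_card_itemBlock_le hP.ℓ_pos hn hkn hi
  have hmain := card_filter_product_le (Finset.univ.filter fun G : Graph n P => IsCoupled G)
    (Finset.univ.filter fun τ : Fin (P.numAux n) → Fin 2 => ∑ y, (τ y).val = P.auxOnes k)
    (Finset.univ.filter fun σ : Fin n → Fin 2 => ∑ x, (σ x).val = k)
    (fun ω => decode k (harmonicThreshold k P a) ω.1 ω.2.1 (results (pools ω.1) ω.2.2) ≠ ω.2.2)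
    (fun τ => ¬ ∀ c < P.s - 1, ((∑ y ∈ auxBlock n P c, (τ y).val : ℕ) : ℝ) ≤ κ)
    (fun σ => ¬ ∀ i < P.ℓ, ((∑ x ∈ itemBlock n P i, (σ x).val : ℕ) : ℝ) ≤ κ)
    (ε₁ := P.s * Real.exp ((k / P.ℓ + 1) * (Real.exp t - 1) - t * κ))
    (ε₂ := P.ℓ * Real.exp ((k / P.ℓ + 1) * (Real.exp t - 1) - t * κ))
    (ε₃ := n * Real.exp (-(H * A₀)) + k * Real.exp (-(H * A₁)))
    (by convert hμ₁) (by convert hμ₂) (by positivity) (by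
      intro τ _ σ hσ hτb hσb
      rw [not_not] at hτb hσb
      have hσk : ∑ x, (σ x).val = k := (Finset.mem_filter.1 hσ).2
      have hκ : ∀ c < P.ring,
          ((compartment n P c ∩ onesOf (trueLabels τ σ)).card : ℝ) ≤ κ := by
        intro c hc
        rw [card_compartment_inter_onesOf]
        split_ifs with hcs
        · exact hτb c hcs
        · refine hσb _ ?_
          have : c < P.ℓ + P.s - 1 := hc
          omega
      have key := card_decode_ne_le hP hk a τ σ hσk (w₀ := h₀ / meanDeg n P)
        (w₁ := h₁ / meanDeg n P) (e₀ := H * A₀) (e₁ := H * A₁)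
        (by positivity) (div_nonpos_of_nonpos_of_nonneg hh₁ hD.le) ?_ ?_
      · convert key
      · intro x hx
        have hlab : (((trueLabels τ σ (Sum.inr x)).val : ℕ) : ℝ) = 0 := by simp [trueLabels, hx]
        have := scoreExponent_le hP (trueLabels τ σ) x hD₀ hN hκ (K := leadingRate n P 0 h₀ κ)
          (by rw [hlab]; rfl) hK₀
        have h2 : h₀ / meanDeg n P * (a * H * meanDeg n P) = H * (h₀ * a) := by
          field_simp
        rw [h2]
        have h3 := mul_le_mul_of_nonneg_left hA₀ hH0
        rw [mul_sub] at h3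
        have h4 : scoreExponent (trueLabels τ σ) x (h₀ / meanDeg n P) ≤ H * scoreRate n P 0 h₀ κ :=
          this
        linarith
      · intro x hx
        have hlab : (((trueLabels τ σ (Sum.inr x)).val : ℕ) : ℝ) = 1 := by simp [trueLabels, hx]
        have := scoreExponent_le hP (trueLabels τ σ) x hD₁ hN hκ (K := leadingRate n P 1 h₁ κ)
          (by rw [hlab]; rfl) hK₁
        have h2 : h₁ / meanDeg n P * (a * H * meanDeg n P) = H * (h₁ * a) := by
          field_simp
        rw [h2]
        have h3 := mul_le_mul_of_nonneg_left hA₁ hH0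
        rw [mul_sub] at h3
        have h4 : scoreExponent (trueLabels τ σ) x (h₁ / meanDeg n P) ≤ H * scoreRate n P 1 h₁ κ :=
          this
        linarith)
  have hpos : (0 : ℝ) < (outcomes n k P).card := by
    have := outcomes_nonempty hP (fun c hc => ?_) hkn
    · exact_mod_cast this.card_pos
    · have := (card_compartment_bounds hP.ℓ_pos (n := n) hP.compSize_pos hc).1
      omega
  have hsplit := Finset.card_filter_add_card_filter_not (s := outcomes n k P)
    (fun ω : Outcome n P => decode k (harmonicThreshold k P a) ω.1 ω.2.1
      (results (pools ω.1) ω.2.2) = ω.2.2)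
  rw [successProb, le_div_iff₀ hpos]
  have hsplit' : (((outcomes n k P).filter fun ω : Outcome n P => decode k (harmonicThreshold k P a)
      ω.1 ω.2.1 (results (pools ω.1) ω.2.2) = ω.2.2).card : ℝ) +
      ((outcomes n k P).filter fun ω : Outcome n P => ¬ decode k (harmonicThreshold k P a)
      ω.1 ω.2.1 (results (pools ω.1) ω.2.2) = ω.2.2).card = (outcomes n k P).card := by
    exact_mod_cast hsplit
  have hmain' : (((outcomes n k P).filter fun ω : Outcome n P => ¬ decode k (harmonicThreshold k P a)
      ω.1 ω.2.1 (results (pools ω.1) ω.2.2) = ω.2.2).card : ℝ) ≤ (outcomes n k P).card *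
      (P.s * Real.exp ((k / P.ℓ + 1) * (Real.exp t - 1) - t * κ) +
        P.ℓ * Real.exp ((k / P.ℓ + 1) * (Real.exp t - 1) - t * κ) +
        (n * Real.exp (-(H * A₀)) + k * Real.exp (-(H * A₁)))) := by
    rw [outcomes]
    convert hmain
  have : (1 - (((P.s : ℝ) + P.ℓ) * Real.exp ((k / P.ℓ + 1) * (Real.exp t - 1) - t * κ) +
      (n * Real.exp (-(H * A₀)) + k * Real.exp (-(H * A₁))))) * (outcomes n k P).card =
      (outcomes n k P).card - (outcomes n k P).card *
      (P.s * Real.exp ((k / P.ℓ + 1) * (Real.exp t - 1) - t * κ) +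
        P.ℓ * Real.exp ((k / P.ℓ + 1) * (Real.exp t - 1) - t * κ) +
        (n * Real.exp (-(H * A₀)) + k * Real.exp (-(H * A₁)))) := by ring
  rw [this]
  linarith

end Success

/-! ### Convergence of the success probability -/

section Convergence

variable {P : ℕ → Params} {k : ℕ → ℕ}

theorem tendsto_leadingRate (hD : Tendsto (fun n => meanDeg n (P n)) atTop atTop)
    (hb : Tendsto (fun n => (P n).g / (((P n).compSize n : ℝ) - 2)) atTop (𝓝 0)) {κ : ℕ → ℝ} {v : ℝ}
    (hq : Tendsto (fun n => (P n).g * κ n / (meanDeg n (P n) * (((P n).compSize n : ℝ) - 2)))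
      atTop (𝓝 v)) (label h : ℝ) :
    Tendsto (fun n => leadingRate n (P n) label h (κ n)) atTop (𝓝 (label * h + h ^ 2 / 2 * v)) := by
  have h1 : Tendsto (fun n => |h| / meanDeg n (P n)) atTop (𝓝 0) := hD.const_div_atTop _
  have := (((hb.const_mul 2).mul_const |h|).const_add (label * h)).add
    (((h1.const_add (1 / 2)).const_mul (h ^ 2)).mul hq)
  convert this using 2
  · rw [leadingRate, leadingCoeff]
  · ring

theorem tendsto_scoreRate (hD : Tendsto (fun n => meanDeg n (P n)) atTop atTop)
    (hN : Tendsto (fun n => ((P n).compSize n : ℝ)) atTop atTop) {κ : ℕ → ℝ} {label h K : ℝ}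
    (hK : Tendsto (fun n => leadingRate n (P n) label h (κ n)) atTop (𝓝 K)) :
    Tendsto (fun n => scoreRate n (P n) label h (κ n)) atTop (𝓝 K) := by
  have hρ : Tendsto (fun n => ((P n).compSize n : ℝ) / (((P n).compSize n : ℝ) - 1)) atTop (𝓝 1) := by
    have h1 : Tendsto (fun n => 1 + 1 / (((P n).compSize n : ℝ) - 1)) atTop (𝓝 (1 + 0)) :=
      ((tendsto_atTop_add_const_right _ (-1) hN).const_div_atTop 1).const_add 1
    rw [add_zero] at h1
    refine h1.congr' ?_
    filter_upwards [hN.eventually_gt_atTop 1] with n hn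
    have : ((P n).compSize n : ℝ) - 1 ≠ 0 := by linarith
    field_simp
    ring
  have := (hK.add ((hρ.sub_const 1).mul hK.abs)).add (hρ.mul ((hK.pow 2).div_atTop hD))
  convert this using 2
  · rw [scoreRate]
  · ring

theorem tendsto_mul_exp_neg_zero {θ b : ℝ} (hb : θ < b) {f g : ℕ → ℝ} (hf₀ : ∀ n, 0 ≤ f n)
    (hf : ∀ᶠ n : ℕ in atTop, f n ≤ (n : ℝ) ^ θ) (hg : ∀ᶠ n : ℕ in atTop, b * Real.log n ≤ g n) :
    Tendsto (fun n => f n * Real.exp (-g n)) atTop (𝓝 0) := by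
  have h0 : Tendsto (fun n : ℕ => (n : ℝ) ^ (-(b - θ))) atTop (𝓝 0) :=
    (tendsto_rpow_neg_atTop (sub_pos.2 hb)).comp tendsto_natCast_atTop_atTop
  refine squeeze_zero' (Eventually.of_forall fun n => mul_nonneg (hf₀ n) (Real.exp_pos _).le) ?_ h0
  filter_upwards [hf, hg, eventually_gt_atTop 0] with n h1 h2 hn
  have hn' : (0 : ℝ) < n := by exact_mod_cast hn
  calc f n * Real.exp (-g n) ≤ (n : ℝ) ^ θ * Real.exp (Real.log n * -b) := by
        gcongr
        linarith
    _ = (n : ℝ) ^ (-(b - θ)) := by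
        rw [← Real.rpow_def_of_pos hn', ← Real.rpow_add hn']
        congr 1
        ring

/-- With `exp t - 1 ≤ t + t ^ 2` the exponent is at most `2 - t ^ 2 * r n`, and `r n` grows faster
than `log n`, so any relative excess `2 * t > 0` is improbable in all compartments at once. -/
theorem tendsto_labelTail {r f : ℕ → ℝ} (hr : Tendsto (fun n : ℕ => Real.log n / r n) atTop (𝓝 0))
    (hr₀ : ∀ᶠ n in atTop, 0 < r n) (hf₀ : ∀ n, 0 ≤ f n) (hf : ∀ᶠ n : ℕ in atTop, f n ≤ 2 * n)
    {t : ℝ} (ht₀ : 0 < t) (ht₁ : t ≤ 1) :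
    Tendsto (fun n => f n * Real.exp ((r n + 1) * (Real.exp t - 1) - t * ((1 + 2 * t) * r n)))
      atTop (𝓝 0) := by
  have h1 : Tendsto (fun n => f n / 2 * Real.exp (-(t ^ 2 * r n))) atTop (𝓝 0) := by
    refine tendsto_mul_exp_neg_zero (θ := 1) (b := 2) (by norm_num)
      (fun n => div_nonneg (hf₀ n) (by norm_num)) ?_ ?_
    · filter_upwards [hf] with n hn
      rw [Real.rpow_one]
      linarith
    · filter_upwards [hr₀, hr.eventually_lt_const (by positivity : 0 < t ^ 2 / 2)] with n h0 h2
      rw [div_lt_iff₀ h0] at h2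
      linarith
  have h2 := h1.const_mul (2 * Real.exp 2)
  rw [mul_zero] at h2
  refine squeeze_zero' (Eventually.of_forall fun n => mul_nonneg (hf₀ n) (Real.exp_pos _).le) ?_ h2
  filter_upwards [hr₀] with n h0
  have h3 : Real.exp t - 1 ≤ t + t ^ 2 := exp_sub_one_le (by rwa [abs_of_pos ht₀])
  have h4 : (r n + 1) * (Real.exp t - 1) - t * ((1 + 2 * t) * r n) ≤ 2 + -(t ^ 2 * r n) := by
    have := mul_le_mul_of_nonneg_left h3 (by linarith : 0 ≤ r n + 1)
    nlinarith
  calc _ ≤ f n * Real.exp (2 + -(t ^ 2 * r n)) :=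
        mul_le_mul_of_nonneg_left (Real.exp_le_exp.2 h4) (hf₀ n)
    _ = _ := by rw [Real.exp_add]; ring

theorem tendsto_successProb {θ c α : ℝ} (hθ : 0 < θ) (hc : 0 < c) (hα₀ : 0 < α) (hα₁ : α < 1)
    (hcα : 1 / θ < α ^ 2 * c / 2) (hcα' : 1 < (1 - α) ^ 2 * c / 2)
    (hP : ∀ᶠ n in atTop, (P n).Proper n) (hgN : ∀ᶠ n in atTop, (P n).g < (P n).compSize n)
    (hℓn : ∀ᶠ n in atTop, (P n).ℓ ≤ n) (hk : ∀ᶠ n in atTop, 0 < k n) (hkn : ∀ᶠ n in atTop, k n ≤ n)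
    (hkθ : ∀ᶠ n : ℕ in atTop, (k n : ℝ) ≤ (n : ℝ) ^ θ)
    (hN : Tendsto (fun n => ((P n).compSize n : ℝ)) atTop atTop)
    (hD : Tendsto (fun n => meanDeg n (P n)) atTop atTop)
    (hb : Tendsto (fun n => (P n).g / (((P n).compSize n : ℝ) - 2)) atTop (𝓝 0))
    (hq : Tendsto (fun n => (P n).g * ((k n : ℝ) / (P n).ℓ) /
      (meanDeg n (P n) * (((P n).compSize n : ℝ) - 2))) atTop (𝓝 (1 / c)))
    (hr : Tendsto (fun n : ℕ => Real.log n / ((k n : ℝ) / (P n).ℓ)) atTop (𝓝 0))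
    (hH : ∀ η < θ, ∀ᶠ n : ℕ in atTop,
      η * Real.log n ≤ ∑ j ∈ Finset.range (P n).s, 1 / ((j : ℝ) + 1)) :
    Tendsto (fun n => successProb n (k n) (P n) (harmonicThreshold (k n) (P n) α)) atTop (𝓝 1) := by
  have hθ' : 0 < 1 / θ := by positivity
  obtain ⟨A₀, hA₀, hA₀'⟩ := exists_between hcα
  obtain ⟨A₁, hA₁, hA₁'⟩ := exists_between hcα'
  have hA₀pos : 0 < A₀ := hθ'.trans hA₀
  have hA₁pos : 0 < A₁ := one_pos.trans hA₁
  -- Strictness leaves room for a lower bound `η log n` on the harmonic number: `1 < η * A₀` beats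
  -- the `n` items and `θ < η * A₁` beats the `n ^ θ` ones.
  obtain ⟨η, hη, hηθ⟩ : ∃ η, max (1 / A₀) (θ / A₁) < η ∧ η < θ := by
    refine exists_between (max_lt ?_ ?_)
    · exact (one_div_lt hA₀pos hθ).2 hA₀
    · exact div_lt_self hθ hA₁
  have hη₀ : 1 < η * A₀ := (div_lt_iff₀ hA₀pos).1 ((le_max_left _ _).trans_lt hη)
  have hη₁ : θ < η * A₁ := (div_lt_iff₀ hA₁pos).1 ((le_max_right _ _).trans_lt hη)
  have hM₀ : 0 < α ^ 2 * c / 2 := hA₀pos.trans hA₀'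
  have hM₁ : 0 < (1 - α) ^ 2 * c / 2 := hA₁pos.trans hA₁'
  obtain ⟨ξ, hξ, hξ1⟩ : ∃ ξ, max (A₀ / (α ^ 2 * c / 2)) (A₁ / ((1 - α) ^ 2 * c / 2)) < ξ ∧ ξ < 1 :=
    exists_between (max_lt ((div_lt_one hM₀).2 hA₀') ((div_lt_one hM₁).2 hA₁'))
  have hξ₀ : A₀ < ξ * (α ^ 2 * c / 2) := (div_lt_iff₀ hM₀).1 ((le_max_left _ _).trans_lt hξ)
  have hξ₁ : A₁ < ξ * ((1 - α) ^ 2 * c / 2) := (div_lt_iff₀ hM₁).1 ((le_max_right _ _).trans_lt hξ)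
  have hξpos : 0 < ξ := lt_trans (by positivity) ((le_max_left _ _).trans_lt hξ)
  -- Chosen so that `1 + 2 * t = 2 - ξ`: with this excess of ones the optimal rates shrink exactly
  -- by the factor `ξ`, which keeps them above `A₀` and `A₁`.
  set t := (1 - ξ) / 2 with ht
  have ht₀ : 0 < t := by linarith
  have ht₁ : t ≤ 1 := by linarith
  set κ : ℕ → ℝ := fun n => (1 + 2 * t) * ((k n : ℝ) / (P n).ℓ) with hκ
  have hq' : Tendsto (fun n => (P n).g * κ n / (meanDeg n (P n) * (((P n).compSize n : ℝ) - 2)))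
      atTop (𝓝 ((1 + 2 * t) * (1 / c))) := by
    refine (hq.const_mul (1 + 2 * t)).congr fun n => ?_
    rw [hκ]
    ring
  -- The tilts `α c` and `-(1 - α) c` minimise `h² / (2 c) - h α` and `h + h² / (2 c) - h α`.
  have hK₀ := tendsto_leadingRate hD hb hq' 0 (α * c)
  have hK₁ := tendsto_leadingRate hD hb hq' 1 (-((1 - α) * c))
  have hR₀ := (tendsto_scoreRate hD hN hK₀).sub_const (α * c * α)
  have hR₁ := (tendsto_scoreRate hD hN hK₁).sub_const (-((1 - α) * c) * α)
  have hv₀ : 0 * (α * c) + (α * c) ^ 2 / 2 * ((1 + 2 * t) * (1 / c)) - α * c * α < -A₀ := by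
    have : 0 * (α * c) + (α * c) ^ 2 / 2 * ((1 + 2 * t) * (1 / c)) - α * c * α =
        -(ξ * (α ^ 2 * c / 2)) := by
      rw [ht]; field_simp; ring
    linarith
  have hv₁ : 1 * -((1 - α) * c) + (-((1 - α) * c)) ^ 2 / 2 * ((1 + 2 * t) * (1 / c)) -
      -((1 - α) * c) * α < -A₁ := by
    have : 1 * -((1 - α) * c) + (-((1 - α) * c)) ^ 2 / 2 * ((1 + 2 * t) * (1 / c)) -
        -((1 - α) * c) * α = -(ξ * ((1 - α) ^ 2 * c / 2)) := by
      rw [ht]; field_simp; ring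
    linarith
  have hle : ∀ {f : ℕ → ℝ} {K : ℝ}, Tendsto f atTop (𝓝 K) →
      ∀ᶠ n in atTop, |f n| ≤ meanDeg n (P n) := by
    intro f K hf
    filter_upwards [hf.abs.eventually_lt_const (lt_add_one |K|), hD.eventually_ge_atTop (|K| + 1)]
      with n h1 h2
    exact h1.le.trans h2
  have hHA : ∀ {A : ℝ}, 0 < A → ∀ᶠ n : ℕ in atTop, η * A * Real.log n ≤
      (∑ j ∈ Finset.range (P n).s, 1 / ((j : ℝ) + 1)) * A := by
    intro A hA
    filter_upwards [hH η hηθ] with n hn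
    have := mul_le_mul_of_nonneg_right hn hA.le
    linarith
  have e₁ : Tendsto (fun n : ℕ => (n : ℝ) *
      Real.exp (-((∑ j ∈ Finset.range (P n).s, 1 / ((j : ℝ) + 1)) * A₀))) atTop (𝓝 0) :=
    tendsto_mul_exp_neg_zero hη₀ (fun n => Nat.cast_nonneg _)
      (Eventually.of_forall fun n => (Real.rpow_one _).ge) (hHA hA₀pos)
  have e₂ : Tendsto (fun n : ℕ => (k n : ℝ) *
      Real.exp (-((∑ j ∈ Finset.range (P n).s, 1 / ((j : ℝ) + 1)) * A₁))) atTop (𝓝 0) :=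
    tendsto_mul_exp_neg_zero hη₁ (fun n => Nat.cast_nonneg _) hkθ (hHA hA₁pos)
  have e₃ := tendsto_labelTail (f := fun n => ((P n).s : ℝ) + (P n).ℓ) hr
    (by
      filter_upwards [hk, hP] with n h1 h2
      have h3 : (0 : ℝ) < k n := by exact_mod_cast h1
      have h4 : (0 : ℝ) < (P n).ℓ := by exact_mod_cast h2.ℓ_pos
      positivity)
    (fun n => by positivity)
    (by
      filter_upwards [hℓn, hP] with n h1 h2
      have h3 : ((P n).ℓ : ℝ) ≤ n := by exact_mod_cast h1
      have h4 : ((P n).s : ℝ) ≤ n := by exact_mod_cast h2.s_le_n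
      linarith) ht₀ ht₁
  have hlow := (e₃.add (e₁.add e₂)).const_sub 1
  simp only [add_zero, sub_zero] at hlow
  refine tendsto_of_tendsto_of_tendsto_of_le_of_le' hlow tendsto_const_nhds ?_
    (Eventually.of_forall fun n => successProb_le_one _ _ _ _)
  filter_upwards [hP, hgN, hk, hkn, hN.eventually_ge_atTop 3, hle hK₀, hle hK₁,
    hle (tendsto_const_nhds (x := α * c)), hle (tendsto_const_nhds (x := -((1 - α) * c))),
    hR₀.eventually_lt_const hv₀, hR₁.eventually_lt_const hv₁] with n a1 a2 a3 a4 a5 a6 a7 a8 a9 b1 b2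
  exact one_sub_le_successProb a1 (by exact_mod_cast a5) a2 a3 a4 ht₀.le (by positivity)
    (neg_nonpos.2 (mul_nonneg (by linarith) hc.le)) a8 a9 a6 a7 b1.le b2.le

end Convergence

/-! ### The choice of the parameters -/

/-- `⌊log n⌋`. -/
noncomputable def logFloor (n : ℕ) : ℕ := ⌊Real.log n⌋₊

/-- The parameters `ℓ ≈ k / log² n`, `s ≈ k / log³ n`, `g ≈ (n / ℓ) / log n`, `p ≈ c k / ℓ`. -/
noncomputable def designParams (θ c : ℝ) (n : ℕ) : Params where
  ℓ := numOnes θ n / logFloor n ^ 2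
  s := numOnes θ n / logFloor n ^ 2 / logFloor n
  g := (n + numOnes θ n / logFloor n ^ 2 - 1) / (numOnes θ n / logFloor n ^ 2) / logFloor n
  p := ⌊c * numOnes θ n / ((numOnes θ n / logFloor n ^ 2 +
    numOnes θ n / logFloor n ^ 2 / logFloor n - 1 : ℕ) : ℝ)⌋₊

/-! ### Asymptotics of the parameters -/

section Growth

variable {θ c : ℝ}

theorem tendsto_log_natCast : Tendsto (fun n : ℕ => Real.log n) atTop atTop :=
  Real.tendsto_log_atTop.comp tendsto_natCast_atTop_atTop

theorem tendsto_logFloor : Tendsto (fun n => (logFloor n : ℝ)) atTop atTop :=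
  tendsto_natCast_atTop_atTop.comp (tendsto_nat_floor_atTop.comp tendsto_log_natCast)

theorem tendsto_log_div_logFloor :
    Tendsto (fun n : ℕ => Real.log n / logFloor n) atTop (𝓝 1) := by
  have := (tendsto_nat_floor_div_atTop (R := ℝ)).comp tendsto_log_natCast
  have := this.inv₀ one_ne_zero
  rw [inv_one] at this
  exact this.congr fun n => inv_div _ _

theorem numOnes_le_rpow (n : ℕ) : (numOnes θ n : ℝ) ≤ (n : ℝ) ^ θ :=
  Nat.floor_le (by positivity)

theorem numOnes_le (hθ₁ : θ ≤ 1) {n : ℕ} (hn : 0 < n) : numOnes θ n ≤ n := by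
  have h1 : (n : ℝ) ^ θ ≤ (n : ℝ) ^ (1 : ℝ) :=
    Real.rpow_le_rpow_of_exponent_le (by exact_mod_cast hn) hθ₁
  rw [Real.rpow_one] at h1
  exact_mod_cast (numOnes_le_rpow n).trans h1

/-- Rounding costs at most a factor two and the logarithms are of lower order than `n ^ (θ - η)`.
Since `s` is this quotient rounded down, its logarithm is asymptotically not less than `θ log n`. -/
theorem eventually_rpow_le_numOnes_div (hθ₀ : 0 < θ) {η : ℝ} (hη : η < θ) {M : ℝ} (hM : 0 < M) :
    ∀ᶠ n : ℕ in atTop, M * (n : ℝ) ^ η ≤ numOnes θ n / (logFloor n : ℝ) ^ 3 := by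
  have h1 : Tendsto (fun n : ℕ => (n : ℝ) ^ θ) atTop atTop :=
    (tendsto_rpow_atTop hθ₀).comp tendsto_natCast_atTop_atTop
  have h2 : ∀ᶠ n : ℕ in atTop, (1 / 2 : ℝ) < numOnes θ n / (n : ℝ) ^ θ :=
    ((tendsto_nat_floor_div_atTop (R := ℝ)).comp h1).eventually_const_lt (by norm_num)
  have h3 := ((isLittleO_log_rpow_rpow_atTop 3 (sub_pos.2 hη)).comp_tendsto
    tendsto_natCast_atTop_atTop).def (by positivity : 0 < 1 / (2 * M))
  filter_upwards [h2, h3, h1.eventually_gt_atTop 0, tendsto_logFloor.eventually_gt_atTop 0,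
    tendsto_log_natCast.eventually_gt_atTop 0, eventually_gt_atTop 0] with n a1 a2 a3 a4 a5 hn
  have hn' : (0 : ℝ) < n := by exact_mod_cast hn
  have a6 : (logFloor n : ℝ) ≤ Real.log n := Nat.floor_le a5.le
  simp only [Function.comp_apply] at a2
  rw [Real.norm_of_nonneg (by positivity), Real.norm_of_nonneg (by positivity),
    show (3 : ℝ) = ((3 : ℕ) : ℝ) by norm_num, Real.rpow_natCast] at a2
  have a7 : (logFloor n : ℝ) ^ 3 ≤ Real.log n ^ 3 := by gcongr
  rw [lt_div_iff₀ a3] at a1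
  rw [le_div_iff₀ (by positivity)]
  calc M * (n : ℝ) ^ η * (logFloor n : ℝ) ^ 3
      ≤ M * (n : ℝ) ^ η * (1 / (2 * M) * (n : ℝ) ^ (θ - η)) := by
        gcongr
        exact a7.trans a2
    _ = 1 / 2 * ((n : ℝ) ^ η * (n : ℝ) ^ (θ - η)) := by field_simp
    _ = 1 / 2 * (n : ℝ) ^ θ := by rw [← Real.rpow_add hn']; congr 2; ring
    _ ≤ _ := a1.le

theorem designParams_s (n : ℕ) : (designParams θ c n).s = ⌊(numOnes θ n : ℝ) / (logFloor n : ℝ) ^ 3⌋₊ := by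
  have h1 : (logFloor n : ℝ) ^ 3 = ((logFloor n ^ 3 : ℕ) : ℝ) := by push_cast; rfl
  rw [h1, Nat.floor_div_natCast, Nat.floor_natCast]
  show numOnes θ n / logFloor n ^ 2 / logFloor n = _
  rw [Nat.div_div_eq_div_mul, ← pow_succ]

theorem tendsto_numOnes_div (hθ₀ : 0 < θ) :
    Tendsto (fun n => (numOnes θ n : ℝ) / (logFloor n : ℝ) ^ 3) atTop atTop := by
  refine tendsto_atTop.2 fun b => ?_
  filter_upwards [eventually_rpow_le_numOnes_div hθ₀ hθ₀ (M := max b 1) (by positivity)] with n hn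
  rw [Real.rpow_zero, mul_one] at hn
  exact (le_max_left _ _).trans hn

theorem tendsto_designParams_s (hθ₀ : 0 < θ) :
    Tendsto (fun n => (designParams θ c n).s) atTop atTop := by
  simp only [designParams_s]
  exact tendsto_nat_floor_atTop.comp (tendsto_numOnes_div hθ₀)

theorem designParams_s_le_ℓ (n : ℕ) : (designParams θ c n).s ≤ (designParams θ c n).ℓ :=
  Nat.div_le_self _ _

theorem designParams_s_mul_le (n : ℕ) :
    (designParams θ c n).s * logFloor n ≤ (designParams θ c n).ℓ := Nat.div_mul_le_self _ _

theorem designParams_ℓ_mul_le (n : ℕ) :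
    (designParams θ c n).ℓ * logFloor n ^ 2 ≤ numOnes θ n := Nat.div_mul_le_self _ _

theorem designParams_ℓ_le (n : ℕ) : (designParams θ c n).ℓ ≤ numOnes θ n := Nat.div_le_self _ _

theorem designParams_g (n : ℕ) :
    (designParams θ c n).g = ⌊((designParams θ c n).compSize n : ℝ) / logFloor n⌋₊ := by
  rw [Nat.floor_div_natCast, Nat.floor_natCast]
  rfl

theorem designParams_p (n : ℕ) :
    (designParams θ c n).p = ⌊c * numOnes θ n / ((designParams θ c n).ring : ℝ)⌋₊ := rfl

theorem tendsto_designParams_ℓ (hθ₀ : 0 < θ) :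
    Tendsto (fun n => (designParams θ c n).ℓ) atTop atTop :=
  tendsto_atTop_mono (fun n => designParams_s_le_ℓ n) (tendsto_designParams_s hθ₀)

theorem eventually_sq_le (hθ₀ : 0 < θ) : ∀ᶠ n in atTop,
    (logFloor n : ℝ) ^ 2 ≤ (numOnes θ n : ℝ) / (designParams θ c n).ℓ := by
  filter_upwards [(tendsto_designParams_ℓ (c := c) hθ₀).eventually_gt_atTop 0] with n h
  rw [le_div_iff₀ (by exact_mod_cast h), mul_comm]
  exact_mod_cast designParams_ℓ_mul_le n

theorem tendsto_div_logFloor (hθ₀ : 0 < θ) : Tendsto (fun n =>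
    (numOnes θ n : ℝ) / (designParams θ c n).ℓ / logFloor n) atTop atTop := by
  refine tendsto_atTop_mono' _ ?_ tendsto_logFloor
  filter_upwards [eventually_sq_le (c := c) hθ₀, tendsto_logFloor.eventually_gt_atTop 0] with n h1 h2
  rw [le_div_iff₀ h2]
  nlinarith

theorem tendsto_numOnes_div_ℓ (hθ₀ : 0 < θ) : Tendsto (fun n =>
    (numOnes θ n : ℝ) / (designParams θ c n).ℓ) atTop atTop := by
  refine tendsto_atTop_mono' _ ?_ (tendsto_div_logFloor (c := c) hθ₀)
  filter_upwards [tendsto_logFloor.eventually_ge_atTop 1] with n h1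
  exact div_le_self (by positivity) h1

theorem tendsto_s_div_ℓ (hθ₀ : 0 < θ) : Tendsto (fun n =>
    ((designParams θ c n).s : ℝ) / (designParams θ c n).ℓ) atTop (𝓝 0) := by
  refine squeeze_zero' (Eventually.of_forall fun n => by positivity) ?_
    (tendsto_logFloor.const_div_atTop 1)
  filter_upwards [(tendsto_designParams_ℓ (c := c) hθ₀).eventually_gt_atTop 0,
    tendsto_logFloor.eventually_gt_atTop 0] with n h1 h2
  rw [div_le_div_iff₀ (by exact_mod_cast h1) h2, one_mul]
  exact_mod_cast designParams_s_mul_le n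

theorem tendsto_ring_div_ℓ (hθ₀ : 0 < θ) : Tendsto (fun n =>
    ((designParams θ c n).ring : ℝ) / (designParams θ c n).ℓ) atTop (𝓝 1) := by
  have h1 : Tendsto (fun n => ((designParams θ c n).ℓ : ℝ)) atTop atTop :=
    tendsto_natCast_atTop_atTop.comp (tendsto_designParams_ℓ hθ₀)
  have h2 := ((tendsto_s_div_ℓ (c := c) hθ₀).const_add 1).sub (h1.const_div_atTop 1)
  rw [add_zero, sub_zero] at h2
  refine h2.congr' ?_
  filter_upwards [h1.eventually_gt_atTop 0,
    (tendsto_designParams_s (c := c) hθ₀).eventually_gt_atTop 0] with n h3 h4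
  have h5 : ((designParams θ c n).ring : ℝ) = (designParams θ c n).ℓ + (designParams θ c n).s - 1 := by
    rw [Params.ring, Nat.cast_sub (by omega)]
    push_cast
    rfl
  rw [h5]
  field_simp

theorem tendsto_p_ratio (hθ₀ : 0 < θ) (hc : 0 < c) :
    Tendsto (fun n => c * numOnes θ n / ((designParams θ c n).ring : ℝ)) atTop atTop ∧
    Tendsto (fun n => ((designParams θ c n).p : ℝ) /
      (c * numOnes θ n / ((designParams θ c n).ring : ℝ))) atTop (𝓝 1) := by
  have h1 : Tendsto (fun n => c * numOnes θ n / ((designParams θ c n).ring : ℝ)) atTop atTop := by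
    have h2 := (tendsto_numOnes_div_ℓ (c := c) hθ₀).const_mul_atTop hc |>.atTop_mul_pos one_pos
      (by simpa using (tendsto_ring_div_ℓ (c := c) hθ₀).inv₀ one_ne_zero)
    refine h2.congr' ?_
    filter_upwards [(tendsto_designParams_ℓ (c := c) hθ₀).eventually_gt_atTop 0] with n h3
    have : ((designParams θ c n).ℓ : ℝ) ≠ 0 := by positivity
    field_simp
  exact ⟨h1, (tendsto_nat_floor_div_atTop (R := ℝ)).comp h1⟩

/-- As `s = o(ℓ)`, the ring has `(1 + o(1)) ℓ` compartments, and the additional pools around the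
seed do not affect the constant. -/
theorem tendsto_p_mul_ℓ_div (hθ₀ : 0 < θ) (hc : 0 < c) : Tendsto (fun n =>
    ((designParams θ c n).p : ℝ) * (designParams θ c n).ℓ / numOnes θ n) atTop (𝓝 c) := by
  have h1 := ((tendsto_p_ratio hθ₀ hc).2.const_mul c).div (tendsto_ring_div_ℓ (c := c) hθ₀)
    one_ne_zero
  rw [mul_one, div_one] at h1
  refine h1.congr' ?_
  filter_upwards [(tendsto_designParams_ℓ (c := c) hθ₀).eventually_gt_atTop 0,
    (tendsto_designParams_s (c := c) hθ₀).eventually_gt_atTop 0] with n h2 h3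
  have h5 : 0 < (designParams θ c n).ring := by
    rw [Params.ring]; omega
  have h6 : 0 < numOnes θ n := h2.trans_le (designParams_ℓ_le n)
  have a1 : ((designParams θ c n).ℓ : ℝ) ≠ 0 := by positivity
  have a2 : ((designParams θ c n).ring : ℝ) ≠ 0 := by positivity
  have a3 : (numOnes θ n : ℝ) ≠ 0 := by positivity
  simp only [Pi.div_apply]
  field_simp

theorem eventually_div_le_compSize (hθ₀ : 0 < θ) (hθ₁ : θ < 1) : ∀ᶠ n in atTop,
    (numOnes θ n : ℝ) / (designParams θ c n).ℓ ≤ (designParams θ c n).compSize n := by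
  filter_upwards [(tendsto_designParams_ℓ (c := c) hθ₀).eventually_gt_atTop 0,
    eventually_gt_atTop 0] with n h1 hn
  rw [div_le_iff₀ (by exact_mod_cast h1)]
  have h2 : n ≤ (designParams θ c n).compSize n * (designParams θ c n).ℓ := by
    have := Nat.lt_div_mul_add (a := n + (designParams θ c n).ℓ - 1) h1
    have h3 : (designParams θ c n).compSize n =
      (n + (designParams θ c n).ℓ - 1) / (designParams θ c n).ℓ := rfl
    rw [← h3] at this
    omega
  exact_mod_cast (numOnes_le hθ₁.le hn).trans h2

theorem tendsto_compSize (hθ₀ : 0 < θ) (hθ₁ : θ < 1) : Tendsto (fun n =>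
    ((designParams θ c n).compSize n : ℝ)) atTop atTop :=
  tendsto_atTop_mono' _ (eventually_div_le_compSize hθ₀ hθ₁) (tendsto_numOnes_div_ℓ hθ₀)

theorem tendsto_compSize_div (hθ₀ : 0 < θ) (hθ₁ : θ < 1) : Tendsto (fun n =>
    ((designParams θ c n).compSize n : ℝ) / (((designParams θ c n).compSize n : ℝ) - 2))
    atTop (𝓝 1) := by
  have hN := tendsto_compSize (c := c) hθ₀ hθ₁
  have h1 : Tendsto (fun n => 1 + 2 / (((designParams θ c n).compSize n : ℝ) - 2)) atTop (𝓝 (1 + 0)) :=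
    ((tendsto_atTop_add_const_right _ (-2) hN).const_div_atTop 2).const_add 1
  rw [add_zero] at h1
  refine h1.congr' ?_
  filter_upwards [hN.eventually_gt_atTop 2] with n hn
  have : ((designParams θ c n).compSize n : ℝ) - 2 ≠ 0 := by linarith
  field_simp
  ring

theorem tendsto_g_ratio (hθ₀ : 0 < θ) (hθ₁ : θ < 1) : Tendsto (fun n =>
    ((designParams θ c n).g : ℝ) / (((designParams θ c n).compSize n : ℝ) / logFloor n))
    atTop (𝓝 1) := by
  simp only [designParams_g]
  refine (tendsto_nat_floor_div_atTop (R := ℝ)).comp ?_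
  refine tendsto_atTop_mono' _ ?_ (tendsto_div_logFloor (c := c) hθ₀)
  filter_upwards [eventually_div_le_compSize (c := c) hθ₀ hθ₁] with n h
  gcongr

theorem eventually_pos (hθ₀ : 0 < θ) (hθ₁ : θ < 1) (hc : 0 < c) : ∀ᶠ n in atTop,
    2 ≤ logFloor n ∧ 0 < numOnes θ n ∧ 0 < (designParams θ c n).ℓ ∧ 2 ≤ (designParams θ c n).s ∧
      0 < (designParams θ c n).p ∧ 3 ≤ (designParams θ c n).compSize n ∧
      logFloor n ≤ (designParams θ c n).compSize n ∧ 0 < n := by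
  have h1 : Tendsto (fun n => (designParams θ c n).p) atTop atTop := by
    simp only [designParams_p]
    exact tendsto_nat_floor_atTop.comp (tendsto_p_ratio hθ₀ hc).1
  filter_upwards [h1.eventually_gt_atTop 0, (tendsto_designParams_ℓ (c := c) hθ₀).eventually_gt_atTop 0,
    (tendsto_designParams_s (c := c) hθ₀).eventually_ge_atTop 2,
    (tendsto_compSize (c := c) hθ₀ hθ₁).eventually_ge_atTop 3,
    tendsto_logFloor.eventually_ge_atTop 2, eventually_gt_atTop 0, eventually_sq_le (c := c) hθ₀,
    eventually_div_le_compSize (c := c) hθ₀ hθ₁] with n a1 a2 a3 a4 a5 a6 a7 a8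
  refine ⟨by exact_mod_cast a5, a2.trans_le (designParams_ℓ_le n), a2, a3, a1, by exact_mod_cast a4,
    ?_, a6⟩
  have : (logFloor n : ℝ) ≤ (designParams θ c n).compSize n := by nlinarith
  exact_mod_cast this

/-- The degree is about `c * (k / ℓ) / log n`, and `k / ℓ` is at least of order `log² n`. A window
length or compartment count closer to `k` would destroy this. -/
theorem tendsto_meanDeg (hθ₀ : 0 < θ) (hθ₁ : θ < 1) (hc : 0 < c) :
    Tendsto (fun n => meanDeg n (designParams θ c n)) atTop atTop := by
  have h := ((tendsto_div_logFloor (c := c) hθ₀).atTop_mul_pos hc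
    (tendsto_p_mul_ℓ_div hθ₀ hc)).atTop_mul_pos one_pos (tendsto_g_ratio (c := c) hθ₀ hθ₁)
  refine h.congr' ?_
  filter_upwards [eventually_pos hθ₀ hθ₁ hc] with n ⟨a1, a2, a3, a4, a5, a6, a7, a8⟩
  have b1 : (numOnes θ n : ℝ) ≠ 0 := by positivity
  have b2 : ((designParams θ c n).ℓ : ℝ) ≠ 0 := by positivity
  have b3 : (logFloor n : ℝ) ≠ 0 := by positivity
  have b4 : ((designParams θ c n).compSize n : ℝ) ≠ 0 := by positivity
  rw [meanDeg]
  field_simp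

theorem tendsto_g_div (hθ₀ : 0 < θ) (hθ₁ : θ < 1) (hc : 0 < c) : Tendsto (fun n =>
    ((designParams θ c n).g : ℝ) / (((designParams θ c n).compSize n : ℝ) - 2)) atTop (𝓝 0) := by
  have h := ((tendsto_g_ratio (c := c) hθ₀ hθ₁).mul (tendsto_compSize_div (c := c) hθ₀ hθ₁)).mul
    (tendsto_logFloor.const_div_atTop 1)
  rw [mul_zero] at h
  refine h.congr' ?_
  filter_upwards [eventually_pos hθ₀ hθ₁ hc] with n ⟨a1, a2, a3, a4, a5, a6, a7, a8⟩
  have b3 : (logFloor n : ℝ) ≠ 0 := by positivity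
  have b4 : ((designParams θ c n).compSize n : ℝ) ≠ 0 := by positivity
  have b5 : ((designParams θ c n).compSize n : ℝ) - 2 ≠ 0 := by
    have : (3 : ℝ) ≤ (designParams θ c n).compSize n := by exact_mod_cast a6
    linarith
  field_simp

theorem designParams_proper (hθ₀ : 0 < θ) (hθ₁ : θ < 1) (hc : 0 < c) :
    ∀ᶠ n in atTop, (designParams θ c n).Proper n := by
  filter_upwards [eventually_pos hθ₀ hθ₁ hc] with n ⟨a1, a2, a3, a4, a5, a6, a7, a8⟩
  have hk := numOnes_le hθ₁.le a8
  have hℓ := designParams_ℓ_le (θ := θ) (c := c) n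
  have hs := designParams_s_le_ℓ (θ := θ) (c := c) n
  refine ⟨by omega, by omega, Nat.div_pos a7 (by omega), a5, a3, fun d hd => ?_, fun d hd => ?_⟩
  · have := (card_compartment_bounds a3 (n := n) (by omega) hd).1
    omega
  · refine (card_compartment_bounds a3 (n := n) (by omega) hd).2.trans ?_
    refine Nat.lt_succ_iff.1 ((Nat.div_lt_iff_lt_mul a3).2 ?_)
    have : n * 1 ≤ n * (designParams θ c n).ℓ := Nat.mul_le_mul_left _ a3
    rw [Nat.succ_mul]
    omega

/-- The pool size `g` cancels against the mean degree, and `k / (p ℓ)` remains. The constant `c`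
enters the exponents only through this limit. -/
theorem tendsto_variance (hθ₀ : 0 < θ) (hθ₁ : θ < 1) (hc : 0 < c) : Tendsto (fun n =>
    ((designParams θ c n).g : ℝ) * ((numOnes θ n : ℝ) / (designParams θ c n).ℓ) /
      (meanDeg n (designParams θ c n) * (((designParams θ c n).compSize n : ℝ) - 2)))
    atTop (𝓝 (1 / c)) := by
  have h := ((tendsto_p_mul_ℓ_div hθ₀ hc).inv₀ hc.ne').mul (tendsto_compSize_div (c := c) hθ₀ hθ₁)
  rw [mul_one, ← one_div] at h
  refine h.congr' ?_
  filter_upwards [eventually_pos hθ₀ hθ₁ hc, designParams_proper hθ₀ hθ₁ hc]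
    with n ⟨a1, a2, a3, a4, a5, a6, a7, a8⟩ hP
  have b1 : (numOnes θ n : ℝ) ≠ 0 := by positivity
  have b2 : ((designParams θ c n).ℓ : ℝ) ≠ 0 := by positivity
  have b3 : ((designParams θ c n).p : ℝ) ≠ 0 := by positivity
  have b4 : ((designParams θ c n).compSize n : ℝ) ≠ 0 := by positivity
  have b5 : ((designParams θ c n).compSize n : ℝ) - 2 ≠ 0 := by
    have : (3 : ℝ) ≤ (designParams θ c n).compSize n := by exact_mod_cast a6
    linarith
  have b6 : ((designParams θ c n).g : ℝ) ≠ 0 := by exact_mod_cast hP.g_pos.ne'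
  rw [meanDeg]
  field_simp

theorem harmonic_eq_sum (s : ℕ) :
    ∑ j ∈ Finset.range s, 1 / ((j : ℝ) + 1) = ((harmonic s : ℚ) : ℝ) := by
  simp [harmonic]

/-- Rounding is harmless because the harmonic number dominates `log (s + 1)`, and `s + 1` exceeds
the unrounded quotient. -/
theorem log_le_harmonic_of_lt (hθ₀ : 0 < θ) {η : ℝ} (hη : η < θ) : ∀ᶠ n : ℕ in atTop,
    η * Real.log n ≤ ∑ j ∈ Finset.range (designParams θ c n).s, 1 / ((j : ℝ) + 1) := by
  filter_upwards [eventually_rpow_le_numOnes_div hθ₀ hη one_pos, eventually_gt_atTop 0] with n h1 hn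
  have hn' : (0 : ℝ) < n := by exact_mod_cast hn
  rw [harmonic_eq_sum, ← Real.log_rpow hn']
  refine le_trans (Real.log_le_log (by positivity) ?_) (log_add_one_le_harmonic _)
  rw [designParams_s]
  push_cast
  rw [one_mul] at h1
  exact h1.trans (Nat.lt_floor_add_one _).le

theorem tendsto_harmonic_div_log :
    Tendsto (fun s : ℕ => ((harmonic s : ℚ) : ℝ) / Real.log s) atTop (𝓝 1) := by
  have h1 : Tendsto (fun s : ℕ => 1 / Real.log s + 1) atTop (𝓝 (0 + 1)) :=
    (tendsto_log_natCast.const_div_atTop 1).add_const 1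
  rw [zero_add] at h1
  refine tendsto_of_tendsto_of_tendsto_of_le_of_le' tendsto_const_nhds h1 ?_ ?_
  · filter_upwards [tendsto_log_natCast.eventually_gt_atTop 0, eventually_gt_atTop 0] with s h2 h3
    rw [le_div_iff₀ h2, one_mul]
    refine le_trans (Real.log_le_log (by exact_mod_cast h3) ?_) (log_add_one_le_harmonic s)
    push_cast
    linarith
  · filter_upwards [tendsto_log_natCast.eventually_gt_atTop 0] with s h2
    have := harmonic_le_one_add_log s
    rw [div_le_iff₀ h2]
    field_simp
    exact this

theorem tendsto_log_div (hθ₀ : 0 < θ) : Tendsto (fun n : ℕ =>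
    Real.log n / ((numOnes θ n : ℝ) / (designParams θ c n).ℓ)) atTop (𝓝 0) := by
  have h := tendsto_log_div_logFloor.mul (tendsto_logFloor.const_div_atTop 1)
  rw [mul_zero] at h
  refine squeeze_zero' (Eventually.of_forall fun n => div_nonneg (Real.log_natCast_nonneg n)
    (by positivity)) ?_ h
  filter_upwards [eventually_sq_le (c := c) hθ₀, tendsto_logFloor.eventually_gt_atTop 0] with n h1 h2
  calc _ ≤ Real.log n / (logFloor n : ℝ) ^ 2 :=
        div_le_div_of_nonneg_left (Real.log_natCast_nonneg n) (by positivity) h1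
    _ = _ := by field_simp

end Growth

/-! ### Time bound, number of pools, and choice of the constants -/

section Main

variable {θ c : ℝ}

open Polynomial in
/-- A bound for the parameters, if there are at most `C n` coupled pools. -/
noncomputable def paramBound (C : ℕ) : ℕ[X] :=
  6 + (C : ℕ[X]) * X * (X * X + X) + X * X + (C : ℕ[X]) * X + 2 * X

open Polynomial in
theorem paramVal_le {n k C : ℕ} {P : Params} (hP : P.Proper n) (hs : 2 ≤ P.s) (hg : P.g ≤ P.compSize n)
    (hk : k ≤ n) (hℓ : P.ℓ ≤ n) (hp : P.ring * P.p ≤ C * n) (i : ℕ) :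
    paramVal n k P i ≤ (paramBound C).eval n := by
  have hN : P.compSize n ≤ n := by
    rw [← card_compartment_aux hP.compSize_pos (c := 0) (by omega)]
    exact hP.card_le 0 hP.ring_pos
  have hsn := hP.s_le_n
  have hA : P.numAux n ≤ n * n := Nat.mul_le_mul (by omega) hN
  have hp' : P.p ≤ P.ring * P.p := Nat.le_mul_of_pos_left _ hP.ring_pos
  have hL : P.ring * (P.p * (P.numAux n + n)) ≤ C * n * (n * n + n) := by
    rw [← mul_assoc]
    exact Nat.mul_le_mul hp (by omega)
  have hring : P.ring = P.ℓ + P.s - 1 := rfl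
  have hB : (paramBound C).eval n = 6 + C * n * (n * n + n) + n * n + C * n + 2 * n := by
    simp [paramBound]
  rw [hB]
  -- The nonlinear terms become atoms, so that linear arithmetic settles every case.
  generalize C * n * (n * n + n) = z at hL ⊢
  generalize n * n = y at hA ⊢
  rcases i with _ | _ | _ | _ | _ | _ | _ | _ | _ | _ | _ | _ | _ | i <;>
    simp only [paramVal, offOut, offExtra, offCoupled, offLabels] <;> omega

theorem ring_mul_p_le (hc : 0 < c) (n : ℕ) :
    ((designParams θ c n).ring : ℝ) * (designParams θ c n).p ≤ c * numOnes θ n := by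
  rcases Nat.eq_zero_or_pos (designParams θ c n).ring with h | h
  · rw [h, Nat.cast_zero, zero_mul]
    positivity
  · have h' : (0 : ℝ) < (designParams θ c n).ring := by exact_mod_cast h
    rw [mul_comm, ← le_div_iff₀ h', designParams_p]
    exact Nat.floor_le (by positivity)

theorem computesWithin_designParams (hθ₀ : 0 < θ) (hθ₁ : θ < 1) (hc : 0 < c) (a₁ : ℕ) {a₂ : ℕ}
    (ha₂ : 0 < a₂) : ∀ᶠ n : ℕ in atTop,
      ComputesWithin (decoderProg a₁ a₂) n (numOnes θ n) (designParams θ c n)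
        (harmonicThreshold (numOnes θ n) (designParams θ c n) (a₁ / a₂))
        (((decoderCost a₁ a₂).comp (paramBound ⌈c⌉₊)).eval n) := by
  filter_upwards [eventually_pos hθ₀ hθ₁ hc, designParams_proper hθ₀ hθ₁ hc]
    with n ⟨a1, a2, a3, a4, a5, a6, a7, a8⟩ hP
  rw [Polynomial.eval_comp]
  have hk := numOnes_le hθ₁.le a8
  refine computesWithin_decoderProg hP a2 a₁ ha₂ (paramVal_le hP a4 (Nat.div_le_self _ _) hk
    ((designParams_ℓ_le n).trans hk) ?_)
  have h1 : (numOnes θ n : ℝ) ≤ n := by exact_mod_cast hk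
  have h2 : ((designParams θ c n).ring : ℝ) * (designParams θ c n).p ≤ ⌈c⌉₊ * n :=
    (ring_mul_p_le hc n).trans (mul_le_mul (Nat.le_ceil c) h1 (by positivity) (by positivity))
  exact_mod_cast h2

theorem tendsto_threshold_ratio (hθ₀ : 0 < θ) (hθ₁ : θ < 1) (hc : 0 < c) (α : ℝ) :
    Tendsto (fun n => harmonicThreshold (numOnes θ n) (designParams θ c n) α /
      (√((numCoupled (designParams θ c n) : ℝ) / (numOnes θ n : ℝ)) *
        Real.log ((designParams θ c n).s : ℝ))) atTop (𝓝 α) := by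
  have h := (tendsto_harmonic_div_log.comp (tendsto_designParams_s (c := c) hθ₀)).const_mul α
  rw [mul_one] at h
  refine h.congr' ?_
  filter_upwards [eventually_pos hθ₀ hθ₁ hc, designParams_proper hθ₀ hθ₁ hc]
    with n ⟨a1, a2, a3, a4, a5, a6, a7, a8⟩ hP
  have h1 : √((numCoupled (designParams θ c n) : ℝ) / (numOnes θ n : ℝ)) ≠ 0 := by
    have := hP.numCoupled_pos
    positivity
  have h2 : Real.log ((designParams θ c n).s : ℝ) ≠ 0 :=
    (Real.log_pos (by exact_mod_cast (by omega : 1 < (designParams θ c n).s))).ne'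
  rw [harmonicThreshold, harmonic_eq_sum]
  simp only [Function.comp_apply]
  field_simp

/-- The `ℓ` additional pools are `o(k)` and fit into the slack between `c` and `c'`. -/
theorem eventually_card_poolIdx_le (hθ₀ : 0 < θ) (hc : 0 < c) {c' : ℝ} (hcc : c < c') :
    ∀ᶠ n : ℕ in atTop, (Fintype.card (PoolIdx (designParams θ c n)) : ℝ) ≤ c' * numOnes θ n := by
  filter_upwards [(tendsto_designParams_ℓ (c := c) hθ₀).eventually_gt_atTop 0,
    (tendsto_numOnes_div_ℓ (c := c) hθ₀).eventually_ge_atTop (1 / (c' - c))] with n h1 h2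
  have h3 : (0 : ℝ) < (designParams θ c n).ℓ := by exact_mod_cast h1
  rw [div_le_div_iff₀ (by linarith) h3, one_mul] at h2
  have h4 := ring_mul_p_le (θ := θ) hc n
  have h5 : (Fintype.card (PoolIdx (designParams θ c n)) : ℝ) =
      ((designParams θ c n).ring : ℝ) * (designParams θ c n).p + (designParams θ c n).ℓ := by
    simp [PoolIdx]
  rw [h5]
  linarith

/-- With `y = √(2 / c)` the two rate conditions on `α` in `(0, 1)` read `y / √θ < α` and `α < 1 -
y`. This interval is nonempty precisely when `y * (1 + √θ) < √θ`, which is the assumption on `c`. -/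
theorem exists_threshold_constant (hθ₀ : 0 < θ) (hc : 2 * (1 + √θ) ^ 2 / θ < c) :
    ∃ a₁ a₂ : ℕ, 0 < a₂ ∧ (0 : ℝ) < a₁ / a₂ ∧ (a₁ / a₂ : ℝ) < 1 ∧
      1 / θ < (a₁ / a₂ : ℝ) ^ 2 * c / 2 ∧ 1 < (1 - (a₁ / a₂ : ℝ)) ^ 2 * c / 2 := by
  have hr : 0 < √θ := Real.sqrt_pos.2 hθ₀
  have hr2 : √θ ^ 2 = θ := Real.sq_sqrt hθ₀.le
  have hc₀ : 0 < c := lt_trans (by positivity) hc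
  set y := √(2 / c) with hy
  have hy0 : 0 < y := Real.sqrt_pos.2 (by positivity)
  have hy2 : y ^ 2 * c = 2 := by
    rw [hy, Real.sq_sqrt (by positivity)]
    field_simp
  have hlt : y / √θ < 1 - y := by
    have h1 : (y * (1 + √θ)) ^ 2 < √θ ^ 2 := by
      rw [div_lt_iff₀ hθ₀] at hc
      have h2 : y ^ 2 * (2 * (1 + √θ) ^ 2) < y ^ 2 * (c * θ) := by gcongr
      rw [mul_pow, hr2]
      have h3 : y ^ 2 * (c * θ) = 2 * θ := by rw [← mul_assoc, hy2]
      linarith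
    have h2 : y * (1 + √θ) < √θ := lt_of_pow_lt_pow_left₀ 2 hr.le h1
    rw [div_lt_iff₀ hr]
    linarith
  -- A rational `α` is needed, because its numerator and denominator are constants of the program.
  obtain ⟨α, hα, hα'⟩ := exists_rat_btwn hlt
  have hα0 : (0 : ℝ) < α := (by positivity : (0 : ℝ) < y / √θ).trans hα
  have hα0' : 0 < α := by exact_mod_cast hα0
  have hcast : ((α.num.toNat : ℝ) / (α.den : ℝ)) = α := by
    have h1 : ((α.num.toNat : ℤ) : ℝ) = (α.num : ℝ) := by
      rw [Int.toNat_of_nonneg (Rat.num_pos.2 hα0').le]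
    rw [Int.cast_natCast] at h1
    rw [h1]
    exact (Rat.cast_def α).symm
  refine ⟨α.num.toNat, α.den, α.den_pos, ?_⟩
  rw [hcast]
  refine ⟨hα0, by linarith, ?_, ?_⟩
  · have h1 : (y / √θ) ^ 2 * c / 2 = 1 / θ := by
      rw [div_pow, hr2, div_mul_eq_mul_div, hy2]
      field_simp
    rw [← h1]
    gcongr
  · have h1 : y ^ 2 * c / 2 = 1 := by rw [hy2]; norm_num
    have h2 : y ^ 2 * c / 2 < (1 - α) ^ 2 * c / 2 := by
      have : y < 1 - α := by linarith
      gcongr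
    linarith

end Main

end QGT

theorem theorem1 (θ δ : ℝ) (hθ₀ : 0 < θ) (hθ₁ : θ < 1) (hδ : 0 < δ) :
    ∃ (P : ℕ → QGT.Params) (T : ℕ → ℝ) (prog : QGT.RamProg) (q : Polynomial ℕ),
      ((fun n => ((P n).ℓ : ℝ)) =o[atTop] fun n => (QGT.numOnes θ n : ℝ)) ∧
      ((fun n => ((P n).s : ℝ)) =o[atTop] fun n => ((P n).ℓ : ℝ)) ∧
      Tendsto (fun n => (P n).s) atTop atTop ∧
      (∃ α : ℝ, 0 < α ∧ α < 1 ∧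
        Tendsto (fun n => T n /
            (√((QGT.numCoupled (P n) : ℝ) / (QGT.numOnes θ n : ℝ)) * Real.log ((P n).s : ℝ)))
          atTop (𝓝 α)) ∧
      (∀ᶠ n : ℕ in atTop,
        (Fintype.card (QGT.PoolIdx (P n)) : ℝ) ≤
          (1 + δ) * ((1 + √θ) / (1 - √θ)) * (2 * ((1 - θ) / θ) * (QGT.numOnes θ n : ℝ))) ∧
      (∀ᶠ n : ℕ in atTop,
        QGT.ComputesWithin prog n (QGT.numOnes θ n) (P n) (T n) (q.eval n)) ∧
      Tendsto (fun n => QGT.successProb n (QGT.numOnes θ n) (P n) (T n)) atTop (𝓝 1) := by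
  open QGT in
  have hr : 0 < √θ := Real.sqrt_pos.2 hθ₀
  have hr1 : √θ < 1 := by rwa [Real.sqrt_lt' one_pos, one_pow]
  have hr2 : √θ ^ 2 = θ := Real.sq_sqrt hθ₀.le
  have hconst : (1 + √θ) / (1 - √θ) * (2 * ((1 - θ) / θ)) = 2 * (1 + √θ) ^ 2 / θ := by
    have h1 : 1 - √θ ≠ 0 := by linarith
    have h2 : 1 - θ = (1 - √θ) * (1 + √θ) := by linear_combination hr2
    rw [h2]
    field_simp
  set c₀ := 2 * (1 + √θ) ^ 2 / θ with hc₀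
  have hc₀pos : 0 < c₀ := by positivity
  -- Half of `δ` provides the strict inequality needed for the threshold constant, the other half
  -- pays for the pools that measure whole compartments.
  set c := (1 + δ / 2) * c₀ with hcdef
  have hc₀c : c₀ < c := by rw [hcdef]; nlinarith
  have hc : 0 < c := hc₀pos.trans hc₀c
  have hcδ : c < (1 + δ) * c₀ := by rw [hcdef]; nlinarith
  obtain ⟨a₁, a₂, ha₂, hα₀, hα₁, hα, hα'⟩ := exists_threshold_constant hθ₀ hc₀c
  have hℓ : ∀ᶠ n in atTop, 0 < (designParams θ c n).ℓ :=
    (tendsto_designParams_ℓ hθ₀).eventually_gt_atTop 0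
  refine ⟨designParams θ c, fun n => harmonicThreshold (numOnes θ n) (designParams θ c n) (a₁ / a₂),
    decoderProg a₁ a₂, (decoderCost a₁ a₂).comp (paramBound ⌈c⌉₊), ?_, ?_,
    tendsto_designParams_s hθ₀, ⟨a₁ / a₂, hα₀, hα₁, tendsto_threshold_ratio hθ₀ hθ₁ hc _⟩, ?_,
    computesWithin_designParams hθ₀ hθ₁ hc a₁ ha₂, ?_⟩
  · refine (isLittleO_iff_tendsto' ?_).2 ?_
    · filter_upwards [hℓ] with n h1 h2
      exact absurd h2 (Nat.cast_ne_zero.2 (h1.trans_le (designParams_ℓ_le n)).ne')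
    · have := (tendsto_numOnes_div_ℓ (c := c) hθ₀).inv_tendsto_atTop
      exact this.congr fun n => inv_div _ _
  · refine (isLittleO_iff_tendsto' ?_).2 (tendsto_s_div_ℓ hθ₀)
    filter_upwards [hℓ] with n h1 h2
    exact absurd h2 (Nat.cast_ne_zero.2 h1.ne')
  · filter_upwards [eventually_card_poolIdx_le hθ₀ hc hcδ] with n h
    rw [mul_assoc, ← mul_assoc ((1 + √θ) / (1 - √θ)), hconst, ← mul_assoc]
    exact h
  · have hpos := eventually_pos hθ₀ hθ₁ hc
    refine tendsto_successProb hθ₀ hc hα₀ hα₁ hα hα' (designParams_proper hθ₀ hθ₁ hc) ?_ ?_ ?_ ?_ ?_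
      (tendsto_compSize hθ₀ hθ₁) (tendsto_meanDeg hθ₀ hθ₁ hc) (tendsto_g_div hθ₀ hθ₁ hc)
      (tendsto_variance hθ₀ hθ₁ hc) (tendsto_log_div hθ₀)
      fun η hη => log_le_harmonic_of_lt hθ₀ hη
    · filter_upwards [hpos] with n h
      exact Nat.div_lt_self (show 0 < (designParams θ c n).compSize n by omega) (by omega)
    · filter_upwards [hpos] with n h
      exact (designParams_ℓ_le n).trans (numOnes_le hθ₁.le (by omega))
    · filter_upwards [hpos] with n h
      exact h.2.1
    · filter_upwards [hpos] with n h
      exact numOnes_le hθ₁.le (by omega)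
    · exact Eventually.of_forall fun n => numOnes_le_rpow n
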